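/- Let $r\ge 1$ and let $\gamma_1,\dots,\gamma_r\in\mathbb C$ with $\Re\gamma_j>0$ for all $j$. *The zeta-function.* The series $$\zeta_r((s_j);(\gamma_j))=\sum_{n_1,\dots,n_r\ge 1}\ \prod_{j=1}^r (n_1\gamma_1+\cdots+n_j\gamma_j)^{-s_j}$$ (principal powers) converges absolutely for $\Re(s_{r-k+1}+\cdots+s_r)>k$ $(1\le k\le r)$ and has a meromorphic continuation to $\mathbb C^r$, denoted by the same symbol. *The desingularized function.* For $\varepsilon>0$ let $\mathcal C$ be the Hankel contour that comes from $+\infty$ along the real axis to $\varepsilon$ (argument $0$), goes once counterclockwise around the circle $|t|=\varepsilon$, and returns to $+\infty$ along the real axis (argument $2\pi$). Then there is a unique entire function $\zeta_r^{\rm des}((s_j);(\gamma_j))$ on $\mathbb C^r$ such that, for all sufficiently small $\varepsilon$ and all $(s_j)$ with no $s_j$ an integer, $$\zeta_r^{\rm des}((s_j);(\gamma_j))=\lim_{c\to1,\ c\in\mathbb R\setminus\{1\}}\frac{(-1)^r}{(c-1)^r}\prod_{k=1}^r\frac{1}{(e^{2\pi i s_k}-1)\Gamma(s_k)}\int_{\mathcal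 C^r}\prod_{j=1}^r\left(\frac{1}{e^{y_j}-1}-\frac{c}{e^{cy_j}-1}\right)\prod_{k=1}^r t_k^{s_k-1}\,dt_k,\qquad y_j=\gamma_j\sum_{k=j}^r t_k,$$ where the integral converges absolutely for $c$ near $1$, $c \neq 1$. *The coefficients.* Let the integers $a_{\boldsymbol l,\boldsymbol m}$ ($\boldsymbol l\in\mathbb Z_{\ge0}^r$, $\boldsymbol m\in\mathbb Z^r$) be defined by $$\prod_{j=1}^r\Bigl(1-(u_jv_j+\cdots+u_rv_r)(v_j^{-1}-v_{j-1}^{-1})\Bigr)=\sum_{\boldsymbol l,\boldsymbol m}a_{\boldsymbol l,\boldsymbol m}\prod_{j=1}^r u_j^{l_j}v_j^{m_j},\qquad v_0^{-1}:=0.$$ Only finitely many $a_{\boldsymbol l,\boldsymbol m}$ are non-zero, and $a_{\boldsymbol l,\boldsymbol m}\neq0$ implies $m_1+\cdots+m_r=0$. *The identity.* With $(s)_0=1$ and $(s)_k=s(s+1)\cdots(s+k-1)$, $$\zeta_r^{\rm des}((s_j);(\gamma_j))=\sum_{\boldsymbol l,\boldsymbol m}a_{\boldsymbol l,\boldsymbol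 m}\Bigl(\prod_{j=1}^r(s_j)_{l_j}\Bigr)\zeta_r(s_1+m_1,\dots,s_r+m_r;(\gamma_j))$$ on all of $\mathbb C^r$, as an identity of meromorphic functions. That is: the set of points $(s_j)\in\mathbb C^r$ at which every function $\zeta_r(s_1+m_1,\dots,s_r+m_r;(\gamma_j))$ with some $a_{\boldsymbol l,\boldsymbol m}\ne0$ is holomorphic is dense, the identity holds at each of its points, and at every point of $\mathbb C^r$ the right-hand side, restricted to this set, tends to the value of the entire function on the left, so that all singularities of the individual terms cancel in the sum. -/

import Mathlib

open Filter Topology MeasureTheory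

noncomputable section

namespace MultipleZeta

/-! ### Holomorphic and meromorphic functions of several complex variables -/

/-- `f` is holomorphic at `p`: complex differentiable at every point of a neighbourhood of `p`. -/
def HolomorphicAt {r : ℕ} (f : (Fin r → ℂ) → ℂ) (p : Fin r → ℂ) : Prop :=
  ∀ᶠ s in 𝓝 p, DifferentiableAt ℂ f s

/-- `f` represents near `p` the quotient `g / h` of two germs of holomorphic functions, where the
germ of `h` is not zero. (The value of `f` on the zero set of `h` is not prescribed.) -/
def MeromorphicAtPoint {r : ℕ} (f : (Fin r → ℂ) → ℂ) (p : Fin r → ℂ) : Prop :=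
  ∃ g h : (Fin r → ℂ) → ℂ, HolomorphicAt g p ∧ HolomorphicAt h p ∧
    (∃ᶠ s in 𝓝 p, h s ≠ 0) ∧ ∀ᶠ s in 𝓝 p, h s ≠ 0 → f s = g s / h s

/-! ### The multiple zeta-function of the generalized Euler-Zagier type -/

/-- The term `∏_j (n_1 γ_1 + ⋯ + n_j γ_j) ^ (-s_j)` with `n_k = m_k + 1`, so that `m_k` runs
through `ℕ` when `n_k` runs through the positive integers. Powers are principal ones. -/
def zetaTerm {r : ℕ} (γ s : Fin r → ℂ) (m : Fin r → ℕ) : ℂ :=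
  ∏ j : Fin r, (∑ k ∈ Finset.Iic j, ((m k : ℂ) + 1) * γ k) ^ (-s j)

/-- The region of absolute convergence: `Re (s_{r-k+1} + ⋯ + s_r) > k` for `1 ≤ k ≤ r`. The tail
that starts at the index `j` (counted from `0`) has `r - j` terms. -/
def convergenceRegion (r : ℕ) : Set (Fin r → ℂ) :=
  {s | ∀ j : Fin r, (r : ℝ) - (j : ℕ) < (∑ k ∈ Finset.Ici j, s k).re}

/-- `Z` is a meromorphic continuation to `ℂ ^ r` of the multiple zeta-function with parameters
`γ`: it is meromorphic at every point, and on the region of convergence it is the sum of the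
(unconditionally, hence absolutely, convergent) series. -/
structure IsZetaContinuation {r : ℕ} (γ : Fin r → ℂ) (Z : (Fin r → ℂ) → ℂ) : Prop where
  meromorphic : ∀ p, MeromorphicAtPoint Z p
  hasSum : ∀ s ∈ convergenceRegion r, HasSum (zetaTerm γ s) (Z s)

/-! ### The Hankel contour

The contour comes from `+∞` along the real axis (argument `0`) to `ε`, goes once counterclockwise
around the circle of radius `ε` and returns to `+∞` along the real axis (argument `2π`). It is
parametrized by `x : ℝ`: the first ray for `x < 0`, the circle for `0 ≤ x ≤ 2π`, the second ray
for `x > 2π`. -/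

/-- The absolute value of the contour point with parameter `x`. -/
def hankelAbs (ε x : ℝ) : ℝ :=
  if x < 0 then ε - x else if x ≤ 2 * Real.pi then ε else ε + (x - 2 * Real.pi)

/-- The continuous branch of the argument along the contour. -/
def hankelArg (x : ℝ) : ℝ :=
  if x < 0 then 0 else if x ≤ 2 * Real.pi then x else 2 * Real.pi

/-- The continuous branch of the logarithm along the contour. -/
def hankelLog (ε x : ℝ) : ℂ :=
  (Real.log (hankelAbs ε x) : ℂ) + (hankelArg x : ℂ) * Complex.I

/-- The contour point with parameter `x`. -/
def hankelPoint (ε x : ℝ) : ℂ :=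
  (hankelAbs ε x : ℂ) * Complex.exp ((hankelArg x : ℂ) * Complex.I)

/-- The velocity `dt / dx` of the parametrization (off the two corners). -/
def hankelVelocity (ε x : ℝ) : ℂ :=
  if x < 0 then -1
  else if x ≤ 2 * Real.pi then Complex.I * (ε : ℂ) * Complex.exp ((x : ℂ) * Complex.I)
  else 1

/-! ### The desingularized multiple zeta-function -/

/-- `1 / (e ^ y - 1) - c / (e ^ (c y) - 1)`, with its removable singularity at `y = 0` removed. -/
def kernelFactor (c : ℝ) (y : ℂ) : ℂ :=
  if y = 0 then ((c : ℂ) - 1) / 2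
  else 1 / (Complex.exp y - 1) - (c : ℂ) / (Complex.exp ((c : ℂ) * y) - 1)

/-- The generating function `∏_j (1 / (exp (γ_j ∑_{k ≥ j} t_k) - 1) -
c / (exp (c γ_j ∑_{k ≥ j} t_k) - 1))`. -/
def kernel {r : ℕ} (γ : Fin r → ℂ) (c : ℝ) (t : Fin r → ℂ) : ℂ :=
  ∏ j : Fin r, kernelFactor c (γ j * ∑ k ∈ Finset.Ici j, t k)

/-- The integrand `kernel γ c t * ∏_k t_k ^ (s_k - 1) dt_k` on the `r`-fold product of the
Hankel contour, pulled back to `ℝ ^ r`. -/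
def contourIntegrand {r : ℕ} (γ : Fin r → ℂ) (ε c : ℝ) (s : Fin r → ℂ) (x : Fin r → ℝ) : ℂ :=
  kernel γ c (fun k => hankelPoint ε (x k)) *
    ∏ k : Fin r, Complex.exp ((s k - 1) * hankelLog ε (x k)) * hankelVelocity ε (x k)

/-- The expression whose limit for `c → 1` defines the desingularized function. -/
def preDesingularization {r : ℕ} (γ : Fin r → ℂ) (ε c : ℝ) (s : Fin r → ℂ) : ℂ :=
  (-1) ^ r / ((c : ℂ) - 1) ^ r *
    (∏ k : Fin r, 1 / ((Complex.exp (2 * Real.pi * Complex.I * s k) - 1) * Complex.Gamma (s k))) *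
    ∫ x : Fin r → ℝ, contourIntegrand γ ε c s x

/-- `D` is the desingularized multiple zeta-function with parameters `γ`: the entire function which
is given by the limit of the contour integrals over contours of every sufficiently small radius
`ε`, wherever no `s_k` is an integer, that is, wherever the factors
`1 / ((e ^ (2 π i s_k) - 1) Γ(s_k))` are literally defined. The contour integrals are required to
converge absolutely for `c` near `1`. -/
structure IsDesingularization {r : ℕ} (γ : Fin r → ℂ) (D : (Fin r → ℂ) → ℂ) : Prop where
  entire : Differentiable ℂ D
  limit : ∃ ε₀ > 0, ∀ ε : ℝ, 0 < ε → ε < ε₀ → ∀ s : Fin r → ℂ, (∀ k, ∀ n : ℤ, s k ≠ n) →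
    (∀ᶠ c : ℝ in 𝓝[≠] 1, Integrable (contourIntegrand γ ε c s)) ∧
    Tendsto (fun c : ℝ => preDesingularization γ ε c s) (𝓝[≠] 1) (𝓝 (D s))

/-! ### The generating polynomial of the coefficients

Polynomials in `u_j` and Laurent polynomials in `v_j` with integer coefficients form the monoid
algebra over `ℤ` of the additive monoid of the exponents `(l, m)` in `ℕ ^ r × ℤ ^ r`. -/

/-- The ring `ℤ[u_1, …, u_r, v_1^{±1}, …, v_r^{±1}]`. -/
abbrev LaurentRing (r : ℕ) : Type := AddMonoidAlgebra ℤ ((Fin r → ℕ) × (Fin r → ℤ))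

/-- The variable `u_j`. -/
def varU {r : ℕ} (j : Fin r) : LaurentRing r := AddMonoidAlgebra.single (Pi.single j 1, 0) 1

/-- The variable `v_j`. -/
def varV {r : ℕ} (j : Fin r) : LaurentRing r := AddMonoidAlgebra.single (0, Pi.single j 1) 1

/-- The inverse `v_j⁻¹`. -/
def varVInv {r : ℕ} (j : Fin r) : LaurentRing r := AddMonoidAlgebra.single (0, Pi.single j (-1)) 1

/-- The inverse of the previous variable, `v_{j-1}⁻¹`, with the convention `v_0⁻¹ = 0` for the
first index (which is `0` in `Fin r`). -/
def varVInvPrev {r : ℕ} (j : Fin r) : LaurentRing r :=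
  if (j : ℕ) = 0 then 0 else varVInv ⟨(j : ℕ) - 1, lt_of_le_of_lt (Nat.sub_le _ _) j.isLt⟩

/-- `∏_j (1 - (u_j v_j + ⋯ + u_r v_r) (v_j⁻¹ - v_{j-1}⁻¹))`. -/
def generatingPolynomial (r : ℕ) : LaurentRing r :=
  ∏ j : Fin r, (1 - (∑ k ∈ Finset.Ici j, varU k * varV k) * (varVInv j - varVInvPrev j))

/-- The finite set of all `(l, m)` whose coefficient in the generating polynomial is not zero. -/
def exponents (r : ℕ) : Finset ((Fin r → ℕ) × (Fin r → ℤ)) :=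
  (generatingPolynomial r).coeff.support

/-- The coefficient `a_{l,m}` of the generating polynomial. -/
def coefficient (r : ℕ) (l : Fin r → ℕ) (m : Fin r → ℤ) : ℤ :=
  (generatingPolynomial r).coeff (l, m)

/-- The finite sum `∑ a_{l,m} ∏_j (s_j)_{l_j} Z(s_1 + m_1, …, s_r + m_r)`. -/
def shiftedCombination {r : ℕ} (Z : (Fin r → ℂ) → ℂ) (s : Fin r → ℂ) : ℂ :=
  ∑ p ∈ exponents r, (coefficient r p.1 p.2 : ℂ) *
    (∏ j : Fin r, (ascPochhammer ℂ (p.1 j)).eval (s j)) * Z (fun j => s j + (p.2 j : ℂ))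

/-- The set of all `s` such that every shifted function occurring in the finite sum is
holomorphic at `s`. -/
def regularSet {r : ℕ} (Z : (Fin r → ℂ) → ℂ) : Set (Fin r → ℂ) :=
  {s | ∀ p ∈ exponents r, HolomorphicAt Z (fun j => s j + (p.2 j : ℂ))}

end MultipleZeta

end

/-! Put B(y) = y / (e^y - 1). Since 1/(e^y - 1) - c/(e^{cy} - 1) = (B(y) - B(cy)) / y, each factor
of the kernel divided by c - 1 tends to -B'(y) as c → 1, and (-1)^r removes the signs. The
desingularized function is therefore the normalized Hankel integral of G(t) = ∏ B'(y_j)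
(`limitGenerating`). The function B' (`limitKernel`) is holomorphic and exponentially decaying near
the half-lines γ_j · [0, ∞). The mean value inequality in c gives the same decay, with a factor |c -
1|, for the kernels themselves (`exists_kernelFactor_bound`); this yields absolute convergence and
the passage to the limit by dominated convergence (`exists_isDesingularization_normalizedIntegral`).

The normalized integral is entire. In each variable the contour can be collapsed to the half-line
with factor 1/Γ(s) when Re s > 0, while for Re s < 1 the normalizing factor of the contour equals
the holomorphic function Γ(1 - s) e^{-πis} / (2πi). The two descriptions agree for 0 < Re s < 1
(`integral_pathWeight_congr`), and Fubini's theorem allows a change of path in one variable at a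
time (`pathIntegral_congr`).

For large Re s_j everything happens on half-lines. Insert B'(y) = ∑_{n ≥ 1} (1 - n y) e^{-n y}. With
N_k = n_1 γ_1 + ⋯ + n_k γ_k one has ∑ n_j y_j = ∑ N_k t_k, so the exponentials separate, and n_j γ_j
= N_j - N_{j-1} turns ∏ (1 - n_j y_j) into the generating polynomial evaluated at v_j⁻¹ = N_j, u_k
v_k = t_k (`prod_one_sub_eq_sum`). A monomial u^l v^m becomes ∏ (N_j t_j)^{l_j} N_j^{-m_j}, and its
Gamma integral is ∏ (s_j)_{l_j} N_j^{-(s_j + m_j)} (`integral_expansionFactor`). Summation over n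
gives the identity on an open set (`normalizedIntegral_eq_shiftedCombination`), and the identity
theorem for meromorphic functions of several variables (`eq_zero_of_meromorphic`) carries it to all
regular points. These are dense and the left-hand side is continuous, which gives the limits at the
remaining points.

The continuation of the series is obtained by telescoping over the last summation index. The
differences (N - γ)^{-(w-1)} - N^{-(w-1)}, with w the last argument, sum to a series of smaller
depth. Their Taylor expansion in γ consists of (w - 1) γ N^{-w}, terms with larger exponents, and a
remainder that converges further to the left (`tsum_zetaTerm_recursion`). Solving for the leading
term extends the domain step by step (`hasContinuation_succ`), starting from the Riemann zeta
function in depth one. -/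

noncomputable section

namespace MultipleZeta

/-! ### Cauchy estimates, parameter integrals and the identity theorem in several variables. -/

section SeveralVariables

variable {E : Type*} [NormedAddCommGroup E] [NormedSpace ℂ E]

/-- Cauchy's estimate for the Fréchet derivative of a bounded holomorphic function on a ball. -/
lemma norm_fderiv_le_of_norm_le {f : E → ℂ} {x₀ : E} {R C : ℝ} (hR : 0 < R)
    (hf : DifferentiableOn ℂ f (Metric.ball x₀ R)) (hC : ∀ x ∈ Metric.ball x₀ R, ‖f x‖ ≤ C)
    {x : E} (hx : x ∈ Metric.ball x₀ (R / 2)) : ‖fderiv ℂ f x‖ ≤ 4 * C / R := by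
  have hxR : ∀ w : E, ‖w‖ < R / 2 → x + w ∈ Metric.ball x₀ R := by
    intro w hw
    rw [Metric.mem_ball, dist_eq_norm] at hx ⊢
    calc ‖x + w - x₀‖ = ‖(x - x₀) + w‖ := by congr 1; abel
      _ ≤ ‖x - x₀‖ + ‖w‖ := norm_add_le _ _
      _ < R := by linarith
  have hC0 : 0 ≤ C := (norm_nonneg _).trans (hC x (by simpa using hxR 0 (by simpa using by linarith)))
  refine ContinuousLinearMap.opNorm_le_bound _ (by positivity) fun v => ?_
  rcases eq_or_ne v 0 with rfl | hv
  · simp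
  have hv' : 0 < ‖v‖ := norm_pos_iff.mpr hv
  -- With this radius the disc z ↦ x + z v stays within R / 4 of x, hence inside the large ball;
  -- Cauchy's estimate in one variable then divides C by ρ.
  set ρ : ℝ := R / 4 / ‖v‖ with hρ
  have hρ0 : 0 < ρ := by positivity
  have hmem : ∀ z ∈ Metric.closedBall (0 : ℂ) ρ, x + z • v ∈ Metric.ball x₀ R := by
    intro z hz
    apply hxR
    rw [norm_smul]
    have : ‖z‖ ≤ ρ := by simpa using hz
    calc ‖z‖ * ‖v‖ ≤ ρ * ‖v‖ := by gcongr
      _ = R / 4 := by rw [hρ]; field_simp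
      _ < R / 2 := by linarith
  have hd : ∀ z ∈ Metric.closedBall (0 : ℂ) ρ, HasDerivAt (fun z : ℂ => f (x + z • v))
      (fderiv ℂ f (x + z • v) v) z := by
    intro z hz
    have h1 : HasFDerivAt f (fderiv ℂ f (x + z • v)) (x + z • v) :=
      ((hf _ (hmem z hz)).differentiableAt (Metric.isOpen_ball.mem_nhds (hmem z hz))).hasFDerivAt
    have h2 : HasDerivAt (fun z : ℂ => x + z • v) v z := by
      simpa using ((hasDerivAt_id z).smul_const v).const_add x
    exact h1.comp_hasDerivAt z h2
  have hdc : DiffContOnCl ℂ (fun z : ℂ => f (x + z • v)) (Metric.ball 0 ρ) := by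
    apply DifferentiableOn.diffContOnCl
    intro z hz
    exact (hd z (Metric.closure_ball_subset_closedBall hz)).differentiableAt.differentiableWithinAt
  have h := Complex.norm_deriv_le_of_forall_mem_sphere_norm_le hρ0 hdc
    (fun z hz => hC _ (hmem z (Metric.sphere_subset_closedBall hz)))
  rw [(hd 0 (by simp [hρ0.le])).deriv] at h
  simp only [zero_smul, add_zero] at h
  calc ‖fderiv ℂ f x v‖ ≤ C / ρ := h
    _ = 4 * C / R * ‖v‖ := by rw [hρ]; field_simp

/-- A dominated parametric integral of holomorphic functions is holomorphic. -/
lemma differentiableAt_integral_of_dominated [FiniteDimensional ℂ E] {α : Type*}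
    [MeasurableSpace α] {μ : Measure α} {f : E → α → ℂ} {x₀ : E} {R : ℝ} (hR : 0 < R)
    {bound : α → ℝ} (hmeas : ∀ x ∈ Metric.ball x₀ R, AEStronglyMeasurable (f x) μ)
    (hdiff : ∀ a, DifferentiableOn ℂ (fun x => f x a) (Metric.ball x₀ R))
    (hb : ∀ a, ∀ x ∈ Metric.ball x₀ R, ‖f x a‖ ≤ bound a) (hbi : Integrable bound μ) :
    DifferentiableAt ℂ (fun x => ∫ a, f x a ∂μ) x₀ := by
  have hx₀ : x₀ ∈ Metric.ball x₀ R := Metric.mem_ball_self hR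
  have hd : ∀ a, ∀ x ∈ Metric.ball x₀ R, HasFDerivAt (fun x => f x a)
      (fderiv ℂ (fun x => f x a) x) x := fun a x hx =>
    ((hdiff a x hx).differentiableAt (Metric.isOpen_ball.mem_nhds hx)).hasFDerivAt
  -- Each directional derivative is a pointwise limit of difference quotients with steps 1 / (n + n₀
  -- + 1), which are measurable in the parameter; n₀ keeps the points inside the ball. In finite
  -- dimension the directions of a basis suffice for the whole derivative.
  have hmv : ∀ v : E, AEStronglyMeasurable (fun a => fderiv ℂ (fun x => f x a) x₀ v) μ := by
    intro v
    have hev : ∀ᶠ n : ℕ in atTop, x₀ + ((n : ℂ) + 1)⁻¹ • v ∈ Metric.ball x₀ R := by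
      have : Tendsto (fun n : ℕ => x₀ + ((n : ℂ) + 1)⁻¹ • v) atTop (𝓝 x₀) := by
        have h1 : Tendsto (fun n : ℕ => ((n : ℂ) + 1)⁻¹) atTop (𝓝 0) := by
          simpa using tendsto_one_div_add_atTop_nhds_zero_nat (𝕜 := ℂ)
        simpa using (h1.smul (tendsto_const_nhds (x := v))).const_add x₀
      exact this.eventually (Metric.isOpen_ball.mem_nhds hx₀)
    obtain ⟨n₀, hn₀⟩ := eventually_atTop.mp hev
    refine aestronglyMeasurable_of_tendsto_ae (u := atTop)
      (f := fun (n : ℕ) a => ((n + n₀ : ℕ) + 1 : ℂ) * (f (x₀ + (((n + n₀ : ℕ) : ℂ) + 1)⁻¹ • v) a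
        - f x₀ a)) (fun n => ?_) (Eventually.of_forall fun a => ?_)
    · have hn := hmeas _ (hn₀ (n + n₀) (Nat.le_add_left _ _))
      exact (hn.sub (hmeas _ hx₀)).const_mul _
    · have hline : HasDerivAt (fun z : ℂ => f (x₀ + z • v) a)
          (fderiv ℂ (fun x => f x a) x₀ v) 0 := by
        have h2 : HasDerivAt (fun z : ℂ => x₀ + z • v) v 0 := by
          simpa using ((hasDerivAt_id (0 : ℂ)).smul_const v).const_add x₀
        have h1 : HasFDerivAt (fun x => f x a) (fderiv ℂ (fun x => f x a) x₀)
          (x₀ + (0 : ℂ) • v) := by simpa using hd a x₀ hx₀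
        exact h1.comp_hasDerivAt (0 : ℂ) h2
      have hs := hline.tendsto_slope_zero
      have hseq : Tendsto (fun n : ℕ => (((n + n₀ : ℕ) : ℂ) + 1)⁻¹) atTop (𝓝[≠] 0) := by
        refine tendsto_nhdsWithin_iff.mpr ⟨?_, Eventually.of_forall fun n => ?_⟩
        · have h1 : Tendsto (fun n : ℕ => ((n : ℂ) + 1)⁻¹) atTop (𝓝 0) := by
            simpa using tendsto_one_div_add_atTop_nhds_zero_nat (𝕜 := ℂ)
          exact h1.comp (tendsto_add_atTop_nat n₀)
        · exact inv_ne_zero (Nat.cast_add_one_ne_zero _)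
      have := hs.comp hseq
      simpa [Function.comp_def] using this
  have hm' : AEStronglyMeasurable (fun a => fderiv ℂ (fun x => f x a) x₀) μ := by
    let b := Module.finBasis ℂ E
    have heq : (fun a => fderiv ℂ (fun x => f x a) x₀) = fun a => ∑ i,
        (fderiv ℂ (fun x => f x a) x₀ (b i)) • (LinearMap.toContinuousLinearMap (b.coord i)) := by
      funext a
      ext v
      have hv : fderiv ℂ (fun x => f x a) x₀ v =
          fderiv ℂ (fun x => f x a) x₀ (∑ i, b.repr v i • b i) := by rw [b.sum_repr v]
      rw [hv, map_sum]
      simp [mul_comm]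
    rw [heq]
    exact Finset.aestronglyMeasurable_fun_sum _ fun i _ => (hmv (b i)).smul_const _
  exact (hasFDerivAt_integral_of_dominated_of_fderiv_le (s := Metric.ball x₀ (R / 2))
    (F' := fun x a => fderiv ℂ (fun x => f x a) x) (bound := fun a => 4 * bound a / R)
    (Metric.ball_mem_nhds _ (by positivity))
    (eventually_of_mem (Metric.ball_mem_nhds _ hR) hmeas)
    (hbi.mono' (hmeas _ hx₀) (Eventually.of_forall fun a => hb a x₀ hx₀)) hm'
    (Eventually.of_forall fun a x hx => norm_fderiv_le_of_norm_le hR (hdiff a) (hb a) hx)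
    ((hbi.const_mul 4).div_const R)
    (Eventually.of_forall fun a x hx => hd a x
      (Metric.ball_subset_ball (by linarith) hx))).differentiableAt

/-- A normally convergent series of holomorphic functions is holomorphic. -/
lemma differentiableAt_tsum_of_dominated {ι : Type*} {f : ι → E → ℂ} {u : ι → ℝ} {x₀ : E} {R : ℝ}
    (hR : 0 < R) (hu : Summable u) (hdiff : ∀ i, DifferentiableOn ℂ (f i) (Metric.ball x₀ R))
    (hb : ∀ i, ∀ x ∈ Metric.ball x₀ R, ‖f i x‖ ≤ u i) :
    DifferentiableAt ℂ (fun x => ∑' i, f i x) x₀ := by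
  let _ : NormedSpace ℝ E := NormedSpace.restrictScalars ℝ ℂ E
  have hx₀ : x₀ ∈ Metric.ball x₀ R := Metric.mem_ball_self hR
  refine (hasFDerivAt_tsum_of_isPreconnected (u := fun i => 4 * u i / R)
    ((hu.mul_left 4).div_const R) Metric.isOpen_ball
    (convex_ball x₀ (R / 2)).isPreconnected (f' := fun i x => fderiv ℂ (f i) x)
    (fun i x hx => ?_) (fun i x hx => norm_fderiv_le_of_norm_le hR (hdiff i) (hb i) hx)
    (Metric.mem_ball_self (by positivity)) (Summable.of_norm_bounded hu fun i => hb i x₀ hx₀)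
    (Metric.mem_ball_self (by positivity))).differentiableAt
  have hx' := Metric.ball_subset_ball (by linarith : R / 2 ≤ R) hx
  exact ((hdiff i x hx').differentiableAt (Metric.isOpen_ball.mem_nhds hx')).hasFDerivAt

/-- Identity theorem on convex open sets, in any complex normed space. -/
lemma eqOn_zero_of_convex {Ω : Set E} (hΩ : IsOpen Ω)
    (hconv : ∀ x ∈ Ω, ∀ y ∈ Ω, Convex ℝ {z : ℂ | x + z • (y - x) ∈ Ω}) {f : E → ℂ}
    (hf : DifferentiableOn ℂ f Ω) {q : E} (hq : q ∈ Ω) (h0 : ∀ᶠ x in 𝓝 q, f x = 0) :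
    ∀ x ∈ Ω, f x = 0 := by
  intro w hw
  -- Restriction to the complex line through q and w reduces the claim to the identity theorem in
  -- one variable.
  set S : Set ℂ := {z : ℂ | q + z • (w - q) ∈ Ω} with hS
  have hcont : Continuous fun z : ℂ => q + z • (w - q) := by fun_prop
  have hSo : IsOpen S := hΩ.preimage hcont
  have hg : DifferentiableOn ℂ (fun z : ℂ => f (q + z • (w - q))) S := by
    refine hf.comp (t := Ω) ?_ fun z hz => hz
    exact (by fun_prop : Differentiable ℂ fun z : ℂ => q + z • (w - q)).differentiableOn
  have h0' : ∀ᶠ z in 𝓝 (0 : ℂ), f (q + z • (w - q)) = 0 := by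
    have : Tendsto (fun z : ℂ => q + z • (w - q)) (𝓝 0) (𝓝 q) := by
      simpa using hcont.tendsto 0
    exact this.eventually h0
  have := (hg.analyticOnNhd hSo).eqOn_zero_of_preconnected_of_eventuallyEq_zero
    (hconv q hq w hw).isPreconnected (by simpa [hS] using hq : (0 : ℂ) ∈ S) h0'
  simpa using this (by simpa [hS] using hw : (1 : ℂ) ∈ S)

lemma convex_line_preimage [NormedSpace ℝ E] [IsScalarTower ℝ ℂ E] {Ω : Set E}
    (hΩ : Convex ℝ Ω) (x y : E) : Convex ℝ {z : ℂ | x + z • (y - x) ∈ Ω} := by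
  intro z hz w hw a b ha hb hab
  have := hΩ hz hw ha hb hab
  simp only [Set.mem_ofPred_eq]
  convert this using 1
  rw [smul_add, smul_add, add_smul, smul_assoc, smul_assoc]
  have hx : x = a • x + b • x := by rw [← add_smul, hab, one_smul]
  nth_rewrite 1 [hx]
  abel

/-- A product of two holomorphic functions on a convex open set, none of which vanishes identically,
does not vanish identically. -/
lemma exists_mul_ne_zero_of_convex [NormedSpace ℝ E] [IsScalarTower ℝ ℂ E] {Ω : Set E}
    (hΩ : IsOpen Ω) (hconv : Convex ℝ Ω) {f g : E → ℂ} (hf : DifferentiableOn ℂ f Ω)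
    (hg : DifferentiableOn ℂ g Ω) (hf0 : ∃ x ∈ Ω, f x ≠ 0) (hg0 : ∃ x ∈ Ω, g x ≠ 0) :
    ∃ x ∈ Ω, f x * g x ≠ 0 := by
  by_contra! h
  obtain ⟨x, hx, hfx⟩ := hf0
  obtain ⟨y, hy, hgy⟩ := hg0
  refine hgy (eqOn_zero_of_convex hΩ (fun _ _ _ _ => convex_line_preimage hconv _ _) hg hx ?_ y hy)
  have h1 : ∀ᶠ z in 𝓝 x, f z ≠ 0 :=
    (hf.continuousOn.continuousAt (hΩ.mem_nhds hx)).eventually_ne hfx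
  filter_upwards [h1, hΩ.mem_nhds hx] with z hz hzΩ
  exact (mul_eq_zero.mp (h z hzΩ)).resolve_left hz

/-- A holomorphic function on a convex open set that does not vanish identically is non-zero on a
dense subset. -/
lemma frequently_ne_zero_of_convex [NormedSpace ℝ E] [IsScalarTower ℝ ℂ E] {Ω : Set E}
    (hΩ : IsOpen Ω) (hconv : Convex ℝ Ω) {f : E → ℂ} (hf : DifferentiableOn ℂ f Ω)
    (hf0 : ∃ x ∈ Ω, f x ≠ 0) {p : E} (hp : p ∈ Ω) : ∃ᶠ x in 𝓝 p, f x ≠ 0 := by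
  intro h
  obtain ⟨x, hx, hfx⟩ := hf0
  refine hfx (eqOn_zero_of_convex hΩ (fun _ _ _ _ => convex_line_preimage hconv _ _) hf hp ?_ x hx)
  filter_upwards [h] with z hz using not_not.mp hz

end SeveralVariables

/-! ### Meromorphic functions of several variables -/

section Meromorphic

variable {r : ℕ}

lemma HolomorphicAt.add {f g : (Fin r → ℂ) → ℂ} {p : Fin r → ℂ} (hf : HolomorphicAt f p)
    (hg : HolomorphicAt g p) : HolomorphicAt (fun s => f s + g s) p := by
  filter_upwards [hf, hg] with s h1 h2 using h1.add h2

lemma HolomorphicAt.mul {f g : (Fin r → ℂ) → ℂ} {p : Fin r → ℂ} (hf : HolomorphicAt f p)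
    (hg : HolomorphicAt g p) : HolomorphicAt (fun s => f s * g s) p := by
  filter_upwards [hf, hg] with s h1 h2 using h1.mul h2

lemma HolomorphicAt.of_differentiable {f : (Fin r → ℂ) → ℂ} (hf : Differentiable ℂ f)
    (p : Fin r → ℂ) : HolomorphicAt f p :=
  Eventually.of_forall fun s => hf s

/-- Germs of holomorphic functions form an integral domain. This is what makes a common denominator
in a sum of two quotients of germs admissible. -/
lemma HolomorphicAt.frequently_mul_ne_zero {f g : (Fin r → ℂ) → ℂ} {p : Fin r → ℂ}
    (hf : HolomorphicAt f p) (hg : HolomorphicAt g p) (hf0 : ∃ᶠ s in 𝓝 p, f s ≠ 0)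
    (hg0 : ∃ᶠ s in 𝓝 p, g s ≠ 0) : ∃ᶠ s in 𝓝 p, f s * g s ≠ 0 := by
  obtain ⟨R, hR, h⟩ := Metric.eventually_nhds_iff_ball.mp (hf.and hg)
  have hne : ∀ {u : (Fin r → ℂ) → ℂ}, (∃ᶠ s in 𝓝 p, u s ≠ 0) →
      ∃ x ∈ Metric.ball p R, u x ≠ 0 := fun hu =>
    ((hu.and_eventually (Metric.ball_mem_nhds p hR)).exists).imp fun _ hx => ⟨hx.2, hx.1⟩
  have hfd : DifferentiableOn ℂ f (Metric.ball p R) :=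
    fun x hx => (h x hx).1.differentiableWithinAt
  have hgd : DifferentiableOn ℂ g (Metric.ball p R) :=
    fun x hx => (h x hx).2.differentiableWithinAt
  exact frequently_ne_zero_of_convex Metric.isOpen_ball (convex_ball p R) (hfd.mul hgd)
    (exists_mul_ne_zero_of_convex Metric.isOpen_ball (convex_ball p R) hfd hgd (hne hf0) (hne hg0))
    (Metric.mem_ball_self hR)

lemma MeromorphicAtPoint.of_differentiable {f : (Fin r → ℂ) → ℂ} (hf : Differentiable ℂ f)
    (p : Fin r → ℂ) : MeromorphicAtPoint f p :=
  ⟨f, fun _ => 1, .of_differentiable hf p, .of_differentiable (differentiable_const _) p,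
    (Eventually.of_forall fun _ => one_ne_zero).frequently,
    Eventually.of_forall fun s _ => by simp⟩

lemma MeromorphicAtPoint.add {f g : (Fin r → ℂ) → ℂ} {p : Fin r → ℂ}
    (hf : MeromorphicAtPoint f p) (hg : MeromorphicAtPoint g p) :
    MeromorphicAtPoint (fun s => f s + g s) p := by
  obtain ⟨a, b, ha, hb, hb0, hab⟩ := hf
  obtain ⟨c, d, hc, hd, hd0, hcd⟩ := hg
  refine ⟨fun s => a s * d s + c s * b s, fun s => b s * d s, (ha.mul hd).add (hc.mul hb),
    hb.mul hd, hb.frequently_mul_ne_zero hd hb0 hd0, ?_⟩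
  filter_upwards [hab, hcd] with s h1 h2 hs
  have hbs := left_ne_zero_of_mul hs
  have hds := right_ne_zero_of_mul hs
  rw [h1 hbs, h2 hds]
  field_simp

lemma MeromorphicAtPoint.mul_left {f g : (Fin r → ℂ) → ℂ} {p : Fin r → ℂ}
    (hf : HolomorphicAt f p) (hg : MeromorphicAtPoint g p) :
    MeromorphicAtPoint (fun s => f s * g s) p := by
  obtain ⟨c, d, hc, hd, hd0, hcd⟩ := hg
  refine ⟨fun s => f s * c s, d, hf.mul hc, hd, hd0, ?_⟩
  filter_upwards [hcd] with s h hs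
  rw [h hs, mul_div_assoc]

lemma MeromorphicAtPoint.sum {ι : Type*} {t : Finset ι} {f : ι → (Fin r → ℂ) → ℂ}
    {p : Fin r → ℂ} (hf : ∀ i ∈ t, MeromorphicAtPoint (f i) p) :
    MeromorphicAtPoint (fun s => ∑ i ∈ t, f i s) p := by
  classical
  induction t using Finset.induction_on with
  | empty => simpa using MeromorphicAtPoint.of_differentiable (differentiable_const (0 : ℂ)) p
  | insert i t hi ih =>
    simp_rw [Finset.sum_insert hi]
    exact (hf i (Finset.mem_insert_self _ _)).add
      (ih fun j hj => hf j (Finset.mem_insert_of_mem hj))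

lemma HolomorphicAt.comp_add_const {f : (Fin r → ℂ) → ℂ} {p a : Fin r → ℂ}
    (hf : HolomorphicAt f (p + a)) : HolomorphicAt (fun s => f (s + a)) p := by
  have : Tendsto (fun s : Fin r → ℂ => s + a) (𝓝 p) (𝓝 (p + a)) :=
    (continuous_id.add continuous_const).tendsto p
  filter_upwards [this.eventually hf] with s hs
  exact DifferentiableAt.comp s hs (by fun_prop)

lemma MeromorphicAtPoint.comp_add_const {f : (Fin r → ℂ) → ℂ} {p a : Fin r → ℂ}
    (hf : MeromorphicAtPoint f (p + a)) : MeromorphicAtPoint (fun s => f (s + a)) p := by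
  obtain ⟨c, d, hc, hd, hd0, hcd⟩ := hf
  have hmap : map (fun s : Fin r → ℂ => s + a) (𝓝 p) = 𝓝 (p + a) :=
    (Homeomorph.addRight a).map_nhds_eq p
  refine ⟨fun s => c (s + a), fun s => d (s + a), hc.comp_add_const, hd.comp_add_const, ?_, ?_⟩
  · rw [← hmap] at hd0
    exact frequently_map.mp hd0
  · rw [← hmap] at hcd
    exact eventually_map.mp hcd

/-- The points at which a meromorphic function is holomorphic are dense. -/
lemma dense_holomorphicAt {f : (Fin r → ℂ) → ℂ} (hf : ∀ p, MeromorphicAtPoint f p) :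
    Dense {s | HolomorphicAt f s} := by
  intro p
  rw [mem_closure_iff_frequently]
  obtain ⟨c, d, hc, hd, hd0, hcd⟩ := hf p
  have key : ∀ᶠ s in 𝓝 p, d s ≠ 0 → HolomorphicAt f s := by
    filter_upwards [hc.eventually_nhds, hd.eventually_nhds, hcd.eventually_nhds] with s h1 h2 h3 h4
    have h5 : ∀ᶠ x in 𝓝 s, d x ≠ 0 := h2.self_of_nhds.continuousAt.eventually_ne h4
    have h6 : f =ᶠ[𝓝 s] fun x => c x / d x := by
      filter_upwards [h3, h5] with x h7 h8 using h7 h8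
    filter_upwards [h1, h2, h5, h6.eventuallyEq_nhds] with x g1 g2 g3 g4
    have g5 : DifferentiableAt ℂ (fun x => c x * (d x)⁻¹) x := g1.mul (g2.inv g3)
    exact g5.congr_of_eventuallyEq (g4.trans (Eventually.of_forall fun y => div_eq_mul_inv _ _))
  exact (hd0.and_eventually key).mono fun s hs => hs.2 hs.1

lemma isOpen_holomorphicAt (f : (Fin r → ℂ) → ℂ) : IsOpen {s | HolomorphicAt f s} := by
  rw [isOpen_iff_mem_nhds]
  intro s hs
  exact hs.eventually_nhds

/-- A function that is meromorphic on `ℂ ^ r` and vanishes on a non-empty open set vanishes at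
every point at which it is continuous. -/
lemma eq_zero_of_meromorphic {f : (Fin r → ℂ) → ℂ} (hf : ∀ p, MeromorphicAtPoint f p)
    {q : Fin r → ℂ} (hq : ∀ᶠ s in 𝓝 q, f s = 0) {p : Fin r → ℂ} (hp : ContinuousAt f p) :
    f p = 0 := by
  -- The closure of N is shown to be open, hence everything. Near a limit point f = c / d off the
  -- zeros of d; the numerator c vanishes near a point of N, so on a whole ball. The values of f on
  -- d = 0 are arbitrary, so only density of N results, and continuity at p is needed to conclude.
  set N : Set (Fin r → ℂ) := {y | ∀ᶠ z in 𝓝 y, f z = 0} with hN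
  have hopen : IsOpen (closure N) := by
    rw [isOpen_iff_mem_nhds]
    intro s hs
    obtain ⟨c, d, hc, hd, hd0, hcd⟩ := hf s
    obtain ⟨R, hR, h⟩ := Metric.eventually_nhds_iff_ball.mp (hc.and (hd.and hcd.eventually_nhds))
    have hB := Metric.isOpen_ball (x := s) (ε := R)
    have hBc := convex_ball s R
    have hcD : DifferentiableOn ℂ c (Metric.ball s R) :=
      fun x hx => (h x hx).1.differentiableWithinAt
    have hdD : DifferentiableOn ℂ d (Metric.ball s R) :=
      fun x hx => (h x hx).2.1.differentiableWithinAt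
    have hd1 : ∃ x ∈ Metric.ball s R, d x ≠ 0 :=
      ((hd0.and_eventually (Metric.ball_mem_nhds s hR)).exists).imp fun _ hx => ⟨hx.2, hx.1⟩
    have hdd : ∀ x ∈ Metric.ball s R, ∃ᶠ y in 𝓝 x, d y ≠ 0 := fun x hx =>
      frequently_ne_zero_of_convex hB hBc hdD hd1 hx
    obtain ⟨y, hyB, hyN⟩ := mem_closure_iff.mp hs _ hB (Metric.mem_ball_self hR)
    have hyN' : ∀ᶠ z in 𝓝 y, f z = 0 := hyN
    have hc0 : ∀ᶠ x in 𝓝 y, c x = 0 := by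
      filter_upwards [hyN'.eventually_nhds, hB.mem_nhds hyB] with x hx hxB
      by_contra hcx
      have e1 : ∀ᶠ z in 𝓝 x, c z ≠ 0 := (h x hxB).1.continuousAt.eventually_ne hcx
      obtain ⟨z, hz, hz1, hz2, hz3⟩ :=
        ((hdd x hxB).and_eventually (e1.and (hx.and (h x hxB).2.2))).exists
      rw [hz2] at hz3
      exact (div_ne_zero hz1 hz) (hz3 hz).symm
    have hcB := eqOn_zero_of_convex hB (fun _ _ _ _ => convex_line_preimage hBc _ _) hcD hyB hc0
    refine mem_of_superset (Metric.ball_mem_nhds s hR) fun x hx => ?_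
    rw [mem_closure_iff_frequently]
    refine ((hdd x hx).and_eventually (hB.mem_nhds hx)).mono fun z hz => ?_
    have hdz : ∀ᶠ w in 𝓝 z, d w ≠ 0 := (h z hz.2).2.1.continuousAt.eventually_ne hz.1
    show ∀ᶠ w in 𝓝 z, f w = 0
    filter_upwards [hdz, (h z hz.2).2.2, hB.mem_nhds hz.2] with w h1 h2 h3
    rw [h2 h1, hcB w h3, zero_div]
  have huniv : closure N = Set.univ :=
    IsClopen.eq_univ ⟨isClosed_closure, hopen⟩ ⟨q, subset_closure hq⟩
  by_contra hfp
  have hpN : p ∈ closure N := huniv ▸ Set.mem_univ p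
  rw [mem_closure_iff_frequently] at hpN
  obtain ⟨y, hy, hy'⟩ := (hpN.and_eventually (hp.eventually_ne hfp)).exists
  have hy2 : ∀ᶠ z in 𝓝 y, f z = 0 := hy
  exact hy' hy2.self_of_nhds

end Meromorphic

/-! ### Absolute convergence of the multiple zeta series -/

section FinSums

variable {M : Type*} [AddCommMonoid M] {r : ℕ}

lemma sum_Ici_succ (f : Fin (r + 1) → M) (j : Fin r) :
    ∑ k ∈ Finset.Ici j.succ, f k = ∑ k ∈ Finset.Ici j, f k.succ := by
  rw [← Fin.map_succEmb_Ici, Finset.sum_map]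
  rfl

lemma sum_Ici_zero (f : Fin (r + 1) → M) : ∑ k ∈ Finset.Ici 0, f k = ∑ k, f k := by
  congr 1
  ext k
  simp

lemma sum_Ici_castSucc (f : Fin (r + 1) → M) (j : Fin r) :
    ∑ k ∈ Finset.Ici j.castSucc, f k = ∑ k ∈ Finset.Ici j, f k.castSucc + f (Fin.last r) := by
  have h1 : ∀ {n : ℕ} (i : Fin n), Finset.Ici i = Finset.univ.filter (i ≤ ·) := by
    intro n i
    ext k
    simp
  rw [h1, h1, Finset.sum_filter, Finset.sum_filter, Fin.sum_univ_castSucc]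
  simp [Fin.le_last]

lemma sum_Ici_last (f : Fin (r + 1) → M) : ∑ k ∈ Finset.Ici (Fin.last r), f k = f (Fin.last r) := by
  have : Finset.Ici (Fin.last r) = {Fin.last r} := by
    ext k
    simp [Fin.last_le_iff]
  rw [this, Finset.sum_singleton]

lemma sum_Iic_castSucc (f : Fin (r + 1) → M) (j : Fin r) :
    ∑ k ∈ Finset.Iic j.castSucc, f k = ∑ k ∈ Finset.Iic j, f k.castSucc := by
  rw [← Fin.map_castSuccEmb_Iic, Finset.sum_map]
  rfl

lemma sum_Iic_last (f : Fin (r + 1) → M) :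
    ∑ k ∈ Finset.Iic (Fin.last r), f k = ∑ k, f k := by
  congr 1
  ext k
  simp [Fin.le_last]

end FinSums

/-- Abel summation: a linear combination of a non-negative non-decreasing sequence with
coefficients whose tails are non-negative is non-negative. -/
lemma sum_mul_nonneg_of_tails : ∀ {r : ℕ} (d L : Fin r → ℝ),
    (∀ j, 0 ≤ ∑ k ∈ Finset.Ici j, d k) → Monotone L → (∀ j, 0 ≤ L j) → 0 ≤ ∑ j, d j * L j := by
  intro r
  induction r with
  | zero => intro d L _ _ _; simp
  | succ r ih =>
    intro d L hd hL hL0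
    -- Subtracting L 0 keeps the later values non-negative and monotone; what is removed adds up,
    -- together with the first summand, to L 0 times the sum of all d j.
    have h1 := ih (fun j => d j.succ) (fun j => L j.succ - L 0)
      (fun j => by rw [← sum_Ici_succ]; exact hd _)
      (fun i j hij => by
        have := hL (Fin.succ_le_succ_iff.mpr hij)
        simpa using this)
      (fun j => sub_nonneg.mpr (hL (Fin.zero_le _)))
    have h2 := mul_nonneg (hd 0) (hL0 0)
    rw [sum_Ici_zero, Fin.sum_univ_succ] at h2
    rw [Fin.sum_univ_succ]
    simp only [mul_sub, Finset.sum_sub_distrib, ← Finset.sum_mul] at h1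
    linarith [add_mul (d 0) (∑ i : Fin r, d i.succ) (L 0)]

/-- The partial sums `n_1 + ⋯ + n_j`, with `n_k = m_k + 1`. -/
def partialCount {r : ℕ} (m : Fin r → ℕ) (j : Fin r) : ℝ := ∑ k ∈ Finset.Iic j, ((m k : ℝ) + 1)

/-- The partial sums `n_1 γ_1 + ⋯ + n_j γ_j`, with `n_k = m_k + 1`. -/
def partialSum {r : ℕ} (γ : Fin r → ℂ) (m : Fin r → ℕ) (j : Fin r) : ℂ :=
  ∑ k ∈ Finset.Iic j, ((m k : ℂ) + 1) * γ k

lemma add_one_le_partialCount {r : ℕ} (m : Fin r → ℕ) (j : Fin r) :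
    (m j : ℝ) + 1 ≤ partialCount m j :=
  Finset.single_le_sum (f := fun k => (m k : ℝ) + 1) (fun k _ => by positivity)
    (Finset.mem_Iic.mpr le_rfl)

lemma one_le_partialCount {r : ℕ} (m : Fin r → ℕ) (j : Fin r) : 1 ≤ partialCount m j :=
  le_trans (by simp) (add_one_le_partialCount m j)

lemma partialCount_pos {r : ℕ} (m : Fin r → ℕ) (j : Fin r) : 0 < partialCount m j :=
  zero_lt_one.trans_le (one_le_partialCount m j)

lemma partialCount_mono {r : ℕ} (m : Fin r → ℕ) : Monotone (partialCount m) := by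
  intro i j hij
  exact Finset.sum_le_sum_of_subset_of_nonneg (Finset.Iic_subset_Iic.mpr hij)
    fun k _ _ => by positivity

/-- Take logarithms: the numbers σ_j - (1 + δ/r) have non-negative tails and the logarithms of the
partial counts increase, so Abel summation replaces every σ_j by 1 + δ/r. Then n_1 + ⋯ + n_j ≥ n_j
separates the variables, and a product of convergent one-variable series dominates. -/
lemma prod_partialCount_rpow_le {r : ℕ} {σ : Fin r → ℝ} {δ : ℝ} (hδ : 0 < δ)
    (hσ : ∀ j : Fin r, (r : ℝ) - (j : ℕ) + δ ≤ ∑ k ∈ Finset.Ici j, σ k) (m : Fin r → ℕ) :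
    ∏ j, partialCount m j ^ (-σ j) ≤ ∏ j, ((m j : ℝ) + 1) ^ (-(1 + δ / r)) := by
  have hlog : ∀ j, 0 ≤ Real.log (partialCount m j) := fun j =>
    Real.log_nonneg (one_le_partialCount m j)
  have h1 := sum_mul_nonneg_of_tails (fun j => σ j - (1 + δ / r))
    (fun j => Real.log (partialCount m j)) (fun j => by
      have hr : (0 : ℝ) < r := by exact_mod_cast lt_of_le_of_lt (Nat.zero_le _) j.isLt
      have hj : ((j : ℕ) : ℝ) ≤ r := by exact_mod_cast j.isLt.le
      rw [Finset.sum_sub_distrib, Finset.sum_const, Fin.card_Ici, nsmul_eq_mul,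
        Nat.cast_sub j.isLt.le]
      have h2 : ((r : ℝ) - (j : ℕ)) * (1 + δ / r) ≤ r - (j : ℕ) + δ := by
        have : ((r : ℝ) - (j : ℕ)) * (δ / r) ≤ δ := by
          calc ((r : ℝ) - (j : ℕ)) * (δ / r) ≤ r * (δ / r) := by
                gcongr
                linarith [Nat.cast_nonneg (α := ℝ) (j : ℕ)]
            _ = δ := by field_simp
        linarith
      linarith [hσ j])
    (fun i j hij => Real.log_le_log (partialCount_pos m i) (partialCount_mono m hij)) hlog
  have h2 : ∀ j, ((m j : ℝ) + 1) ^ (-(1 + δ / r))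
      = Real.exp (Real.log ((m j : ℝ) + 1) * (-(1 + δ / r))) := fun j =>
    Real.rpow_def_of_pos (by positivity) _
  have h3 : ∀ j, partialCount m j ^ (-σ j) = Real.exp (Real.log (partialCount m j) * (-σ j)) :=
    fun j => Real.rpow_def_of_pos (partialCount_pos m j) _
  simp_rw [h2, h3, ← Real.exp_sum]
  rw [Real.exp_le_exp]
  have h4 : ∑ j, Real.log ((m j : ℝ) + 1) * (1 + δ / r)
      ≤ ∑ j, Real.log (partialCount m j) * (1 + δ / r) :=
    Finset.sum_le_sum fun j _ => mul_le_mul_of_nonneg_right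
      (Real.log_le_log (by positivity) (add_one_le_partialCount m j)) (by positivity)
  simp only [sub_mul, Finset.sum_sub_distrib, mul_neg, Finset.sum_neg_distrib] at h1 ⊢
  have h5 : ∑ j, (1 + δ / r) * Real.log (partialCount m j)
    = ∑ j, Real.log (partialCount m j) * (1 + δ / r) := Finset.sum_congr rfl fun _ _ => mul_comm _ _
  have h6 : ∑ j, σ j * Real.log (partialCount m j)
    = ∑ j, Real.log (partialCount m j) * σ j := Finset.sum_congr rfl fun _ _ => mul_comm _ _
  linarith

lemma summable_prod_pi {r : ℕ} {f : ℕ → ℝ} (hf0 : ∀ n, 0 ≤ f n) (hf : Summable f) :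
    Summable fun m : Fin r → ℕ => ∏ j, f (m j) := by
  induction r with
  | zero => exact Summable.of_finite
  | succ r ih =>
    rw [← (Fin.consEquiv fun _ : Fin (r + 1) => ℕ).summable_iff]
    have := hf.mul_of_nonneg ih hf0 fun m => Finset.prod_nonneg fun j _ => hf0 _
    refine this.congr fun p => ?_
    simp [Fin.prod_univ_succ, Fin.consEquiv]

lemma summable_prod_rpow {r : ℕ} {κ : ℝ} (hκ : 1 < κ) :
    Summable fun m : Fin r → ℕ => ∏ j, ((m j : ℝ) + 1) ^ (-κ) := by
  refine summable_prod_pi (f := fun n => ((n : ℝ) + 1) ^ (-κ)) (fun n => by positivity) ?_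
  have := (summable_nat_add_iff 1).mpr (Real.summable_one_div_nat_rpow.mpr hκ)
  refine this.congr fun n => ?_
  rw [Real.rpow_neg (by positivity), one_div]
  push_cast
  rfl

/-- The region of convergence, translated by `n` in the last coordinate. -/
def shiftedRegion (r n : ℕ) : Set (Fin r → ℂ) :=
  {s | ∀ j : Fin r, (r : ℝ) - (j : ℕ) < (∑ k ∈ Finset.Ici j, s k).re + n}

lemma shiftedRegion_zero (r : ℕ) : shiftedRegion r 0 = convergenceRegion r := by
  simp [shiftedRegion, convergenceRegion]

lemma isOpen_shiftedRegion (r n : ℕ) : IsOpen (shiftedRegion r n) := by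
  simp only [shiftedRegion, Set.ofPred_forall]
  exact isOpen_iInter_of_finite fun j => isOpen_lt continuous_const (by fun_prop)

lemma isOpen_convergenceRegion (r : ℕ) : IsOpen (convergenceRegion r) :=
  shiftedRegion_zero r ▸ isOpen_shiftedRegion r 0

lemma convex_shiftedRegion (r n : ℕ) : Convex ℝ (shiftedRegion r n) := by
  intro x hx y hy a b ha hb hab j
  have h1 := hx j
  have h2 := hy j
  have h3 : (∑ k ∈ Finset.Ici j, (a • x + b • y) k).re
      = a * (∑ k ∈ Finset.Ici j, x k).re + b * (∑ k ∈ Finset.Ici j, y k).re := by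
    simp [Finset.sum_add_distrib, Finset.mul_sum]
  rw [h3]
  rcases ha.eq_or_lt with rfl | ha'
  · have : b = 1 := by linarith
    subst this
    linarith
  · have hb' : b = 1 - a := by linarith
    subst hb'
    nlinarith [mul_lt_mul_of_pos_left h1 ha', mul_le_mul_of_nonneg_left h2.le hb]

lemma shiftedRegion_mono (r : ℕ) {n n' : ℕ} (h : n ≤ n') :
    shiftedRegion r n ⊆ shiftedRegion r n' := by
  intro s hs j
  have : (n : ℝ) ≤ n' := by exact_mod_cast h
  linarith [hs j]

lemma convergenceRegion_subset (r n : ℕ) : convergenceRegion r ⊆ shiftedRegion r n :=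
  shiftedRegion_zero r ▸ shiftedRegion_mono r (Nat.zero_le n)

lemma exists_mem_shiftedRegion {r : ℕ} (s : Fin r → ℂ) : ∃ n, s ∈ shiftedRegion r n := by
  obtain ⟨n, hn⟩ := exists_nat_gt (∑ j : Fin r, |(r : ℝ) - (j : ℕ) - (∑ k ∈ Finset.Ici j, s k).re|)
  refine ⟨n, fun j => ?_⟩
  have := Finset.single_le_sum
    (f := fun j : Fin r => |(r : ℝ) - (j : ℕ) - (∑ k ∈ Finset.Ici j, s k).re|)
    (fun _ _ => abs_nonneg _) (Finset.mem_univ j)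
  have h2 := le_abs_self ((r : ℝ) - (j : ℕ) - (∑ k ∈ Finset.Ici j, s k).re)
  linarith

lemma convergenceRegion_nonempty (r : ℕ) : (convergenceRegion r).Nonempty := by
  refine ⟨fun _ => 2, fun j => ?_⟩
  have hj : ((j : ℕ) : ℝ) < r := by exact_mod_cast j.isLt
  rw [Finset.sum_const, Fin.card_Ici, nsmul_eq_mul, Nat.cast_sub j.isLt.le]
  have : (((r : ℂ) - ((j : ℕ) : ℂ)) * 2).re = ((r : ℝ) - (j : ℕ)) * 2 := by simp
  rw [this]
  linarith

/-- Every point of the region has a ball on which the defining inequalities hold uniformly. -/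
lemma exists_uniform_ball {r n : ℕ} {s₀ : Fin r → ℂ} (hs₀ : s₀ ∈ shiftedRegion r n) :
    ∃ δ > 0, ∃ R > 0, ∀ s ∈ Metric.ball s₀ R, ∀ j : Fin r,
      (r : ℝ) - (j : ℕ) + δ ≤ (∑ k ∈ Finset.Ici j, s k).re + n := by
  have h1 : ∀ᶠ δ : ℝ in 𝓝[>] 0, ∀ j : Fin r,
      (r : ℝ) - (j : ℕ) + δ < (∑ k ∈ Finset.Ici j, s₀ k).re + n := by
    rw [eventually_all]
    intro j
    apply eventually_nhdsWithin_of_eventually_nhds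
    have : Tendsto (fun δ : ℝ => (r : ℝ) - (j : ℕ) + δ) (𝓝 0) (𝓝 ((r : ℝ) - (j : ℕ) + 0)) :=
      tendsto_id.const_add _
    exact this.eventually_lt_const (by simpa using hs₀ j)
  obtain ⟨δ, hδ, hδ0⟩ := (h1.and self_mem_nhdsWithin).exists
  have h2 : ∀ᶠ s in 𝓝 s₀, ∀ j : Fin r,
      (r : ℝ) - (j : ℕ) + δ < (∑ k ∈ Finset.Ici j, s k).re + n := by
    rw [eventually_all]
    intro j
    have : Continuous fun s : Fin r → ℂ => (∑ k ∈ Finset.Ici j, s k).re + n := by fun_prop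
    exact this.continuousAt.eventually_const_lt (hδ j)
  obtain ⟨R, hR, h⟩ := Metric.eventually_nhds_iff_ball.mp h2
  exact ⟨δ, hδ0, R, hR, fun s hs j => (h s hs j).le⟩

/-- The growth condition on the terms of a series that yields its normal convergence on
compact subsets of a translate of the region of convergence. -/
def TermBound {r : ℕ} (e : Fin r → ℝ) (f : (Fin r → ℂ) → (Fin r → ℕ) → ℂ) : Prop :=
  ∀ R : ℝ, ∃ M : ℝ, 0 ≤ M ∧ ∀ s, ‖s‖ ≤ R → ∀ m,
    ‖f s m‖ ≤ M * ∏ j, partialCount m j ^ (-((s j).re + e j))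

section TermBound

variable {r n : ℕ} {e : Fin r → ℝ} {f : (Fin r → ℂ) → (Fin r → ℕ) → ℂ}

lemma TermBound.exists_summable (hf : TermBound e f)
    (he : ∀ j, (n : ℝ) ≤ ∑ k ∈ Finset.Ici j, e k) {s₀ : Fin r → ℂ}
    (hs₀ : s₀ ∈ shiftedRegion r n) :
    ∃ u : (Fin r → ℕ) → ℝ, Summable u ∧ ∃ R > 0, ∀ m, ∀ s ∈ Metric.ball s₀ R, ‖f s m‖ ≤ u m := by
  obtain ⟨δ, hδ, R, hR, h⟩ := exists_uniform_ball hs₀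
  obtain ⟨M, hM, hb⟩ := hf (‖s₀‖ + R)
  refine ⟨fun m => M * ∏ j, ((m j : ℝ) + 1) ^ (-(1 + δ / r)), ?_, R, hR, fun m s hs => ?_⟩
  · rcases Nat.eq_zero_or_pos r with rfl | hr
    · exact Summable.of_finite
    · refine (summable_prod_rpow ?_).mul_left M
      have : (0 : ℝ) < r := by exact_mod_cast hr
      have : 0 < δ / r := by positivity
      linarith
  · have hs' : ‖s‖ ≤ ‖s₀‖ + R := by
      have h1 : ‖s - s₀‖ < R := by rwa [Metric.mem_ball, dist_eq_norm] at hs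
      calc ‖s‖ = ‖s₀ + (s - s₀)‖ := by congr 1; abel
        _ ≤ ‖s₀‖ + ‖s - s₀‖ := norm_add_le _ _
        _ ≤ _ := by linarith
    refine (hb s hs' m).trans (mul_le_mul_of_nonneg_left
      (prod_partialCount_rpow_le hδ (fun j => ?_) m) hM)
    have h1 := h s hs j
    rw [Complex.re_sum] at h1
    rw [Finset.sum_add_distrib]
    linarith [he j]

lemma TermBound.summable (hf : TermBound e f)
    (he : ∀ j, (n : ℝ) ≤ ∑ k ∈ Finset.Ici j, e k) {s : Fin r → ℂ}
    (hs : s ∈ shiftedRegion r n) : Summable (f s) := by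
  obtain ⟨u, hu, R, hR, h⟩ := hf.exists_summable he hs
  exact Summable.of_norm_bounded hu fun m => h m s (Metric.mem_ball_self hR)

lemma TermBound.differentiableOn_tsum (hf : TermBound e f)
    (he : ∀ j, (n : ℝ) ≤ ∑ k ∈ Finset.Ici j, e k) (hd : ∀ m, Differentiable ℂ fun s => f s m) :
    DifferentiableOn ℂ (fun s => ∑' m, f s m) (shiftedRegion r n) := by
  intro s hs
  obtain ⟨u, hu, R, hR, h⟩ := hf.exists_summable he hs
  exact (differentiableAt_tsum_of_dominated (f := fun m s => f s m) hR hu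
    (fun m => (hd m).differentiableOn) h).differentiableWithinAt

end TermBound

/-- The modulus of z^{-w} is |z|^{-Re w} e^{arg z · Im w}. The argument costs at most e^{πR}, and
replacing |z| by the comparable S costs at most A^R, whatever the sign of Re w. -/
lemma norm_cpow_neg_le {z w : ℂ} {S A : ℝ} (hS : 0 < S) (hA : 1 ≤ A) (h1 : S ≤ A * ‖z‖)
    (h2 : ‖z‖ ≤ A * S) {R : ℝ} (hw : ‖w‖ ≤ R) :
    ‖z ^ (-w)‖ ≤ A ^ R * Real.exp (Real.pi * R) * S ^ (-w.re) := by
  have hA0 : 0 < A := by linarith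
  have hz0 : 0 < ‖z‖ := by
    by_contra hcon
    have : A * ‖z‖ ≤ 0 := mul_nonpos_of_nonneg_of_nonpos hA0.le (not_lt.mp hcon)
    linarith
  have hz : z ≠ 0 := norm_pos_iff.mp hz0
  have hre : |w.re| ≤ R := (Complex.abs_re_le_norm w).trans hw
  have him : |w.im| ≤ R := (Complex.abs_im_le_norm w).trans hw
  rw [Complex.norm_cpow_of_ne_zero hz, div_eq_mul_inv, ← Real.exp_neg]
  have hexp : Real.exp (-(z.arg * (-w).im)) ≤ Real.exp (Real.pi * R) := by
    rw [Real.exp_le_exp]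
    calc -(z.arg * (-w).im) ≤ |z.arg| * |w.im| := by
          rw [← abs_mul]
          refine le_trans (le_of_eq ?_) (le_abs_self _)
          simp
      _ ≤ Real.pi * R := mul_le_mul (Complex.abs_arg_le_pi z) him (abs_nonneg _) Real.pi_pos.le
  have hpow : ‖z‖ ^ (-w).re ≤ A ^ R * S ^ (-w.re) := by
    have hq : ‖z‖ ^ (-w.re) = (‖z‖ / S) ^ (-w.re) * S ^ (-w.re) := by
      rw [← Real.mul_rpow (by positivity) hS.le]
      congr 1
      field_simp
    rw [Complex.neg_re, hq]
    refine mul_le_mul_of_nonneg_right ?_ (by positivity)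
    have hR0 : 0 ≤ R := (norm_nonneg w).trans hw
    have hqpos : 0 < ‖z‖ / S := by positivity
    rcases le_total 1 (‖z‖ / S) with hq1 | hq1
    · calc (‖z‖ / S) ^ (-w.re) ≤ (‖z‖ / S) ^ R :=
            Real.rpow_le_rpow_of_exponent_le hq1 (by linarith [neg_abs_le w.re])
        _ ≤ A ^ R := Real.rpow_le_rpow hqpos.le (by rw [div_le_iff₀ hS]; exact h2) hR0
    · calc (‖z‖ / S) ^ (-w.re) = (S / ‖z‖) ^ w.re := by
            rw [Real.rpow_neg hqpos.le, ← Real.inv_rpow hqpos.le, inv_div]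
        _ ≤ (S / ‖z‖) ^ R := Real.rpow_le_rpow_of_exponent_le
            (by rw [le_div_iff₀ hz0]; rw [div_le_iff₀ hS] at hq1; linarith)
            (by linarith [le_abs_self w.re])
        _ ≤ A ^ R := Real.rpow_le_rpow (by positivity) (by rw [div_le_iff₀ hz0]; exact h1) hR0
  calc ‖z‖ ^ (-w).re * Real.exp (-(z.arg * (-w).im))
      ≤ (A ^ R * S ^ (-w.re)) * Real.exp (Real.pi * R) := by gcongr
    _ = _ := by ring

/-! ### Normal convergence of the multiple zeta series. -/

section ZetaTerm

variable {r : ℕ} {γ : Fin r → ℂ}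

/-- The partial sums are comparable with the partial counts. -/
lemma exists_comparison (hγ : ∀ j, 0 < (γ j).re) : ∃ a > 0, ∃ b > 0, ∀ m j,
    a * partialCount m j ≤ (partialSum γ m j).re ∧ ‖partialSum γ m j‖ ≤ b * partialCount m j := by
  obtain ⟨a, ha, hγa⟩ : ∃ a > 0, ∀ j, a ≤ (γ j).re := by
    have : ∀ᶠ a : ℝ in 𝓝[>] 0, ∀ j, a ≤ (γ j).re := by
      rw [eventually_all]
      intro j
      exact eventually_nhdsWithin_of_eventually_nhds
        ((eventually_lt_nhds (hγ j)).mono fun _ h => h.le)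
    obtain ⟨a, h1, h2⟩ := (this.and self_mem_nhdsWithin).exists
    exact ⟨a, h2, h1⟩
  refine ⟨a, ha, ∑ j, ‖γ j‖ + 1, by positivity, fun m j => ⟨?_, ?_⟩⟩
  · rw [partialCount, partialSum, Finset.mul_sum, Complex.re_sum]
    refine Finset.sum_le_sum fun k _ => ?_
    have : (((m k : ℂ) + 1) * γ k).re = ((m k : ℝ) + 1) * (γ k).re := by simp
    rw [this, mul_comm]
    exact mul_le_mul_of_nonneg_left (hγa k) (by positivity)
  · rw [partialCount, partialSum, Finset.mul_sum]
    refine (norm_sum_le _ _).trans (Finset.sum_le_sum fun k _ => ?_)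
    rw [norm_mul, mul_comm]
    have h1 : ‖(m k : ℂ) + 1‖ = (m k : ℝ) + 1 := by
      exact_mod_cast Complex.norm_natCast (m k + 1)
    rw [h1]
    refine mul_le_mul_of_nonneg_right ?_ (by positivity)
    have := Finset.single_le_sum (f := fun j => ‖γ j‖) (fun _ _ => norm_nonneg _)
      (Finset.mem_univ k)
    linarith

lemma partialSum_re_pos (hγ : ∀ j, 0 < (γ j).re) (m : Fin r → ℕ) (j : Fin r) :
    0 < (partialSum γ m j).re := by
  obtain ⟨a, ha, b, hb, h⟩ := exists_comparison hγ
  exact lt_of_lt_of_le (mul_pos ha (partialCount_pos m j)) (h m j).1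

lemma partialSum_ne_zero (hγ : ∀ j, 0 < (γ j).re) (m : Fin r → ℕ) (j : Fin r) :
    partialSum γ m j ≠ 0 := by
  intro h
  have := partialSum_re_pos hγ m j
  simp [h] at this

lemma zetaTerm_eq (s : Fin r → ℂ) (m : Fin r → ℕ) :
    zetaTerm γ s m = ∏ j, partialSum γ m j ^ (-s j) := rfl

lemma differentiable_zetaTerm (hγ : ∀ j, 0 < (γ j).re) (m : Fin r → ℕ) :
    Differentiable ℂ fun s => zetaTerm γ s m := by
  simp_rw [zetaTerm_eq]
  have h : ∀ j, Differentiable ℂ fun s : Fin r → ℂ => partialSum γ m j ^ (-s j) := fun j s =>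
    DifferentiableAt.const_cpow (by fun_prop) (Or.inl (partialSum_ne_zero hγ m j))
  fun_prop

/-- A uniform bound for powers of numbers comparable with the partial counts. -/
lemma exists_cpow_bound {ι : Type*} {S : ι → ℝ} {z : ι → ℂ} (hS : ∀ i, 0 < S i) {a b : ℝ}
    (ha : 0 < a) (h : ∀ i, a * S i ≤ (z i).re ∧ ‖z i‖ ≤ b * S i) (R : ℝ) :
    ∃ M ≥ 0, ∀ i, ∀ w : ℂ, ‖w‖ ≤ R → ‖z i ^ (-w)‖ ≤ M * S i ^ (-w.re) := by
  set A := max 1 (max b a⁻¹) with hA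
  refine ⟨A ^ R * Real.exp (Real.pi * R), by positivity, fun i w hw =>
    norm_cpow_neg_le (hS i) (le_max_left _ _) ?_ ?_ hw⟩
  · have h1 : S i ≤ a⁻¹ * ‖z i‖ := by
      rw [inv_mul_eq_div, le_div_iff₀ ha, mul_comm]
      exact (h i).1.trans (Complex.re_le_norm _)
    refine h1.trans (mul_le_mul_of_nonneg_right ?_ (norm_nonneg _))
    exact (le_max_right _ _).trans (le_max_right _ _)
  · refine (h i).2.trans (mul_le_mul_of_nonneg_right ?_ (hS i).le)
    exact (le_max_left _ _).trans (le_max_right _ _)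

lemma termBound_zetaTerm (hγ : ∀ j, 0 < (γ j).re) : TermBound 0 (zetaTerm γ) := by
  intro R
  obtain ⟨a, ha, b, hb, h⟩ := exists_comparison hγ
  obtain ⟨M, hM, hMb⟩ := exists_cpow_bound (ι := (Fin r → ℕ) × Fin r)
    (S := fun i => partialCount i.1 i.2) (z := fun i => partialSum γ i.1 i.2)
    (fun i => partialCount_pos _ _) ha (fun i => h i.1 i.2) R
  refine ⟨M ^ r, by positivity, fun s hs m => ?_⟩
  rw [zetaTerm_eq, norm_prod]
  calc ∏ j, ‖partialSum γ m j ^ (-s j)‖ ≤ ∏ j, (M * partialCount m j ^ (-(s j).re)) :=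
        Finset.prod_le_prod (fun _ _ => norm_nonneg _)
          fun j _ => hMb (m, j) (s j) ((norm_le_pi_norm s j).trans hs)
    _ = _ := by simp [Finset.prod_mul_distrib]

lemma summable_zetaTerm (hγ : ∀ j, 0 < (γ j).re) {s : Fin r → ℂ} (hs : s ∈ convergenceRegion r) :
    Summable (zetaTerm γ s) :=
  (termBound_zetaTerm hγ).summable (n := 0) (fun j => by simp) (shiftedRegion_zero r ▸ hs)

lemma differentiableOn_tsum_zetaTerm (hγ : ∀ j, 0 < (γ j).re) :
    DifferentiableOn ℂ (fun s => ∑' m, zetaTerm γ s m) (convergenceRegion r) :=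
  shiftedRegion_zero r ▸ (termBound_zetaTerm hγ).differentiableOn_tsum (n := 0) (fun j => by simp)
    (differentiable_zetaTerm hγ)

end ZetaTerm

/-! ### Meromorphic continuation of the multiple zeta series -/

section TaylorRemainder

/-- The remainder of order `K` in the Taylor expansion of `(z - t γ) ^ (-w)` in powers of `t`. -/
def taylorRemainder (K : ℕ) (γ z w : ℂ) (t : ℝ) : ℂ :=
  (z - t * γ) ^ (-w) - ∑ k ∈ Finset.range K,
    (ascPochhammer ℂ k).eval w / (k.factorial : ℂ) * ((t : ℂ) ^ k * γ ^ k) * z ^ (-w - k)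

/-- Because (w)_{k+1} / k! = w (w + 1)_k / k!, differentiation in t raises w by one and lowers the
order of the remainder by one; the bound on the remainder is an induction based on this. -/
lemma hasDerivAt_taylorRemainder (K : ℕ) {γ z w : ℂ} {t : ℝ} (ht : z - t * γ ∈ Complex.slitPlane) :
    HasDerivAt (taylorRemainder (K + 1) γ z w) (w * γ * taylorRemainder K γ z (w + 1) t) t := by
  have h1 : HasDerivAt (fun t : ℝ => (z - t * γ) ^ (-w)) (w * γ * (z - t * γ) ^ (-(w + 1))) t := by
    have h2 : HasDerivAt (fun t : ℝ => z - t * γ) (-γ) t := by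
      simpa using ((hasDerivAt_id t).ofReal_comp.mul_const γ).const_sub z
    have h3 : HasDerivAt (fun y : ℂ => y ^ (-w)) (-w * (z - t * γ) ^ (-w - 1)) (z - t * γ) :=
      by
      simpa using (hasDerivAt_id (z - t * γ)).cpow_const (c := -w) ht
    have h4 := HasDerivAt.comp t h3 h2
    convert! h4 using 1
    rw [show -(w + 1) = -w - 1 by ring]
    ring
  have h5 : ∀ k : ℕ, HasDerivAt (fun t : ℝ => (ascPochhammer ℂ k).eval w / (k.factorial : ℂ) *
      ((t : ℂ) ^ k * γ ^ k) * z ^ (-w - k))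
      ((ascPochhammer ℂ k).eval w / (k.factorial : ℂ) * ((k * (t : ℂ) ^ (k - 1)) * γ ^ k)
        * z ^ (-w - k)) t := by
    intro k
    have h6 : HasDerivAt (fun t : ℝ => (t : ℂ) ^ k) (k * (t : ℂ) ^ (k - 1)) t := by
      have h7 := HasDerivAt.comp t (hasDerivAt_pow k (t : ℂ)) (Complex.ofRealCLM.hasDerivAt (x := t))
      simpa [Function.comp_def] using h7
    exact ((h6.mul_const _).const_mul _).mul_const _
  have h7 := h1.sub (HasDerivAt.fun_sum fun k (_ : k ∈ Finset.range (K + 1)) => h5 k)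
  convert! h7 using 1
  rw [taylorRemainder, mul_sub, Finset.sum_range_succ']
  simp only [Nat.cast_zero, zero_mul, mul_zero, add_zero]
  congr 1
  rw [Finset.mul_sum]
  refine Finset.sum_congr rfl fun k _ => ?_
  rw [ascPochhammer_succ_left, Polynomial.eval_mul, Polynomial.eval_comp, Polynomial.eval_X,
    Polynomial.eval_add, Polynomial.eval_X, Polynomial.eval_one, Nat.factorial_succ,
    Nat.add_sub_cancel, show -w - ((k + 1 : ℕ) : ℂ) = -(w + 1) - k by push_cast; ring]
  have : (k.factorial : ℂ) ≠ 0 := Nat.cast_ne_zero.mpr k.factorial_ne_zero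
  have : ((k + 1 : ℕ) : ℂ) ≠ 0 := Nat.cast_ne_zero.mpr (Nat.succ_ne_zero k)
  rw [Nat.cast_mul]
  field_simp
  ring

lemma taylorRemainder_zero_right (K : ℕ) (γ z w : ℂ) : taylorRemainder (K + 1) γ z w 0 = 0 := by
  rw [taylorRemainder, Finset.sum_range_succ']
  simp

/-- Induction on K by the mean value inequality: the remainder vanishes at t = 0 and its derivative
is a remainder of lower order at w + 1, so each order gains one power of S. The radius R is
quantified after K since the induction step passes to R + 1. -/
lemma exists_taylorRemainder_bound {ι : Type*} {S : ι → ℝ} {z : ι → ℂ} {γ : ℂ} (hS : ∀ i, 0 < S i)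
    {a b : ℝ} (ha : 0 < a) (h : ∀ i, ∀ t ∈ Set.Icc (0 : ℝ) 1,
      a * S i ≤ (z i - t * γ).re ∧ ‖z i - t * γ‖ ≤ b * S i) (K : ℕ) :
    ∀ R : ℝ, ∃ C ≥ 0, ∀ i, ∀ w : ℂ, ‖w‖ ≤ R → ∀ t ∈ Set.Icc (0 : ℝ) 1,
      ‖taylorRemainder K γ (z i) w t‖ ≤ C * S i ^ (-w.re - K) := by
  induction K with
  | zero =>
    intro R
    obtain ⟨M, hM, hb⟩ := exists_cpow_bound (ι := ι × Set.Icc (0 : ℝ) 1) (S := fun i => S i.1)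
      (z := fun i => z i.1 - (i.2 : ℝ) * γ) (fun i => hS _) ha (fun i => h i.1 i.2 i.2.2) R
    exact ⟨M, hM, fun i w hw t ht => by simpa [taylorRemainder] using hb (i, ⟨t, ht⟩) w hw⟩
  | succ K ih =>
    intro R
    obtain ⟨C, hC, hb⟩ := ih (R + 1)
    refine ⟨|R| * ‖γ‖ * C, by positivity, fun i w hw t ht => ?_⟩
    have hw1 : ‖w + 1‖ ≤ R + 1 := (norm_add_le _ _).trans (by simpa using hw)
    have hmem : ∀ x ∈ Set.Icc (0 : ℝ) 1, z i - x * γ ∈ Complex.slitPlane := fun x hx =>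
      Or.inl (lt_of_lt_of_le (mul_pos ha (hS i)) (h i x hx).1)
    -- The segment [0, t] is rescaled to [0, 1] by x ↦ x t.
    have := norm_image_sub_le_of_norm_deriv_le_segment_01'
      (f := fun x => taylorRemainder (K + 1) γ (z i) w (x * t))
      (f' := fun x => t • (w * γ * taylorRemainder K γ (z i) (w + 1) (x * t)))
      (C := |R| * ‖γ‖ * C * S i ^ (-w.re - (K + 1 : ℕ))) (fun x hx => ?_) (fun x hx => ?_)
    · simpa [taylorRemainder_zero_right] using this
    · have hxt : x * t ∈ Set.Icc (0 : ℝ) 1 := ⟨mul_nonneg hx.1 ht.1, mul_le_one₀ hx.2 ht.1 ht.2⟩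
      have h1 := hasDerivAt_taylorRemainder K (w := w) (hmem _ hxt)
      have h2 : HasDerivAt (fun x : ℝ => x * t) t x := by simpa using (hasDerivAt_id x).mul_const t
      exact (HasDerivAt.scomp x h1 h2).hasDerivWithinAt
    · have hx' := Set.Ico_subset_Icc_self hx
      have hxt : x * t ∈ Set.Icc (0 : ℝ) 1 :=
        ⟨mul_nonneg hx'.1 ht.1, mul_le_one₀ hx'.2 ht.1 ht.2⟩
      have h1 := hb i (w + 1) hw1 _ hxt
      have hexp : -(w + 1).re - (K : ℝ) = -w.re - ((K + 1 : ℕ) : ℝ) := by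
        simp
        ring
      rw [hexp] at h1
      have ht1 : ‖t‖ ≤ 1 := by rw [Real.norm_eq_abs, abs_of_nonneg ht.1]; exact ht.2
      rw [norm_smul, norm_mul, norm_mul]
      have hwR : ‖w‖ ≤ |R| := hw.trans (le_abs_self R)
      calc ‖t‖ * (‖w‖ * ‖γ‖ * ‖taylorRemainder K γ (z i) (w + 1) (x * t)‖)
          ≤ 1 * (|R| * ‖γ‖ * (C * S i ^ (-w.re - ((K + 1 : ℕ) : ℝ)))) := by gcongr
        _ = _ := by ring

end TaylorRemainder

/-! ### Merging and shifting the last argument; the remainder series. -/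

section Recursion

variable {r : ℕ} {γ : Fin (r + 2) → ℂ}

lemma partialSum_castSucc {r : ℕ} (γ : Fin (r + 1) → ℂ) (m : Fin (r + 1) → ℕ) (j : Fin r) :
    partialSum γ m j.castSucc
      = partialSum (fun j => γ j.castSucc) (fun j => m j.castSucc) j :=
  sum_Iic_castSucc _ j

lemma partialSum_last (γ : Fin (r + 2) → ℂ) (m : Fin (r + 2) → ℕ) :
    partialSum γ m (Fin.last _)
      = partialSum (fun j => γ j.castSucc) (fun j => m j.castSucc) (Fin.last r)
        + ((m (Fin.last _) : ℂ) + 1) * γ (Fin.last _) := by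
  rw [partialSum, partialSum, sum_Iic_last, sum_Iic_last, Fin.sum_univ_castSucc]

lemma partialCount_castSucc {r : ℕ} (m : Fin (r + 1) → ℕ) (j : Fin r) :
    partialCount m j.castSucc = partialCount (fun j => m j.castSucc) j :=
  sum_Iic_castSucc _ j

lemma partialCount_last (m : Fin (r + 2) → ℕ) :
    partialCount m (Fin.last _)
      = partialCount (fun j => m j.castSucc) (Fin.last r) + ((m (Fin.last _) : ℝ) + 1) := by
  rw [partialCount, partialCount, sum_Iic_last, sum_Iic_last, Fin.sum_univ_castSucc]

lemma zetaTerm_castSucc {r : ℕ} (γ : Fin (r + 1) → ℂ) (s : Fin (r + 1) → ℂ)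
    (m : Fin (r + 1) → ℕ) :
    zetaTerm γ s m = zetaTerm (fun j => γ j.castSucc) (fun j => s j.castSucc)
      (fun j => m j.castSucc) * partialSum γ m (Fin.last r) ^ (-s (Fin.last r)) := by
  rw [zetaTerm_eq, Fin.prod_univ_castSucc, zetaTerm_eq]
  simp_rw [partialSum_castSucc]

/-- The map `(s_1, …, s_{r+1}) ↦ (s_1, …, s_{r-1}, s_r + s_{r+1} - 1)`. -/
def mergeLast (s : Fin (r + 2) → ℂ) : Fin (r + 1) → ℂ :=
  fun j => s j.castSucc + if j = Fin.last r then s (Fin.last _) - 1 else 0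

lemma differentiable_mergeLast : Differentiable ℂ (mergeLast (r := r)) := by
  rw [differentiable_pi]
  intro j
  unfold mergeLast
  split_ifs <;> fun_prop

/-- Every tail sum loses exactly 1, and so does the bound, because the depth drops by one; the
translate n is therefore preserved. -/
lemma mergeLast_mem {n : ℕ} {s : Fin (r + 2) → ℂ} (hs : s ∈ shiftedRegion (r + 2) n) :
    mergeLast s ∈ shiftedRegion (r + 1) n := by
  intro j
  have h := hs j.castSucc
  rw [sum_Ici_castSucc] at h
  have h2 : ∑ k ∈ Finset.Ici j, mergeLast s k
      = ∑ k ∈ Finset.Ici j, s k.castSucc + (s (Fin.last _) - 1) := by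
    simp [mergeLast, Finset.sum_add_distrib, Fin.le_last]
  rw [h2]
  simp only [Fin.val_castSucc, Complex.add_re, Complex.sub_re, Complex.one_re] at h ⊢
  push_cast at h ⊢
  linarith

lemma zetaTerm_mergeLast {γ : Fin (r + 1) → ℂ} (hγ : ∀ j, 0 < (γ j).re) (s : Fin (r + 2) → ℂ)
    (m : Fin (r + 1) → ℕ) :
    zetaTerm γ (mergeLast s) m = zetaTerm γ (fun j => s j.castSucc) m
      * partialSum γ m (Fin.last r) ^ (-(s (Fin.last _) - 1)) := by
  rw [zetaTerm_eq, zetaTerm_eq, Fin.prod_univ_castSucc, Fin.prod_univ_castSucc, mul_assoc,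
    ← Complex.cpow_add _ _ (partialSum_ne_zero hγ m _)]
  congr 1
  · refine Finset.prod_congr rfl fun j _ => ?_
    simp [mergeLast, (Fin.castSucc_lt_last j).ne]
  · simp [mergeLast]
    ring_nf

/-- Translation in the last coordinate. -/
def shiftLast (n : ℕ) (s : Fin (r + 2) → ℂ) : Fin (r + 2) → ℂ :=
  s + Pi.single (Fin.last _) (n : ℂ)

lemma differentiable_shiftLast (n : ℕ) : Differentiable ℂ (shiftLast (r := r) n) := by
  unfold shiftLast
  fun_prop

lemma sum_Ici_single_last {M : Type*} [AddCommMonoid M] (j : Fin (r + 2)) (x : M) :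
    ∑ k ∈ Finset.Ici j, (Pi.single (Fin.last (r + 1)) x : Fin (r + 2) → M) k = x := by
  rw [Finset.sum_eq_single (Fin.last (r + 1))]
  · simp
  · intro k _ hk
    simp [hk]
  · intro h
    exact absurd (Finset.mem_Ici.mpr (Fin.le_last j)) h

lemma shiftLast_mem {n k l : ℕ} (hkl : l ≤ n + k) {s : Fin (r + 2) → ℂ}
    (hs : s ∈ shiftedRegion (r + 2) l) : shiftLast k s ∈ shiftedRegion (r + 2) n := by
  intro j
  have h := hs j
  have h2 : ∑ i ∈ Finset.Ici j, shiftLast k s i = ∑ i ∈ Finset.Ici j, s i + k := by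
    simp only [shiftLast, Pi.add_apply, Finset.sum_add_distrib, sum_Ici_single_last]
  have h3 : (l : ℝ) ≤ n + k := by exact_mod_cast hkl
  rw [h2]
  simp only [Complex.add_re, Complex.natCast_re]
  linarith

lemma zetaTerm_shiftLast (n : ℕ) (s : Fin (r + 2) → ℂ) (m : Fin (r + 2) → ℕ) :
    zetaTerm γ (shiftLast n s) m = zetaTerm (fun j => γ j.castSucc) (fun j => s j.castSucc)
      (fun j => m j.castSucc) * partialSum γ m (Fin.last _) ^ (-(s (Fin.last _) + n)) := by
  rw [zetaTerm_castSucc]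
  congr 2
  · funext j
    simp [shiftLast, (Fin.castSucc_lt_last j).ne]
  · simp [shiftLast]

/-- The term of the remainder series in the recursion for the multiple zeta series. -/
def remainderTerm (K : ℕ) (γ s : Fin (r + 2) → ℂ) (m : Fin (r + 2) → ℕ) : ℂ :=
  zetaTerm (fun j => γ j.castSucc) (fun j => s j.castSucc) (fun j => m j.castSucc) *
    taylorRemainder K (γ (Fin.last _)) (partialSum γ m (Fin.last _)) (s (Fin.last _) - 1) 1

lemma partialSum_last_sub (γ : Fin (r + 2) → ℂ) (m : Fin (r + 2) → ℕ) (t : ℝ) :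
    partialSum γ m (Fin.last _) - t * γ (Fin.last _)
      = partialSum (fun j => γ j.castSucc) (fun j => m j.castSucc) (Fin.last r)
        + (((m (Fin.last _) : ℝ) + 1 - t : ℝ) : ℂ) * γ (Fin.last _) := by
  rw [partialSum_last]
  push_cast
  ring

/-- Subtracting t γ with t ≤ 1 takes away at most one unit of the last count. The preceding partial
count is at least 1, so at least half of the total is left. This needs depth at least two: in depth
one N - γ can be zero, and that case is handled separately. -/
lemma exists_comparison_sub (hγ : ∀ j, 0 < (γ j).re) : ∃ a > 0, ∃ b > 0,
    ∀ m : Fin (r + 2) → ℕ, ∀ t ∈ Set.Icc (0 : ℝ) 1,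
      a * partialCount m (Fin.last _) ≤ (partialSum γ m (Fin.last _) - t * γ (Fin.last _)).re ∧
      ‖partialSum γ m (Fin.last _) - t * γ (Fin.last _)‖ ≤ b * partialCount m (Fin.last _) := by
  obtain ⟨a, ha, b, hb, h⟩ := exists_comparison (γ := fun j : Fin (r + 1) => γ j.castSucc)
    fun j => hγ _
  have hg := hγ (Fin.last _)
  set g := γ (Fin.last (r + 1)) with hgdef
  refine ⟨min a g.re / 2, by positivity, b + ‖g‖, by positivity, fun m t ht => ?_⟩
  rw [partialSum_last_sub, partialCount_last]
  obtain ⟨h1, h2⟩ := h (fun j => m j.castSucc) (Fin.last r)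
  have hS := one_le_partialCount (fun j : Fin (r + 1) => m j.castSucc) (Fin.last r)
  set S := partialCount (fun j : Fin (r + 1) => m j.castSucc) (Fin.last r)
  set z := partialSum (fun j : Fin (r + 1) => γ j.castSucc) (fun j => m j.castSucc) (Fin.last r)
  set n : ℝ := (m (Fin.last (r + 1)) : ℝ)
  have hn : 0 ≤ n := Nat.cast_nonneg _
  have hx : 0 ≤ n + 1 - t := by linarith [ht.2]
  have hmin1 : min a g.re ≤ a := min_le_left _ _
  have hmin2 : min a g.re ≤ g.re := min_le_right _ _
  have hmin0 : 0 < min a g.re := lt_min ha hg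
  constructor
  · rw [Complex.add_re, Complex.re_ofReal_mul]
    have e1 : min a g.re * S ≤ a * S := mul_le_mul_of_nonneg_right hmin1 (by linarith)
    have e2 : (n + 1 - t) * min a g.re ≤ (n + 1 - t) * g.re := mul_le_mul_of_nonneg_left hmin2 hx
    have e3 : min a g.re * ((S + (n + 1)) / 2) ≤ min a g.re * (S + (n + 1 - t)) :=
      mul_le_mul_of_nonneg_left (by linarith [ht.2]) hmin0.le
    linarith
  · refine (norm_add_le _ _).trans ?_
    rw [norm_mul, Complex.norm_real, Real.norm_of_nonneg hx]
    have e1 : (n + 1 - t) * ‖g‖ ≤ (n + 1) * ‖g‖ :=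
      mul_le_mul_of_nonneg_right (by linarith [ht.1]) (norm_nonneg _)
    have e2 : 0 ≤ b * (n + 1) := by positivity
    have e3 : 0 ≤ ‖g‖ * S := by positivity
    linarith

/-- A remainder of order n + 2 taken at w = s_last - 1 decays with exponent Re s_last + n + 1, that
is, n + 1 better than the original term. -/
lemma termBound_remainderTerm (hγ : ∀ j, 0 < (γ j).re) (n : ℕ) :
    TermBound (Pi.single (Fin.last (r + 1)) ((n + 1 : ℕ) : ℝ)) (remainderTerm (n + 2) γ) := by
  intro R
  obtain ⟨a, ha, b, hb, h⟩ := exists_comparison_sub hγ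
  obtain ⟨C, hC, hCb⟩ := exists_taylorRemainder_bound (ι := Fin (r + 2) → ℕ)
    (S := fun m => partialCount m (Fin.last _)) (z := fun m => partialSum γ m (Fin.last _))
    (fun i => partialCount_pos _ _) ha (fun m t ht => h m t ht) (n + 2) (R + 1)
  obtain ⟨M, hM, hMb⟩ := termBound_zetaTerm (γ := fun j : Fin (r + 1) => γ j.castSucc)
    (fun j => hγ _) R
  refine ⟨M * C, by positivity, fun s hs m => ?_⟩
  have hs1 : ‖fun j : Fin (r + 1) => s j.castSucc‖ ≤ R :=
    (pi_norm_le_iff_of_nonneg ((norm_nonneg s).trans hs)).mpr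
      fun j => (norm_le_pi_norm s _).trans hs
  have hs2 : ‖s (Fin.last (r + 1)) - 1‖ ≤ R + 1 :=
    (norm_sub_le _ _).trans (by
      rw [norm_one]
      linarith [(norm_le_pi_norm s (Fin.last (r + 1))).trans hs])
  have h1 := hMb _ hs1 (fun j => m j.castSucc)
  have h2 := hCb m _ hs2 1 ⟨zero_le_one, le_rfl⟩
  rw [remainderTerm, norm_mul, Fin.prod_univ_castSucc]
  have e1 : ∀ j : Fin (r + 1), partialCount m j.castSucc ^
      (-((s j.castSucc).re + (Pi.single (Fin.last (r + 1)) ((n + 1 : ℕ) : ℝ) :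
        Fin (r + 2) → ℝ) j.castSucc))
      = partialCount (fun j => m j.castSucc) j ^ (-((s j.castSucc).re + (0 : Fin (r + 1) → ℝ) j)) := by
    intro j
    rw [partialCount_castSucc]
    simp [(Fin.castSucc_lt_last j).ne]
  have e2 : -(s (Fin.last (r + 1)) - 1).re - ((n + 2 : ℕ) : ℝ)
      = -((s (Fin.last (r + 1))).re + (Pi.single (Fin.last (r + 1)) ((n + 1 : ℕ) : ℝ) :
        Fin (r + 2) → ℝ) (Fin.last (r + 1))) := by
    simp
    ring
  rw [e2] at h2
  simp_rw [e1]
  refine (mul_le_mul h1 h2 (norm_nonneg _) ?_).trans (le_of_eq (by ring))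
  exact mul_nonneg hM (Finset.prod_nonneg fun j _ =>
    Real.rpow_nonneg (partialCount_pos _ _).le _)

lemma differentiable_remainderTerm (hγ : ∀ j, 0 < (γ j).re) (K : ℕ) (m : Fin (r + 2) → ℕ) :
    Differentiable ℂ fun s => remainderTerm K γ s m := by
  unfold remainderTerm
  have h1 : Differentiable ℂ fun s : Fin (r + 2) → ℂ => zetaTerm (fun j : Fin (r + 1) =>
      γ j.castSucc) (fun j => s j.castSucc) (fun j => m j.castSucc) :=
    (differentiable_zetaTerm (fun j => hγ _) _).comp (by fun_prop)
  have hz := partialSum_ne_zero hγ m (Fin.last _)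
  obtain ⟨a, ha, b, hb, h⟩ := exists_comparison_sub hγ
  have hz1 : partialSum γ m (Fin.last _) - (1 : ℝ) * γ (Fin.last _) ≠ 0 := by
    intro h0
    have h3 := (h m 1 ⟨zero_le_one, le_rfl⟩).1
    rw [h0, Complex.zero_re] at h3
    exact absurd (mul_pos ha (partialCount_pos m (Fin.last _))) (not_lt.mpr h3)
  refine h1.mul ?_
  unfold taylorRemainder
  have h2 : ∀ {z : ℂ} (_ : z ≠ 0) {f : (Fin (r + 2) → ℂ) → ℂ} (_ : Differentiable ℂ f),
      Differentiable ℂ fun s => z ^ f s := fun hz f hf s => (hf s).const_cpow (Or.inl hz)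
  refine (h2 hz1 (by fun_prop)).sub (Differentiable.fun_sum fun k _ => ?_)
  have h4 : Differentiable ℂ fun s : Fin (r + 2) → ℂ =>
      (ascPochhammer ℂ k).eval (s (Fin.last _) - 1) :=
    (Polynomial.differentiable (𝕜 := ℂ) (ascPochhammer ℂ k)).comp
      (by fun_prop : Differentiable ℂ fun s : Fin (r + 2) → ℂ => s (Fin.last _) - 1)
  simp_rw [div_eq_mul_inv]
  exact ((h4.mul_const _).mul_const _).mul (h2 hz (by fun_prop))

end Recursion

/-! ### The telescoping series and the recursion in the depth. -/

section Recursion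

variable {r : ℕ} {γ : Fin (r + 2) → ℂ}

/-- The term of the telescoping series. -/
def telescopingTerm (γ s : Fin (r + 2) → ℂ) (m : Fin (r + 2) → ℕ) : ℂ :=
  zetaTerm (fun j => γ j.castSucc) (fun j => s j.castSucc) (fun j => m j.castSucc) *
    ((partialSum γ m (Fin.last _) - γ (Fin.last _)) ^ (-(s (Fin.last _) - 1))
      - partialSum γ m (Fin.last _) ^ (-(s (Fin.last _) - 1)))

/-- The coefficients of the recursion for the multiple zeta series. -/
def recursionCoeff (g w : ℂ) (i : ℕ) : ℂ :=
  (ascPochhammer ℂ (i + 2)).eval w / ((i + 2).factorial : ℂ) * g ^ (i + 2)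

/-- Taylor's formula at t = 1: the term of order 0 cancels the subtracted power, the term of order 1
is the multiple of the original term, and order i + 2 gives the translate by i + 1 in the last
argument. -/
lemma telescopingTerm_eq (n : ℕ) (s : Fin (r + 2) → ℂ) (m : Fin (r + 2) → ℕ) :
    telescopingTerm γ s m = (s (Fin.last _) - 1) * γ (Fin.last _) * zetaTerm γ s m
      + ∑ i ∈ Finset.range n, recursionCoeff (γ (Fin.last _)) (s (Fin.last _) - 1) i
          * zetaTerm γ (shiftLast (i + 1) s) m
      + remainderTerm (n + 2) γ s m := by
  have h0 : zetaTerm γ s m = zetaTerm (fun j => γ j.castSucc) (fun j => s j.castSucc)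
      (fun j => m j.castSucc) * partialSum γ m (Fin.last _) ^ (-(s (Fin.last _))) :=
    zetaTerm_castSucc γ s m
  simp_rw [zetaTerm_shiftLast]
  rw [telescopingTerm, remainderTerm, taylorRemainder, Finset.sum_range_succ',
    Finset.sum_range_succ', h0]
  simp only [Complex.ofReal_one, one_mul, one_pow, zero_add, pow_one, pow_zero, Nat.cast_zero,
    sub_zero, Nat.cast_one, ascPochhammer_zero, ascPochhammer_one, Polynomial.eval_one,
    Polynomial.eval_X, Nat.factorial_zero, Nat.factorial_one, div_one, mul_one]
  set Q := zetaTerm (fun j => γ j.castSucc) (fun j => s j.castSucc) (fun j => m j.castSucc)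
  set z := partialSum γ m (Fin.last (r + 1))
  set w := s (Fin.last (r + 1))
  have e1 : z ^ (-(w - 1) - 1) = z ^ (-w) := by congr 1; ring
  have e2 : ∑ k ∈ Finset.range n, (ascPochhammer ℂ (k + 1 + 1)).eval (w - 1)
        / ((k + 1 + 1).factorial : ℂ) * γ (Fin.last (r + 1)) ^ (k + 1 + 1)
        * z ^ (-(w - 1) - ((k + 1 + 1 : ℕ) : ℂ))
      = ∑ k ∈ Finset.range n, recursionCoeff (γ (Fin.last _)) (w - 1) k
        * z ^ (-(w + ((k + 1 : ℕ) : ℂ))) := by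
    refine Finset.sum_congr rfl fun k _ => ?_
    rw [recursionCoeff]
    congr 2
    push_cast
    ring
  have e3 : ∑ k ∈ Finset.range n, recursionCoeff (γ (Fin.last _)) (w - 1) k
        * (Q * z ^ (-(w + ((k + 1 : ℕ) : ℂ))))
      = Q * ∑ k ∈ Finset.range n, recursionCoeff (γ (Fin.last _)) (w - 1) k
        * z ^ (-(w + ((k + 1 : ℕ) : ℂ))) := by
    rw [Finset.mul_sum]
    exact Finset.sum_congr rfl fun k _ => by ring
  rw [e1, e2, e3]
  ring

lemma mem_shiftedRegion_of_mem {n : ℕ} {s : Fin r → ℂ} (hs : s ∈ convergenceRegion r) :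
    s ∈ shiftedRegion r n := convergenceRegion_subset r n hs

lemma shiftLast_mem_convergenceRegion (k : ℕ) {s : Fin (r + 2) → ℂ}
    (hs : s ∈ convergenceRegion (r + 2)) : shiftLast k s ∈ convergenceRegion (r + 2) := by
  rw [← shiftedRegion_zero] at hs ⊢
  exact shiftLast_mem (Nat.zero_le _) hs

lemma summable_remainderTerm (hγ : ∀ j, 0 < (γ j).re) (n : ℕ) {s : Fin (r + 2) → ℂ}
    (hs : s ∈ shiftedRegion (r + 2) (n + 1)) : Summable (remainderTerm (n + 2) γ s) :=
  (termBound_remainderTerm hγ n).summable (n := n + 1) (fun j => by rw [sum_Ici_single_last]) hs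

lemma tendsto_partialSum_cpow (hγ : ∀ j, 0 < (γ j).re) {w : ℂ} (hw : 0 < w.re)
    (m : Fin (r + 1) → ℕ) :
    Tendsto (fun n : ℕ => (partialSum (fun j => γ j.castSucc) m (Fin.last r)
      + (n : ℂ) * γ (Fin.last _)) ^ (-w)) atTop (𝓝 0) := by
  rw [← tendsto_add_atTop_iff_nat 1]
  obtain ⟨a, ha, b, hb, h⟩ := exists_comparison hγ
  obtain ⟨M, hM, hMb⟩ := exists_cpow_bound (ι := ℕ)
    (S := fun n => partialCount (Fin.snoc m n : Fin (r + 2) → ℕ) (Fin.last _))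
    (z := fun n => partialSum γ (Fin.snoc m n : Fin (r + 2) → ℕ) (Fin.last _))
    (fun i => partialCount_pos _ _) ha (fun i => h _ _) ‖w‖
  have h1 : Tendsto (fun n : ℕ => M * ((n : ℝ) + 1) ^ (-w.re)) atTop (𝓝 0) := by
    have := ((tendsto_rpow_neg_atTop hw).comp
      (tendsto_atTop_add_const_right atTop (1 : ℝ) tendsto_natCast_atTop_atTop)).const_mul M
    simpa using this
  refine squeeze_zero_norm (fun n => ?_) h1
  have h2 := hMb n w le_rfl
  rw [partialSum_last] at h2
  simp only [Fin.snoc_castSucc, Fin.snoc_last] at h2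
  push_cast
  refine h2.trans (mul_le_mul_of_nonneg_left ?_ hM)
  have h3 := add_one_le_partialCount (Fin.snoc m n : Fin (r + 2) → ℕ) (Fin.last _)
  simp only [Fin.snoc_last] at h3
  exact Real.rpow_le_rpow_of_nonpos (by positivity) h3 (by linarith)

lemma telescopingTerm_snoc (s : Fin (r + 2) → ℂ) (m : Fin (r + 1) → ℕ) (n : ℕ) :
    telescopingTerm γ s (Fin.snoc m n : Fin (r + 2) → ℕ) =
      zetaTerm (fun j => γ j.castSucc) (fun j => s j.castSucc) m *
      ((partialSum (fun j => γ j.castSucc) m (Fin.last r) + (n : ℂ) * γ (Fin.last _))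
          ^ (-(s (Fin.last _) - 1))
        - (partialSum (fun j => γ j.castSucc) m (Fin.last r) + ((n + 1 : ℕ) : ℂ) * γ (Fin.last _))
          ^ (-(s (Fin.last _) - 1))) := by
  rw [telescopingTerm, partialSum_last]
  simp only [Fin.snoc_castSucc, Fin.snoc_last]
  congr 3
  · ring
  · push_cast
    ring

/-- Summation of the telescoping series. -/
lemma hasSum_zetaTerm_mergeLast (hγ : ∀ j, 0 < (γ j).re) {s : Fin (r + 2) → ℂ}
    (hw : 1 < (s (Fin.last _)).re) {T : ℂ} (hT : HasSum (telescopingTerm γ s) T) :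
    HasSum (zetaTerm (fun j => γ j.castSucc) (mergeLast s)) T := by
  let e : (Fin (r + 1) → ℕ) × ℕ ≃ (Fin (r + 2) → ℕ) :=
    (Equiv.prodComm _ _).trans (Fin.snocEquiv fun _ => ℕ)
  have he : ∀ p, e p = (Fin.snoc p.1 p.2 : Fin (r + 2) → ℕ) := fun p => rfl
  have h1 : HasSum (fun p => telescopingTerm γ s (e p)) T := e.hasSum_iff.mpr hT
  -- For fixed earlier indices the sum over the last one telescopes. The contribution at infinity
  -- vanishes because Re s_last > 1, and the initial power merges into the last factor of the
  -- shorter term.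
  refine h1.prod_fiberwise fun m => ?_
  have hsum : Summable fun n => telescopingTerm γ s (e (m, n)) := h1.summable.prod_factor m
  have hlim : Tendsto (fun N => ∑ n ∈ Finset.range N, telescopingTerm γ s (e (m, n))) atTop
      (𝓝 (zetaTerm (fun j => γ j.castSucc) (mergeLast s) m)) := by
    have h2 : ∀ N, ∑ n ∈ Finset.range N, telescopingTerm γ s (e (m, n))
        = zetaTerm (fun j => γ j.castSucc) (fun j => s j.castSucc) m *
          ((partialSum (fun j => γ j.castSucc) m (Fin.last r)) ^ (-(s (Fin.last _) - 1))
          - (partialSum (fun j => γ j.castSucc) m (Fin.last r) + (N : ℂ) * γ (Fin.last _))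
          ^ (-(s (Fin.last _) - 1))) := by
      intro N
      simp_rw [he, telescopingTerm_snoc]
      rw [← Finset.mul_sum, Finset.sum_range_sub']
      simp
    simp_rw [h2]
    have h3 := tendsto_partialSum_cpow hγ (w := s (Fin.last _) - 1) (by simpa using hw) m
    have h4 := (h3.const_sub ((partialSum (fun j => γ j.castSucc) m (Fin.last r))
      ^ (-(s (Fin.last _) - 1)))).const_mul
      (zetaTerm (fun j => γ j.castSucc) (fun j => s j.castSucc) m)
    rw [zetaTerm_mergeLast fun j => hγ _]
    simpa using h4
  have := tendsto_nhds_unique hsum.hasSum.tendsto_sum_nat hlim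
  exact this ▸ hsum.hasSum

/-- The recursion that expresses the multiple zeta series by translates with larger arguments and
a series of smaller depth. -/
lemma tsum_zetaTerm_recursion (hγ : ∀ j, 0 < (γ j).re) (n : ℕ) {s : Fin (r + 2) → ℂ}
    (hs : s ∈ convergenceRegion (r + 2)) :
    ∑' m, zetaTerm (fun j => γ j.castSucc) (mergeLast s) m
      = (s (Fin.last _) - 1) * γ (Fin.last _) * ∑' m, zetaTerm γ s m
      + ∑ i ∈ Finset.range n, recursionCoeff (γ (Fin.last _)) (s (Fin.last _) - 1) i
          * ∑' m, zetaTerm γ (shiftLast (i + 1) s) m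
      + ∑' m, remainderTerm (n + 2) γ s m := by
  have hw : 1 < (s (Fin.last _)).re := by
    have := hs (Fin.last _)
    rw [sum_Ici_last] at this
    simp only [Fin.val_last] at this
    push_cast at this
    linarith
  have h1 := ((summable_zetaTerm hγ hs).hasSum.mul_left
    ((s (Fin.last _) - 1) * γ (Fin.last _))).add
    (hasSum_sum (s := Finset.range n) (f := fun i m => recursionCoeff (γ (Fin.last _))
      (s (Fin.last _) - 1) i * zetaTerm γ (shiftLast (i + 1) s) m) fun i _ =>
      (summable_zetaTerm hγ (shiftLast_mem_convergenceRegion (i + 1) hs)).hasSum.mul_left _)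
  have h2 := h1.add (summable_remainderTerm hγ n (mem_shiftedRegion_of_mem hs)).hasSum
  have h3 : HasSum (telescopingTerm γ s) _ := h2.congr_fun fun m => telescopingTerm_eq n s m
  exact (hasSum_zetaTerm_mergeLast hγ hw h3).tsum_eq

end Recursion

/-! ### Meromorphic continuation by induction on the depth and on the translate. -/

/-- The series times a suitable entire function extends holomorphically to a translate of the
region of convergence. -/
def HasContinuation {r : ℕ} (γ : Fin r → ℂ) (n : ℕ) : Prop :=
  ∃ g h : (Fin r → ℂ) → ℂ, Differentiable ℂ h ∧ (∃ x, h x ≠ 0) ∧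
    DifferentiableOn ℂ g (shiftedRegion r n) ∧
    ∀ s ∈ convergenceRegion r, h s * ∑' m, zetaTerm γ s m = g s

lemma exists_mul_ne_zero {r : ℕ} {f g : (Fin r → ℂ) → ℂ} (hf : Differentiable ℂ f)
    (hg : Differentiable ℂ g) (hf0 : ∃ x, f x ≠ 0) (hg0 : ∃ x, g x ≠ 0) :
    ∃ x, f x * g x ≠ 0 := by
  obtain ⟨x, _, hx⟩ := exists_mul_ne_zero_of_convex isOpen_univ convex_univ hf.differentiableOn
    hg.differentiableOn (hf0.imp fun _ h => ⟨trivial, h⟩) (hg0.imp fun _ h => ⟨trivial, h⟩)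
  exact ⟨x, hx⟩

lemma differentiable_prod {r : ℕ} {ι : Type*} (t : Finset ι) {f : ι → (Fin r → ℂ) → ℂ}
    (hf : ∀ i, Differentiable ℂ (f i)) : Differentiable ℂ fun s => ∏ i ∈ t, f i s := by
  classical
  induction t using Finset.induction_on with
  | empty => simp
  | insert i t hi ih =>
    simp_rw [Finset.prod_insert hi]
    exact (hf i).mul ih

lemma exists_prod_ne_zero {r : ℕ} {ι : Type*} (t : Finset ι) {f : ι → (Fin r → ℂ) → ℂ}
    (hf : ∀ i, Differentiable ℂ (f i)) (hf0 : ∀ i, ∃ x, f i x ≠ 0) :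
    ∃ x, ∏ i ∈ t, f i x ≠ 0 := by
  classical
  induction t using Finset.induction_on with
  | empty => exact ⟨0, by simp⟩
  | insert i t hi ih =>
    simp_rw [Finset.prod_insert hi]
    exact exists_mul_ne_zero (hf i) (differentiable_prod t hf) (hf0 i) ih

lemma hasContinuation_zero {r : ℕ} {γ : Fin r → ℂ} (hγ : ∀ j, 0 < (γ j).re) :
    HasContinuation γ 0 :=
  ⟨fun s => ∑' m, zetaTerm γ s m, fun _ => 1, differentiable_const _, ⟨0, one_ne_zero⟩,
    (shiftedRegion_zero r).symm ▸ differentiableOn_tsum_zetaTerm hγ, fun _ _ => one_mul _⟩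

lemma differentiable_recursionCoeff (g : ℂ) (i : ℕ) :
    Differentiable ℂ fun w => recursionCoeff g w i := by
  unfold recursionCoeff
  simp_rw [div_eq_mul_inv]
  exact ((Polynomial.differentiable _).mul_const _).mul_const _

/-- Solve the recursion for the term (s_last - 1) γ_last ζ(s). The merged series reaches the
translate n + 1 by the case of smaller depth, the shifted series because a shift by at least 1 leads
back to the translate n, and the remainder by its own convergence. The entire denominators of all
terms are multiplied together. -/
lemma hasContinuation_succ {r : ℕ} {γ : Fin (r + 2) → ℂ} (hγ : ∀ j, 0 < (γ j).re) {n : ℕ}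
    (hlow : HasContinuation (fun j : Fin (r + 1) => γ j.castSucc) (n + 1))
    (hcur : HasContinuation γ n) : HasContinuation γ (n + 1) := by
  classical
  obtain ⟨g₁, h₁, hh₁, ⟨x₁, hx₁⟩, hg₁, heq₁⟩ := hlow
  obtain ⟨g₂, h₂, hh₂, ⟨x₂, hx₂⟩, hg₂, heq₂⟩ := hcur
  set c := γ (Fin.last (r + 1)) with hc
  have hc0 : c ≠ 0 := by
    intro h
    have := hγ (Fin.last (r + 1))
    rw [← hc, h] at this
    simp at this
  have hcomp : ∀ i : ℕ, Differentiable ℂ fun s => h₂ (shiftLast (i + 1) s) := fun i =>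
    hh₂.comp (differentiable_shiftLast (i + 1))
  have hlowd : Differentiable ℂ fun s : Fin (r + 2) → ℂ => h₁ (mergeLast s) :=
    hh₁.comp differentiable_mergeLast
  have hlast : Differentiable ℂ fun s : Fin (r + 2) → ℂ => s (Fin.last _) - 1 := by fun_prop
  have hH : ∀ t : Finset ℕ, Differentiable ℂ fun s : Fin (r + 2) → ℂ =>
      ∏ i ∈ t, h₂ (shiftLast (i + 1) s) := fun t => differentiable_prod t hcomp
  refine ⟨fun s => (∏ i ∈ Finset.range n, h₂ (shiftLast (i + 1) s)) * g₁ (mergeLast s)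
      - h₁ (mergeLast s) * ∑ i ∈ Finset.range n, recursionCoeff c (s (Fin.last _) - 1) i
        * (∏ k ∈ (Finset.range n).erase i, h₂ (shiftLast (k + 1) s)) * g₂ (shiftLast (i + 1) s)
      - h₁ (mergeLast s) * (∏ i ∈ Finset.range n, h₂ (shiftLast (i + 1) s))
        * ∑' m, remainderTerm (n + 2) γ s m,
    fun s => (s (Fin.last _) - 1) * c *
      (h₁ (mergeLast s) * ∏ i ∈ Finset.range n, h₂ (shiftLast (i + 1) s)), ?_, ?_, ?_, ?_⟩
  · exact (hlast.mul_const c).mul (hlowd.mul (hH _))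
  · refine exists_mul_ne_zero (hlast.mul_const c) (hlowd.mul (hH _)) ?_
      (exists_mul_ne_zero hlowd (hH _) ?_ (exists_prod_ne_zero _ hcomp fun i => ?_))
    · exact ⟨0, by simpa using hc0⟩
    -- For last coordinate 1 the map `mergeLast` just drops that coordinate.
    · refine ⟨Fin.snoc (α := fun _ => ℂ) x₁ 1, ?_⟩
      convert hx₁ using 2
      funext j
      simp [mergeLast]
    · refine ⟨x₂ - Pi.single (Fin.last _) ((i + 1 : ℕ) : ℂ), ?_⟩
      simpa [shiftLast] using hx₂
  · have hg₁' : DifferentiableOn ℂ (fun s => g₁ (mergeLast s)) (shiftedRegion (r + 2) (n + 1)) :=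
      hg₁.comp differentiable_mergeLast.differentiableOn fun _ hs => mergeLast_mem hs
    have hg₂' : ∀ i : ℕ, DifferentiableOn ℂ (fun s => g₂ (shiftLast (i + 1) s))
        (shiftedRegion (r + 2) (n + 1)) := fun i =>
      hg₂.comp (differentiable_shiftLast (i + 1)).differentiableOn
        fun _ hs => shiftLast_mem (by omega) hs
    have hrem : DifferentiableOn ℂ (fun s => ∑' m, remainderTerm (n + 2) γ s m)
        (shiftedRegion (r + 2) (n + 1)) :=
      (termBound_remainderTerm hγ n).differentiableOn_tsum (n := n + 1)
        (fun j => by rw [sum_Ici_single_last]) fun m => differentiable_remainderTerm hγ _ m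
    have hrec : ∀ i, Differentiable ℂ fun s : Fin (r + 2) → ℂ =>
        recursionCoeff c (s (Fin.last _) - 1) i := fun i =>
      (differentiable_recursionCoeff c i).comp hlast
    refine ((((hH _).differentiableOn.mul hg₁').sub (hlowd.differentiableOn.mul
      (DifferentiableOn.fun_sum fun i _ => ?_))).sub
      ((hlowd.mul (hH _)).differentiableOn.mul hrem))
    exact ((hrec i).mul (hH _)).differentiableOn.mul (hg₂' i)
  · intro s hs
    have hrecur := tsum_zetaTerm_recursion hγ n hs
    have hlow := heq₁ (mergeLast s)
      (shiftedRegion_zero (r + 1) ▸ mergeLast_mem (shiftedRegion_zero (r + 2) ▸ hs))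
    have hsumeq : ∑ i ∈ Finset.range n, recursionCoeff c (s (Fin.last _) - 1) i
        * (∏ k ∈ (Finset.range n).erase i, h₂ (shiftLast (k + 1) s)) * g₂ (shiftLast (i + 1) s)
        = (∏ i ∈ Finset.range n, h₂ (shiftLast (i + 1) s)) *
          ∑ i ∈ Finset.range n, recursionCoeff c (s (Fin.last _) - 1) i
          * ∑' m, zetaTerm γ (shiftLast (i + 1) s) m := by
      rw [Finset.mul_sum]
      refine Finset.sum_congr rfl fun i hi => ?_
      rw [← heq₂ _ (shiftLast_mem_convergenceRegion (i + 1) hs), ← Finset.prod_erase_mul _ _ hi]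
      ring
    simp only
    rw [hsumeq, ← hlow, hrecur]
    ring

/-- `(s - 1) ^ 2 ζ(s)` is entire. -/
lemma differentiable_sq_mul_riemannZeta :
    Differentiable ℂ fun s : ℂ => (s - 1) ^ 2 * riemannZeta s := by
  intro s
  rcases eq_or_ne s 1 with rfl | hs
  -- The square makes the function vanish at 1 whatever value is assigned to `riemannZeta 1`; its
  -- derivative there is the residue.
  · have h : HasDerivAt (fun s : ℂ => (s - 1) ^ 2 * riemannZeta s) 1 1 := by
      rw [hasDerivAt_iff_tendsto_slope]
      refine riemannZeta_residue_one.congr' ?_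
      filter_upwards [self_mem_nhdsWithin] with s hs
      have : s - 1 ≠ 0 := sub_ne_zero.mpr hs
      rw [slope_def_field]
      field_simp
      simp
    exact h.differentiableAt
  · exact ((differentiableAt_id.sub_const 1).pow 2).mul (differentiableAt_riemannZeta hs)

/-- In depth one the series is γ^{-s} ζ(s): the logarithm of (n + 1) γ splits since n + 1 is
positive. -/
lemma hasContinuation_one {γ : Fin 1 → ℂ} (hγ : ∀ j, 0 < (γ j).re) (n : ℕ) :
    HasContinuation γ n := by
  have hγ0 : γ 0 ≠ 0 := by
    intro h
    have := hγ 0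
    simp [h] at this
  refine ⟨fun s => (s 0 - 1) ^ 2 * riemannZeta (s 0) * γ 0 ^ (-s 0), fun s => (s 0 - 1) ^ 2,
    by fun_prop, ⟨0, by simp⟩, ?_, fun s hs => ?_⟩
  · have h1 : Differentiable ℂ fun s : Fin 1 → ℂ => (s 0 - 1) ^ 2 * riemannZeta (s 0) :=
      differentiable_sq_mul_riemannZeta.comp (by fun_prop : Differentiable ℂ fun s : Fin 1 → ℂ => s 0)
    have h2 : Differentiable ℂ fun s : Fin 1 → ℂ => γ 0 ^ (-s 0) := fun s =>
      DifferentiableAt.const_cpow (by fun_prop) (Or.inl hγ0)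
    exact (h1.mul h2).differentiableOn
  · have hs1 : 1 < (s 0).re := by
      have := hs 0
      rw [sum_Ici_zero] at this
      simpa using this
    beta_reduce
    rw [mul_assoc, zeta_eq_tsum_one_div_nat_add_one_cpow hs1, ← tsum_mul_right,
      ← (Equiv.funUnique (Fin 1) ℕ).symm.tsum_eq]
    congr 1
    refine tsum_congr fun n => ?_
    have hn : ((n : ℂ) + 1) ≠ 0 := Nat.cast_add_one_ne_zero n
    have hlog : Complex.log (((n : ℂ) + 1) * γ 0) = Complex.log ((n : ℂ) + 1)
        + Complex.log (γ 0) := by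
      have := Complex.log_ofReal_mul (r := (n : ℝ) + 1) (by positivity) hγ0
      rw [Complex.ofReal_log (by positivity)] at this
      push_cast at this
      exact this
    have hsum : partialSum γ ((Equiv.funUnique (Fin 1) ℕ).symm n) 0 = ((n : ℂ) + 1) * γ 0 := by
      rw [partialSum, show (0 : Fin 1) = Fin.last 0 from rfl, sum_Iic_last]
      simp
    rw [zetaTerm_eq, Fin.prod_univ_one, hsum, one_div, ← Complex.cpow_neg,
      Complex.cpow_def_of_ne_zero (mul_ne_zero hn hγ0), Complex.cpow_def_of_ne_zero hn,
      Complex.cpow_def_of_ne_zero hγ0, hlog, ← Complex.exp_add]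
    congr 1
    ring

/-- Double induction: the translate n + 1 in a given depth uses the translate n in the same depth
and the translate n + 1 in the depth below. -/
lemma hasContinuation : ∀ {r : ℕ} {γ : Fin (r + 1) → ℂ} (_ : ∀ j, 0 < (γ j).re) (n : ℕ),
    HasContinuation γ n := by
  intro r
  induction r with
  | zero => exact hasContinuation_one
  | succ r ih =>
    intro γ hγ n
    induction n with
    | zero => exact hasContinuation_zero hγ
    | succ n ihn => exact hasContinuation_succ hγ (ih (fun j => hγ _) (n + 1)) ihn

/-- The multiple zeta series has a meromorphic continuation. -/
theorem exists_isZetaContinuation {r : ℕ} {γ : Fin (r + 1) → ℂ} (hγ : ∀ j, 0 < (γ j).re) :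
    ∃ Z, IsZetaContinuation γ Z := by
  classical
  choose g h hh hh0 hg heq using hasContinuation hγ
  -- The quotients g_n / h_n agree on overlaps: the cross-multiplied identity holds in the region of
  -- convergence and extends over the convex translate.
  have hcompat : ∀ {n n' : ℕ} {s : Fin (r + 1) → ℂ}, n ≤ n' → s ∈ shiftedRegion (r + 1) n →
      g n s * h n' s = g n' s * h n s := by
    intro n n' s hnn hs
    obtain ⟨q, hq⟩ := convergenceRegion_nonempty (r + 1)
    have h1 := eqOn_zero_of_convex (isOpen_shiftedRegion (r + 1) n)
      (fun _ _ _ _ => convex_line_preimage (convex_shiftedRegion _ _) _ _)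
      (f := fun s => g n s * h n' s - g n' s * h n s)
      (((hg n).mul (hh n').differentiableOn).sub
        (((hg n').mono (shiftedRegion_mono _ hnn)).mul (hh n).differentiableOn))
      (convergenceRegion_subset _ n hq) (by
        filter_upwards [(isOpen_convergenceRegion (r + 1)).mem_nhds hq] with x hx
        rw [← heq n x hx, ← heq n' x hx]
        ring) s hs
    exact sub_eq_zero.mp h1
  have hquot : ∀ {n n' : ℕ} {s : Fin (r + 1) → ℂ}, s ∈ shiftedRegion (r + 1) n →
      s ∈ shiftedRegion (r + 1) n' → h n s ≠ 0 → h n' s ≠ 0 → g n s / h n s = g n' s / h n' s := by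
    intro n n' s hs hs' h0 h0'
    rw [div_eq_div_iff h0 h0']
    rcases le_total n n' with hle | hle
    · exact hcompat hle hs
    · exact (hcompat hle hs').symm
  -- Where no quotient is available the value is that of the series, so that the sum is correct also
  -- at points of the region of convergence at which denominators vanish.
  set Z : (Fin (r + 1) → ℂ) → ℂ := fun s =>
    if hs : ∃ n, s ∈ shiftedRegion (r + 1) n ∧ h n s ≠ 0 then g hs.choose s / h hs.choose s
    else ∑' m, zetaTerm γ s m with hZ
  have hZeq : ∀ {n : ℕ} {s : Fin (r + 1) → ℂ}, s ∈ shiftedRegion (r + 1) n → h n s ≠ 0 →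
      Z s = g n s / h n s := by
    intro n s hs h0
    have hex : ∃ n, s ∈ shiftedRegion (r + 1) n ∧ h n s ≠ 0 := ⟨n, hs, h0⟩
    simp only [hZ, dif_pos hex]
    exact hquot hex.choose_spec.1 hs hex.choose_spec.2 h0
  refine ⟨Z, fun p => ?_, fun s hs => ?_⟩
  · obtain ⟨n, hn⟩ := exists_mem_shiftedRegion p
    have hO := (isOpen_shiftedRegion (r + 1) n).mem_nhds hn
    refine ⟨g n, h n, ?_, .of_differentiable (hh n) p, ?_, ?_⟩
    · filter_upwards [hO] with s hs
      exact (hg n).differentiableAt ((isOpen_shiftedRegion (r + 1) n).mem_nhds hs)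
    · exact frequently_ne_zero_of_convex isOpen_univ convex_univ (hh n).differentiableOn
        ((hh0 n).imp fun _ h => ⟨trivial, h⟩) (Set.mem_univ p)
    · filter_upwards [hO] with s hs h0 using hZeq hs h0
  · have hval : Z s = ∑' m, zetaTerm γ s m := by
      by_cases hex : ∃ n, s ∈ shiftedRegion (r + 1) n ∧ h n s ≠ 0
      · obtain ⟨n, hn, h0⟩ := hex
        rw [hZeq hn h0, ← heq n s hs, mul_div_cancel_left₀ _ h0]
      · simp only [hZ, dif_neg hex]
    exact hval ▸ (summable_zetaTerm hγ hs).hasSum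

/-! ### The limiting kernel -/

/-- The function `y / (exp y - 1)`, with its removable singularity at `0` removed. -/
def bernoulliKernel (y : ℂ) : ℂ := (dslope Complex.exp 0 y)⁻¹

/-- The derivative of `y / (exp y - 1)`. -/
def limitKernel (y : ℂ) : ℂ := deriv bernoulliKernel y

/-- The domain of holomorphy of `y / (exp y - 1)`. -/
def kernelDomain : Set ℂ := {y | dslope Complex.exp 0 y ≠ 0}

lemma differentiable_dslope_exp : Differentiable ℂ (dslope Complex.exp 0) := by
  rw [← differentiableOn_univ, Complex.differentiableOn_dslope univ_mem]
  exact Complex.differentiable_exp.differentiableOn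

lemma isOpen_kernelDomain : IsOpen kernelDomain :=
  isOpen_ne_fun differentiable_dslope_exp.continuous continuous_const

lemma dslope_exp_of_ne {y : ℂ} (hy : y ≠ 0) : dslope Complex.exp 0 y = (Complex.exp y - 1) / y := by
  rw [dslope_of_ne _ hy, slope_def_field]
  simp

lemma dslope_exp_zero : dslope Complex.exp 0 0 = 1 := by simp

lemma zero_mem_kernelDomain : (0 : ℂ) ∈ kernelDomain := by
  show dslope Complex.exp 0 0 ≠ 0
  rw [dslope_exp_zero]
  exact one_ne_zero

lemma mem_kernelDomain_iff {y : ℂ} (hy : y ≠ 0) : y ∈ kernelDomain ↔ Complex.exp y - 1 ≠ 0 := by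
  show dslope Complex.exp 0 y ≠ 0 ↔ _
  rw [dslope_exp_of_ne hy]
  simp [hy]

lemma bernoulliKernel_of_ne {y : ℂ} (hy : y ≠ 0) : bernoulliKernel y = y / (Complex.exp y - 1) := by
  rw [bernoulliKernel, dslope_exp_of_ne hy, inv_div]

lemma differentiableOn_bernoulliKernel : DifferentiableOn ℂ bernoulliKernel kernelDomain :=
  differentiable_dslope_exp.differentiableOn.inv fun _ h => h

lemma hasDerivAt_bernoulliKernel {y : ℂ} (hy : y ∈ kernelDomain) :
    HasDerivAt bernoulliKernel (limitKernel y) y :=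
  (differentiableOn_bernoulliKernel.differentiableAt (isOpen_kernelDomain.mem_nhds hy)).hasDerivAt

lemma differentiableOn_limitKernel : DifferentiableOn ℂ limitKernel kernelDomain :=
  differentiableOn_bernoulliKernel.deriv isOpen_kernelDomain

lemma measurable_limitKernel : Measurable limitKernel := measurable_deriv _

lemma limitKernel_eq {y : ℂ} (hy : y ≠ 0) (hy' : Complex.exp y - 1 ≠ 0) :
    limitKernel y = 1 / (Complex.exp y - 1)
      - y * Complex.exp y / (Complex.exp y - 1) ^ 2 := by
  have h1 : bernoulliKernel =ᶠ[𝓝 y] fun y => y / (Complex.exp y - 1) := by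
    filter_upwards [eventually_ne_nhds hy] with z hz using bernoulliKernel_of_ne hz
  have h2 : HasDerivAt (fun y => y / (Complex.exp y - 1))
      ((1 * (Complex.exp y - 1) - y * Complex.exp y) / (Complex.exp y - 1) ^ 2) y :=
    (hasDerivAt_id y).div ((Complex.hasDerivAt_exp y).sub_const 1) hy'
  rw [limitKernel, h1.deriv_eq, h2.deriv]
  field_simp

lemma limitKernel_zero : limitKernel 0 = -1 / 2 := by
  have h1 : HasDerivAt (dslope Complex.exp 0) (1 / 2) 0 := by
    rw [hasDerivAt_iff_tendsto_slope]
    have hb : Tendsto (fun y : ℂ => ‖y‖) (𝓝[≠] 0) (𝓝 0) := by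
      simpa using (continuous_norm.tendsto (0 : ℂ)).mono_left nhdsWithin_le_nhds
    rw [tendsto_iff_norm_sub_tendsto_zero]
    refine squeeze_zero' (Eventually.of_forall fun _ => norm_nonneg _) ?_ hb
    have hone : ∀ᶠ y : ℂ in 𝓝[≠] 0, ‖y‖ ≤ 1 := by
      filter_upwards [hb.eventually_le_const zero_lt_one] with y hy using hy
    filter_upwards [self_mem_nhdsWithin, hone] with y hy hy1
    have hy0 : y ≠ 0 := hy
    rw [slope_def_field, dslope_exp_zero, dslope_exp_of_ne hy0]
    have h2 := Complex.exp_bound hy1 (n := 3) (by norm_num)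
    simp only [Finset.sum_range_succ, Finset.sum_range_zero, pow_zero, pow_one, Nat.factorial] at h2
    norm_num at h2
    have h3 : ((Complex.exp y - 1) / y - 1) / (y - 0) - 1 / 2
        = (Complex.exp y - (1 + y + y ^ 2 / 2)) / y ^ 2 := by
      field_simp
      ring
    rw [h3, norm_div, norm_pow, div_le_iff₀ (by positivity)]
    refine h2.trans ?_
    have : 0 ≤ ‖y‖ ^ 3 := by positivity
    nlinarith
  have h2 : HasDerivAt bernoulliKernel (-(1 / 2) / (dslope Complex.exp 0 0) ^ 2) 0 :=
    h1.inv (by rw [dslope_exp_zero]; exact one_ne_zero)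
  rw [limitKernel, h2.deriv, dslope_exp_zero]
  norm_num

/-- In this form c enters only through B(cy), so that division by c - 1 gives a difference quotient
of B(cy) / y in c. -/
lemma kernelFactor_of_ne {c : ℝ} {y : ℂ} (hc : c ≠ 0) (hy : y ≠ 0) :
    kernelFactor c y = (bernoulliKernel y - bernoulliKernel (c * y)) / y := by
  have hc' : (c : ℂ) ≠ 0 := Complex.ofReal_ne_zero.mpr hc
  rw [kernelFactor, if_neg hy, bernoulliKernel_of_ne hy, bernoulliKernel_of_ne (mul_ne_zero hc' hy),
    sub_div, div_div, div_div, mul_comm (Complex.exp y - 1), ← div_div, div_self hy,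
    mul_comm (Complex.exp _ - 1) y, mul_comm (c : ℂ) y, mul_div_mul_left _ _ hy]

lemma hasDerivAt_bernoulliKernel_mul {c : ℝ} {y : ℂ} (hy : y ≠ 0)
    (hcy : (c : ℂ) * y ∈ kernelDomain) :
    HasDerivAt (fun c : ℝ => bernoulliKernel (c * y) / y) (limitKernel (c * y)) c := by
  have h1 : HasDerivAt (fun c : ℝ => (c : ℂ) * y) y c := by
    simpa using (hasDerivAt_id c).ofReal_comp.mul_const y
  have h2 := (HasDerivAt.comp c (hasDerivAt_bernoulliKernel hcy) h1).div_const y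
  rwa [mul_div_assoc, div_self hy, mul_one] at h2

lemma tendsto_kernelFactor {y : ℂ} (hy : y ∈ kernelDomain) :
    Tendsto (fun c : ℝ => kernelFactor c y / ((c : ℂ) - 1)) (𝓝[≠] 1) (𝓝 (-limitKernel y)) := by
  rcases eq_or_ne y 0 with rfl | hy0
  · rw [limitKernel_zero]
    refine tendsto_const_nhds.congr' ?_
    filter_upwards [self_mem_nhdsWithin] with c hc
    have : (c : ℂ) - 1 ≠ 0 := sub_ne_zero.mpr (by exact_mod_cast hc)
    rw [kernelFactor, if_pos rfl]
    field_simp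
  · have h1 := hasDerivAt_bernoulliKernel_mul (c := 1) hy0 (by simpa using hy)
    have h2 := (hasDerivAt_iff_tendsto_slope.mp h1).neg
    simp only [Complex.ofReal_one, one_mul] at h2
    refine h2.congr' ?_
    have hne : ∀ᶠ c : ℝ in 𝓝[≠] 1, c ≠ 0 :=
      eventually_nhdsWithin_of_eventually_nhds (eventually_ne_nhds one_ne_zero)
    filter_upwards [hne] with c hc
    rw [kernelFactor_of_ne hc hy0, slope_def_module, Complex.real_smul]
    push_cast
    rw [one_mul]
    ring

/-! ### Uniform exponential decay of the kernels near the half-line. -/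

/-- A closed neighbourhood of the positive half-line. -/
def strip (η : ℝ) : Set ℂ := {w | |w.im| ≤ η ∧ -η ≤ w.re}

/-- The zeros of e^{γw} - 1 other than w = 0 are w = 2πin / γ with n ≠ 0, whose imaginary parts are
at least 2π Re γ / |γ|² in absolute value; η is half of this. -/
lemma exists_mem_kernelDomain {γ : ℂ} (hγ : 0 < γ.re) :
    ∃ η > 0, ∀ w : ℂ, |w.im| ≤ η → γ * w ∈ kernelDomain := by
  have hγ0 : γ ≠ 0 := by
    intro h
    simp [h] at hγ
  have hn : 0 < Complex.normSq γ := Complex.normSq_pos.mpr hγ0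
  refine ⟨Real.pi * γ.re / Complex.normSq γ, by positivity, fun w hw => ?_⟩
  rcases eq_or_ne w 0 with rfl | hw0
  · simpa using zero_mem_kernelDomain
  rw [mem_kernelDomain_iff (mul_ne_zero hγ0 hw0)]
  intro h
  obtain ⟨n, hn'⟩ := Complex.exp_eq_one_iff.mp (sub_eq_zero.mp h)
  have hwn : w = γ⁻¹ * (n * (2 * Real.pi * Complex.I)) := by
    rw [← hn', inv_mul_cancel_left₀ hγ0]
  have hn0 : n ≠ 0 := by
    rintro rfl
    simp at hwn
    exact hw0 hwn
  have him : w.im = 2 * Real.pi * n * γ.re / Complex.normSq γ := by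
    rw [hwn]
    simp [Complex.inv_re, Complex.inv_im]
    ring
  rw [him, abs_div, abs_of_pos hn, div_le_div_iff_of_pos_right hn, abs_mul, abs_mul,
    abs_of_pos hγ, abs_of_pos (by positivity : 0 < 2 * Real.pi)] at hw
  have hn1 : (1 : ℝ) ≤ |(n : ℝ)| := by exact_mod_cast Int.one_le_abs hn0
  have : 2 * Real.pi * 1 * γ.re ≤ 2 * Real.pi * |(n : ℝ)| * γ.re := by gcongr
  have : 0 < Real.pi * γ.re := by positivity
  linarith

lemma norm_limitKernel_le {y : ℂ} (hy : 1 ≤ y.re) :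
    ‖limitKernel y‖ ≤ (2 + 4 * ‖y‖) * Real.exp (-y.re) := by
  have hy0 : y ≠ 0 := by
    rintro rfl
    norm_num at hy
  -- Re y ≥ 1 gives e^{Re y} ≥ 2, so subtracting 1 costs at most half.
  have hE : Real.exp y.re / 2 ≤ ‖Complex.exp y - 1‖ := by
    have h1 : ‖Complex.exp y‖ - ‖(1 : ℂ)‖ ≤ ‖Complex.exp y - 1‖ := norm_sub_norm_le _ _
    rw [Complex.norm_exp, norm_one] at h1
    have h2 : y.re + 1 ≤ Real.exp y.re := Real.add_one_le_exp _
    linarith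
  have hE0 : 0 < Real.exp y.re := Real.exp_pos _
  have hpos : 0 < ‖Complex.exp y - 1‖ := by linarith
  rw [limitKernel_eq hy0 (norm_pos_iff.mp hpos)]
  refine (norm_sub_le _ _).trans ?_
  rw [norm_div, norm_div, norm_mul, norm_pow, norm_one, Complex.norm_exp]
  have h1 : 1 / ‖Complex.exp y - 1‖ ≤ 2 * Real.exp (-y.re) := by
    rw [Real.exp_neg, div_le_iff₀ hpos]
    calc (1 : ℝ) = 2 * (Real.exp y.re)⁻¹ * (Real.exp y.re / 2) := by field_simp
      _ ≤ _ := by gcongr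
  have h2 : ‖y‖ * Real.exp y.re / ‖Complex.exp y - 1‖ ^ 2 ≤ 4 * ‖y‖ * Real.exp (-y.re) := by
    rw [Real.exp_neg, div_le_iff₀ (by positivity)]
    calc ‖y‖ * Real.exp y.re = 4 * ‖y‖ * (Real.exp y.re)⁻¹ * (Real.exp y.re / 2) ^ 2 := by
          field_simp
          ring
      _ ≤ _ := by gcongr
  linarith

/-- The part of the strip up to R₀ is compact. Beyond R₀ one has Re(γw) ≥ 1, and δ ≤ Re γ / 2 leaves
two factors e^{-δ Re w}, one of which absorbs the linear growth in w. -/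
lemma exists_limitKernel_bound {γ : ℂ} (hγ : 0 < γ.re) {η : ℝ} (hη : 0 < η)
    (hdom : ∀ w : ℂ, |w.im| ≤ η → γ * w ∈ kernelDomain) {δ : ℝ} (hδ : 0 < δ)
    (hδγ : δ ≤ γ.re / 2) :
    ∃ C > 0, ∀ w ∈ strip η, ‖limitKernel (γ * w)‖ ≤ C * Real.exp (-δ * w.re) := by
  set R₀ : ℝ := (1 + ‖γ‖ * η) / γ.re with hR₀
  have hR₀' : 0 < R₀ := by positivity
  have hcomp : IsCompact (Set.Icc (-η) R₀ ×ℂ Set.Icc (-η) η) :=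
    IsCompact.reProdIm isCompact_Icc isCompact_Icc
  have hcont : ContinuousOn (fun w : ℂ => ‖limitKernel (γ * w)‖ * Real.exp (δ * w.re))
      (Set.Icc (-η) R₀ ×ℂ Set.Icc (-η) η) := by
    refine ContinuousOn.mul (ContinuousOn.norm ?_) (by fun_prop)
    refine differentiableOn_limitKernel.continuousOn.comp (by fun_prop) fun w hw => ?_
    exact hdom w (abs_le.mpr hw.2)
  obtain ⟨C₁, hC₁⟩ := hcomp.bddAbove_image hcont
  set C₂ := (2 + 4 * ‖γ‖ * η + 4 * ‖γ‖ / δ) * Real.exp (‖γ‖ * η) with hC₂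
  have hC₂' : 0 < C₂ := by positivity
  refine ⟨max C₁ C₂, lt_max_of_lt_right hC₂', fun w hw => ?_⟩
  rcases le_or_gt w.re R₀ with hre | hre
  · have h1 : ‖limitKernel (γ * w)‖ * Real.exp (δ * w.re) ≤ C₁ :=
      hC₁ ⟨w, ⟨⟨hw.2, hre⟩, abs_le.mp hw.1⟩, rfl⟩
    rw [neg_mul, Real.exp_neg, ← div_eq_mul_inv, le_div_iff₀ (Real.exp_pos _)]
    exact h1.trans (le_max_left _ _)
  · have hx : 0 < w.re := hR₀'.trans hre
    have him : |γ.im * w.im| ≤ ‖γ‖ * η := by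
      rw [abs_mul]
      exact mul_le_mul (Complex.abs_im_le_norm γ) hw.1 (abs_nonneg _) (norm_nonneg _)
    have hre1 : γ.re * w.re - ‖γ‖ * η ≤ (γ * w).re := by
      rw [Complex.mul_re]
      linarith [le_abs_self (γ.im * w.im)]
    have hge1 : 1 ≤ (γ * w).re := by
      rw [hR₀, div_lt_iff₀ hγ] at hre
      linarith
    have hnw : ‖w‖ ≤ w.re + η := by
      calc ‖w‖ ≤ |w.re| + |w.im| := Complex.norm_le_abs_re_add_abs_im w
        _ ≤ w.re + η := by rw [abs_of_pos hx]; linarith [hw.1]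
    have hxexp : w.re * Real.exp (-δ * w.re) ≤ 1 / δ := by
      have h1 : δ * w.re ≤ Real.exp (δ * w.re) := by linarith [Real.add_one_le_exp (δ * w.re)]
      rw [neg_mul, Real.exp_neg, ← div_eq_mul_inv, div_le_div_iff₀ (Real.exp_pos _) hδ]
      linarith
    have hle1 : Real.exp (-δ * w.re) ≤ 1 := Real.exp_le_one_iff.mpr (by nlinarith)
    have hexp : Real.exp (-(γ * w).re)
        ≤ Real.exp (‖γ‖ * η) * Real.exp (-δ * w.re) * Real.exp (-δ * w.re) := by
      rw [← Real.exp_add, ← Real.exp_add, Real.exp_le_exp]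
      nlinarith
    calc ‖limitKernel (γ * w)‖ ≤ (2 + 4 * ‖γ * w‖) * Real.exp (-(γ * w).re) :=
          norm_limitKernel_le hge1
      _ ≤ (2 + 4 * (‖γ‖ * (w.re + η))) *
          (Real.exp (‖γ‖ * η) * Real.exp (-δ * w.re) * Real.exp (-δ * w.re)) := by
          rw [norm_mul]
          gcongr
      _ = ((2 + 4 * ‖γ‖ * η) * Real.exp (-δ * w.re) + 4 * ‖γ‖ * (w.re * Real.exp (-δ * w.re)))
          * Real.exp (‖γ‖ * η) * Real.exp (-δ * w.re) := by ring
      _ ≤ ((2 + 4 * ‖γ‖ * η) * 1 + 4 * ‖γ‖ * (1 / δ))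
          * Real.exp (‖γ‖ * η) * Real.exp (-δ * w.re) := by gcongr
      _ = C₂ * Real.exp (-δ * w.re) := by rw [hC₂]; ring
      _ ≤ _ := by gcongr; exact le_max_right _ _

/-- Mean value inequality in c, for the function B(cy) / y with derivative B'(cy). For c in [1/2, 2]
the point c w stays in the strip of twice the width, and decay of rate 2δ at c w is decay of rate δ
at w, up to a constant. -/
lemma exists_kernelFactor_bound {γ : ℂ} (hγ : 0 < γ.re) {η : ℝ} (hη : 0 < η)
    (hdom : ∀ w : ℂ, |w.im| ≤ 2 * η → γ * w ∈ kernelDomain) {δ : ℝ} (hδ : 0 < δ)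
    (hδγ : δ ≤ γ.re / 4) :
    ∃ C > 0, ∀ w ∈ strip η, ‖limitKernel (γ * w)‖ ≤ C * Real.exp (-δ * w.re) ∧
      ∀ c ∈ Set.Icc (1 / 2 : ℝ) 2,
        ‖kernelFactor c (γ * w)‖ ≤ |c - 1| * (C * Real.exp (-δ * w.re)) := by
  obtain ⟨C, hC, hb⟩ := exists_limitKernel_bound hγ (by linarith : 0 < 2 * η) hdom
    (by linarith : 0 < 2 * δ) (by linarith)
  have hscale : ∀ w ∈ strip η, ∀ c ∈ Set.Icc (1 / 2 : ℝ) 2, (c : ℂ) * w ∈ strip (2 * η) := by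
    intro w hw c hc
    have hc0 : 0 ≤ c := by linarith [hc.1]
    refine ⟨?_, ?_⟩
    · rw [Complex.im_ofReal_mul, abs_mul, abs_of_nonneg hc0]
      exact mul_le_mul hc.2 hw.1 (abs_nonneg _) (by norm_num)
    · rw [Complex.re_ofReal_mul]
      rcases le_total 0 w.re with h | h
      · nlinarith [mul_nonneg hc0 h]
      · nlinarith [mul_le_mul_of_nonpos_right hc.2 h, hw.2]
  have hexp : ∀ w ∈ strip η, ∀ c ∈ Set.Icc (1 / 2 : ℝ) 2,
      Real.exp (-(2 * δ) * ((c : ℂ) * w).re) ≤ Real.exp (4 * δ * η) * Real.exp (-δ * w.re) := by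
    intro w hw c hc
    rw [Complex.re_ofReal_mul, ← Real.exp_add, Real.exp_le_exp]
    have hp : 0 < δ * η := by positivity
    rcases le_total 0 w.re with h | h
    · have h1 : δ * (w.re * (1 / 2)) ≤ δ * (w.re * c) := by
        have := hc.1
        gcongr
      linarith
    · have h1 : δ * (2 * w.re) ≤ δ * (c * w.re) :=
        mul_le_mul_of_nonneg_left (mul_le_mul_of_nonpos_right hc.2 h) hδ.le
      have h2 : δ * -η ≤ δ * w.re := mul_le_mul_of_nonneg_left hw.2 hδ.le
      nlinarith [mul_nonpos_of_nonneg_of_nonpos hδ.le h]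
  have hG : ∀ w ∈ strip η, ∀ c ∈ Set.Icc (1 / 2 : ℝ) 2,
      ‖limitKernel (c * (γ * w))‖ ≤ C * Real.exp (4 * δ * η) * Real.exp (-δ * w.re) := by
    intro w hw c hc
    have h1 := hb _ (hscale w hw c hc)
    rw [show (c : ℂ) * (γ * w) = γ * (c * w) by ring, mul_assoc]
    exact h1.trans (mul_le_mul_of_nonneg_left (hexp w hw c hc) hC.le)
  refine ⟨C * Real.exp (4 * δ * η), by positivity, fun w hw => ⟨?_, fun c hc => ?_⟩⟩
  · simpa using hG w hw 1 ⟨by norm_num, by norm_num⟩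
  · have hc0 : c ≠ 0 := by linarith [hc.1]
    rcases eq_or_ne (γ * w) 0 with h0 | h0
    · have h1 := hG w hw 1 ⟨by norm_num, by norm_num⟩
      rw [h0, mul_zero, limitKernel_zero] at h1
      rw [h0, kernelFactor, if_pos rfl]
      have h2 : ‖((c : ℂ) - 1) / 2‖ = |c - 1| * ‖(-1 / 2 : ℂ)‖ := by
        rw [norm_div, norm_div, norm_neg, norm_one]
        rw [← Complex.ofReal_one, ← Complex.ofReal_sub, Complex.norm_real, Real.norm_eq_abs]
        ring
      rw [h2]
      exact mul_le_mul_of_nonneg_left h1 (abs_nonneg _)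
    · have hmv := Convex.norm_image_sub_le_of_norm_hasDerivWithin_le
        (f := fun c : ℝ => bernoulliKernel (c * (γ * w)) / (γ * w))
        (f' := fun c : ℝ => limitKernel (c * (γ * w))) (s := Set.Icc (1 / 2 : ℝ) 2) (x := c) (y := 1)
        (fun x hx => (hasDerivAt_bernoulliKernel_mul h0 (by
          rw [show (x : ℂ) * (γ * w) = γ * (x * w) by ring]
          exact hdom _ (hscale w hw x hx).1)).hasDerivWithinAt)
        (fun x hx => hG w hw x hx) (convex_Icc _ _) hc ⟨by norm_num, by norm_num⟩
      rw [kernelFactor_of_ne hc0 h0, sub_div]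
      simp only [Complex.ofReal_one, one_mul, Real.norm_eq_abs] at hmv
      rw [abs_sub_comm, mul_comm |1 - c|]
      exact hmv

/-- Uniform bounds on a neighbourhood of the half-line for the kernels with parameters `γ_j`. -/
lemma exists_uniform_kernel_bound {r : ℕ} {γ : Fin r → ℂ} (hγ : ∀ j, 0 < (γ j).re) :
    ∃ η > 0, ∃ δ > 0, ∃ C > 0, ∀ j, ∀ w ∈ strip η, γ j * w ∈ kernelDomain ∧
      ‖limitKernel (γ j * w)‖ ≤ C * Real.exp (-δ * w.re) ∧
      ∀ c ∈ Set.Icc (1 / 2 : ℝ) 2,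
        ‖kernelFactor c (γ j * w)‖ ≤ |c - 1| * (C * Real.exp (-δ * w.re)) := by
  choose η hη hdom using fun j => exists_mem_kernelDomain (hγ j)
  have h1 : ∀ᶠ x : ℝ in 𝓝[>] 0, ∀ j, x ≤ η j / 2 ∧ x ≤ (γ j).re / 4 := by
    rw [eventually_all]
    intro j
    refine eventually_nhdsWithin_of_eventually_nhds ?_
    filter_upwards [eventually_lt_nhds (half_pos (hη j)),
      eventually_lt_nhds (by linarith [hγ j] : 0 < (γ j).re / 4)] with x h2 h3 using ⟨h2.le, h3.le⟩
  obtain ⟨x, hx, hx0⟩ := (h1.and self_mem_nhdsWithin).exists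
  have hx0' : 0 < x := hx0
  choose C hC hb using fun j => exists_kernelFactor_bound (hγ j) hx0'
    (fun w hw => hdom j w (hw.trans (by linarith [(hx j).1]))) hx0' (hx j).2
  have hCle : ∀ j, C j ≤ ∑ j, C j + 1 := fun j => by
    have := Finset.single_le_sum (f := C) (fun i _ => (hC i).le) (Finset.mem_univ j)
    linarith
  refine ⟨x, hx0', x, hx0', ∑ j, C j + 1, ?_, fun j w hw => ⟨?_, ?_, fun c hc => ?_⟩⟩
  · have := Finset.sum_nonneg fun j (_ : j ∈ Finset.univ) => (hC j).le
    linarith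
  · exact hdom j w (hw.1.trans (by linarith [(hx j).1, hη j]))
  · refine (hb j w hw).1.trans ?_
    gcongr
    exact hCle j
  · refine ((hb j w hw).2 c hc).trans ?_
    gcongr
    exact hCle j

/-! ### Hankel integrals in one variable -/

/-- Solution of the differential equation `s Ψ + z Ψ' = f` on a disc. -/
lemma exists_antiderivative {f : ℂ → ℂ} {ρ : ℝ} (hf : DifferentiableOn ℂ f (Metric.ball 0 ρ))
    {s : ℂ} (hs : ∀ n : ℕ, (n : ℂ) + s ≠ 0) :
    ∃ Ψ : ℂ → ℂ, DifferentiableOn ℂ Ψ (Metric.ball 0 ρ) ∧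
      ∀ z ∈ Metric.ball (0 : ℂ) ρ, s * Ψ z + z * deriv Ψ z = f z := by
  set a : ℕ → ℂ := fun n => ((n.factorial : ℂ))⁻¹ * iteratedDeriv n f 0 with ha
  have hsum : ∀ z ∈ Metric.ball (0 : ℂ) ρ, HasSum (fun n => a n * z ^ n) (f z) := by
    intro z hz
    refine (Complex.hasSum_taylorSeries_on_ball hf hz).congr_fun fun n => ?_
    simp [ha]
    ring
  obtain ⟨B, hB⟩ : ∃ B : ℝ, ∀ n : ℕ, ‖((n : ℂ) + s)⁻¹‖ ≤ B := by
    have h1 : Tendsto (fun n : ℕ => ((n : ℂ) + s)⁻¹) atTop (𝓝 0) := by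
      refine tendsto_inv₀_cobounded.comp (tendsto_norm_atTop_iff_cobounded.mp ?_)
      refine tendsto_atTop_mono (fun n : ℕ => ?_)
        (tendsto_atTop_add_const_right atTop (-‖s‖) tendsto_natCast_atTop_atTop)
      have := norm_sub_norm_le (n : ℂ) (-s)
      rw [norm_neg, sub_neg_eq_add, Complex.norm_natCast] at this
      linarith
    obtain ⟨B, hB⟩ := (Metric.isBounded_range_of_tendsto _ h1).exists_norm_le
    exact ⟨B, fun n => hB _ ⟨n, rfl⟩⟩
  have hB0 : 0 ≤ B := (norm_nonneg _).trans (hB 0)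
  -- Comparison of coefficients in s Ψ + z Ψ' = f forces division by n + s; these divisors have
  -- bounded inverses, so the series converges wherever the Taylor series of f does.
  set F : ℕ → ℂ → ℂ := fun n z => a n * ((n : ℂ) + s)⁻¹ * z ^ n with hF
  have hFd : ∀ n, Differentiable ℂ (F n) := fun n => by
    simp only [hF]
    fun_prop
  have hu : ∀ R : ℝ, 0 < R → R < ρ → Summable (fun n => B * (‖a n‖ * R ^ n)) ∧
      ∀ n, ∀ w ∈ Metric.ball (0 : ℂ) R, ‖F n w‖ ≤ B * (‖a n‖ * R ^ n) := by
    intro R hR0 hR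
    refine ⟨?_, fun n w hw => ?_⟩
    · have h1 := (hsum (R : ℂ) (by simpa [abs_of_pos hR0] using hR)).summable.norm
      refine (h1.congr fun n => ?_).mul_left B
      rw [norm_mul, norm_pow, Complex.norm_real, Real.norm_of_nonneg hR0.le]
    · have hw' : ‖w‖ ≤ R := by simpa using (Metric.mem_ball.mp hw).le
      calc ‖F n w‖ = ‖((n : ℂ) + s)⁻¹‖ * (‖a n‖ * ‖w‖ ^ n) := by
            simp only [hF, norm_mul, norm_pow]
            ring
        _ ≤ B * (‖a n‖ * R ^ n) := by
            gcongr
            exact hB n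
  have hR : ∀ z ∈ Metric.ball (0 : ℂ) ρ, ∃ R, 0 < R ∧ R < ρ ∧ z ∈ Metric.ball (0 : ℂ) R := by
    intro z hz
    rw [mem_ball_zero_iff] at hz
    obtain ⟨R, h1, h2⟩ := exists_between hz
    exact ⟨R, (norm_nonneg z).trans_lt h1, h2, by simpa using h1⟩
  refine ⟨fun z => ∑' n, F n z, fun z hz => ?_, fun z hz => ?_⟩
  · obtain ⟨R, hR0, hRρ, hzR⟩ := hR z hz
    have h1 := Complex.differentiableOn_tsum_of_summable_norm (hu R hR0 hRρ).1
      (fun n => (hFd n).differentiableOn) Metric.isOpen_ball (hu R hR0 hRρ).2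
    exact (h1.differentiableAt (Metric.isOpen_ball.mem_nhds hzR)).differentiableWithinAt
  · obtain ⟨R, hR0, hRρ, hzR⟩ := hR z hz
    have h1 := Complex.hasSum_deriv_of_summable_norm (hu R hR0 hRρ).1
      (fun n => (hFd n).differentiableOn) Metric.isOpen_ball (hu R hR0 hRρ).2 hzR
    have h2 : HasSum (fun n => F n z) (∑' n, F n z) :=
      (Summable.of_norm_bounded (hu R hR0 hRρ).1 fun n => (hu R hR0 hRρ).2 n z hzR).hasSum
    have h3 := (h2.mul_left s).add (h1.mul_left z)
    refine (h3.congr_fun fun n => ?_).unique (hsum z hz)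
    have hd : deriv (F n) z = a n * ((n : ℂ) + s)⁻¹ * (n * z ^ (n - 1)) := by
      simp only [hF]
      rw [deriv_const_mul_field, deriv_pow_field]
    rw [hd]
    rcases n with _ | n
    · have := hs 0
      simp only [Nat.cast_zero, zero_add] at this
      simp [hF]
      field_simp
    · have := hs (n + 1)
      simp only [hF, Nat.add_sub_cancel]
      field_simp
      ring

/-- An open neighbourhood of the positive half-line. -/
def openStrip (ρ : ℝ) : Set ℂ := {w | |w.im| < ρ ∧ -ρ < w.re}

lemma ball_subset_openStrip (ρ : ℝ) : Metric.ball 0 ρ ⊆ openStrip ρ := by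
  intro w hw
  rw [mem_ball_zero_iff] at hw
  exact ⟨(Complex.abs_im_le_norm w).trans_lt hw,
    by linarith [neg_abs_le w.re, (Complex.abs_re_le_norm w).trans_lt hw]⟩

lemma ofReal_mem_openStrip {ρ t : ℝ} (hρ : 0 < ρ) (ht : 0 ≤ t) : (t : ℂ) ∈ openStrip ρ :=
  ⟨by simpa using hρ, by simp; linarith⟩

/-- The class of functions holomorphic and exponentially decaying near the positive half-line. -/
structure DecayingOn (ρ δ : ℝ) (f : ℂ → ℂ) : Prop where
  measurable : Measurable f
  holomorphic : DifferentiableOn ℂ f (openStrip ρ)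
  bound : ∃ C, ∀ w ∈ openStrip ρ, ‖f w‖ ≤ C * Real.exp (-δ * w.re)

/-- The weight `t ^ (s - 1) dt` on the Hankel contour. -/
def hankelWeight (ε : ℝ) (s : ℂ) (x : ℝ) : ℂ :=
  Complex.exp ((s - 1) * hankelLog ε x) * hankelVelocity ε x

/-! ### Points and weights on the three pieces of the contour. -/

section Paths

variable {ε : ℝ}

lemma hankelPoint_of_neg {x : ℝ} (hx : x < 0) : hankelPoint ε x = ((ε - x : ℝ) : ℂ) := by
  simp [hankelPoint, hankelAbs, hankelArg, hx]

lemma hankelPoint_of_gt {x : ℝ} (hx : 2 * Real.pi < x) :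
    hankelPoint ε x = ((ε + (x - 2 * Real.pi) : ℝ) : ℂ) := by
  have h1 : ¬ x < 0 := by linarith [Real.pi_pos]
  have h2 : ¬ x ≤ 2 * Real.pi := not_le.mpr hx
  simp [hankelPoint, hankelAbs, hankelArg, h1, h2]

lemma hankelPoint_of_mem {x : ℝ} (hx : x ∈ Set.Icc 0 (2 * Real.pi)) :
    hankelPoint ε x = ε * Complex.exp (x * Complex.I) := by
  simp [hankelPoint, hankelAbs, hankelArg, not_lt.mpr hx.1, hx.2]

lemma hankelWeight_of_neg (hε : 0 < ε) (s : ℂ) {x : ℝ} (hx : x < 0) :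
    hankelWeight ε s x = -((ε - x : ℝ) : ℂ) ^ (s - 1) := by
  have h : 0 < ε - x := by linarith
  rw [Complex.cpow_def_of_ne_zero (Complex.ofReal_ne_zero.mpr h.ne'), ← Complex.ofReal_log h.le]
  simp [hankelWeight, hankelLog, hankelAbs, hankelArg, hankelVelocity, hx]
  ring_nf

lemma hankelWeight_of_gt (hε : 0 < ε) (s : ℂ) {x : ℝ} (hx : 2 * Real.pi < x) :
    hankelWeight ε s x = Complex.exp (2 * Real.pi * Complex.I * s)
      * ((ε + (x - 2 * Real.pi) : ℝ) : ℂ) ^ (s - 1) := by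
  have h1 : ¬ x < 0 := by linarith [Real.pi_pos]
  have h2 : ¬ x ≤ 2 * Real.pi := not_le.mpr hx
  have h : 0 < ε + (x - 2 * Real.pi) := by linarith
  rw [Complex.cpow_def_of_ne_zero (Complex.ofReal_ne_zero.mpr h.ne'), ← Complex.ofReal_log h.le,
    ← Complex.exp_add, hankelWeight, hankelLog, hankelAbs, hankelArg, hankelVelocity]
  simp only [h1, h2, if_false, mul_one]
  rw [Complex.exp_eq_exp_iff_exists_int]
  -- The weight contains s - 1 while the prefactor contains s; the exponents differ by -2πi.
  refine ⟨-1, ?_⟩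
  push_cast
  ring

lemma hankelWeight_of_mem (hε : 0 < ε) (s : ℂ) {x : ℝ} (hx : x ∈ Set.Icc 0 (2 * Real.pi)) :
    hankelWeight ε s x = Complex.exp (s * (Real.log ε + x * Complex.I)) * Complex.I := by
  have h : (ε : ℂ) = Complex.exp (Real.log ε) := by
    rw [← Complex.ofReal_exp, Real.exp_log hε]
  rw [hankelWeight, hankelLog, hankelAbs, hankelArg, hankelVelocity]
  simp only [not_lt.mpr hx.1, hx.2, if_false, if_true]
  rw [h]
  rw [show Complex.I * Complex.exp (Real.log ε) * Complex.exp (x * Complex.I)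
    = Complex.exp (Real.log ε) * Complex.exp (x * Complex.I) * Complex.I by ring, ← Complex.exp_add,
    ← mul_assoc, ← Complex.exp_add]
  congr 2
  ring

lemma hankelPoint_mem_openStrip {ρ : ℝ} (hε : 0 < ε) (hερ : ε < ρ) (x : ℝ) :
    hankelPoint ε x ∈ openStrip ρ := by
  rcases lt_or_ge x 0 with hx | hx
  · rw [hankelPoint_of_neg hx]
    exact ofReal_mem_openStrip (hε.trans hερ) (by linarith)
  rcases le_or_gt x (2 * Real.pi) with hx' | hx'
  · apply ball_subset_openStrip
    rw [hankelPoint_of_mem ⟨hx, hx'⟩, mem_ball_zero_iff, norm_mul, Complex.norm_exp_ofReal_mul_I,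
      mul_one, Complex.norm_real, Real.norm_of_nonneg hε.le]
    exact hερ
  · rw [hankelPoint_of_gt hx']
    exact ofReal_mem_openStrip (hε.trans hερ) (by linarith)

lemma measurable_hankelAbs (ε : ℝ) : Measurable (hankelAbs ε) := by
  unfold hankelAbs
  exact Measurable.ite measurableSet_Iio (by fun_prop)
    (Measurable.ite measurableSet_Iic (by fun_prop) (by fun_prop))

lemma measurable_hankelArg : Measurable hankelArg := by
  unfold hankelArg
  exact Measurable.ite measurableSet_Iio (by fun_prop)
    (Measurable.ite measurableSet_Iic (by fun_prop) (by fun_prop))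

lemma measurable_hankelPoint (ε : ℝ) : Measurable (hankelPoint ε) := by
  have h1 := measurable_hankelAbs ε
  have h2 := measurable_hankelArg
  unfold hankelPoint
  fun_prop

lemma measurable_hankelWeight (ε : ℝ) (s : ℂ) : Measurable (hankelWeight ε s) := by
  have h1 := measurable_hankelAbs ε
  have h2 := measurable_hankelArg
  have h3 : Measurable (hankelVelocity ε) := by
    unfold hankelVelocity
    exact Measurable.ite measurableSet_Iio (by fun_prop)
      (Measurable.ite measurableSet_Iic (by fun_prop) (by fun_prop))
  unfold hankelWeight hankelLog
  fun_prop

end Paths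

lemma integrableOn_cpow_mul_exp {ε δ : ℝ} (hε : 0 < ε) (hδ : 0 < δ) (a : ℝ) :
    IntegrableOn (fun t : ℝ => t ^ a * Real.exp (-δ * t)) (Set.Ioi ε) := by
  refine integrable_of_isBigO_exp_neg (b := δ / 2) (half_pos hδ) ?_ ?_
  · intro t ht
    have : t ≠ 0 := (hε.trans_le ht).ne'
    exact ((Real.continuousAt_rpow_const t a (Or.inl this)).mul
      (by fun_prop)).continuousWithinAt
  · have h1 := (isLittleO_rpow_exp_pos_mul_atTop a (half_pos hδ)).isBigO.mul
      (Asymptotics.isBigO_refl (fun t : ℝ => Real.exp (-δ * t)) atTop)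
    refine h1.congr_right fun t => ?_
    rw [← Real.exp_add]
    congr 1
    ring

/-- A locally uniform integrable bound for the weights on the Hankel contour. -/
lemma exists_hankelWeight_bound {ε δ : ℝ} (hε : 0 < ε) (hδ : 0 < δ) (R : ℝ) :
    ∃ g : ℝ → ℝ, Integrable g ∧ ∀ s : ℂ, ‖s‖ ≤ R → ∀ x,
      Real.exp (-δ * (hankelPoint ε x).re) * ‖hankelWeight ε s x‖ ≤ g x := by
  -- For ‖s‖ ≤ R the power t^{Re s - 1} is at most t^{R+1} + t^{-(R+1)}, according to t ≥ 1 or t ≤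
  -- 1; the prefactor bounds e^{2πis} on the second ray.
  set ray : ℝ → ℝ := fun t => Real.exp (2 * Real.pi * R) *
    (t ^ (R + 1) * Real.exp (-δ * t) + t ^ (-(R + 1)) * Real.exp (-δ * t)) with hray
  have hrayi : IntegrableOn ray (Set.Ioi ε) :=
    ((integrableOn_cpow_mul_exp hε hδ _).add (integrableOn_cpow_mul_exp hε hδ _)).const_mul _
  set circ : ℝ := Real.exp (δ * ε) * Real.exp (R * (|Real.log ε| + 2 * Real.pi)) with hcirc
  have hcpow : ∀ s : ℂ, ‖s‖ ≤ R → ∀ t : ℝ, 0 < t →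
      ‖(t : ℂ) ^ (s - 1)‖ ≤ t ^ (R + 1) + t ^ (-(R + 1)) := by
    intro s hs t ht
    rw [Complex.norm_cpow_eq_rpow_re_of_pos ht]
    have h1 := (abs_le.mp ((Complex.abs_re_le_norm s).trans hs))
    simp only [Complex.sub_re, Complex.one_re]
    have p1 : 0 ≤ t ^ (R + 1) := by positivity
    have p2 : 0 ≤ t ^ (-(R + 1)) := by positivity
    rcases le_total 1 t with h | h
    · linarith [Real.rpow_le_rpow_of_exponent_le h (by linarith : s.re - 1 ≤ R + 1)]
    · linarith [Real.rpow_le_rpow_of_exponent_ge ht h (by linarith : -(R + 1) ≤ s.re - 1)]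
  refine ⟨fun x => Set.indicator (Set.Iio 0) (fun x => ray (ε - x)) x
    + Set.indicator (Set.Icc 0 (2 * Real.pi)) (fun _ => circ) x
    + Set.indicator (Set.Ioi (2 * Real.pi)) (fun x => ray (ε + (x - 2 * Real.pi))) x, ?_, ?_⟩
  · refine ((IntegrableOn.integrable_indicator ?_ measurableSet_Iio).add
      (IntegrableOn.integrable_indicator ?_ measurableSet_Icc)).add
      (IntegrableOn.integrable_indicator ?_ measurableSet_Ioi)
    · have h1 : MeasurePreserving (fun x : ℝ => ε - x) volume volume :=
        Measure.measurePreserving_sub_left volume ε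
      have h2 := (h1.integrableOn_comp_preimage
        (Homeomorph.subLeft ε).measurableEmbedding (s := Set.Ioi ε) (f := ray)).mpr hrayi
      refine (h2.congr_set_ae ?_)
      refine Eventually.of_forall fun x => propext ?_
      show x < 0 ↔ ε < ε - x
      constructor <;> intro h <;> linarith
    · exact integrableOn_const measure_Icc_lt_top.ne
    · have h1 : MeasurePreserving (fun x : ℝ => x + (ε - 2 * Real.pi)) volume volume :=
        measurePreserving_add_right volume _
      have h2 := (h1.integrableOn_comp_preimage
        (Homeomorph.addRight (ε - 2 * Real.pi)).measurableEmbedding (s := Set.Ioi ε)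
          (f := ray)).mpr hrayi
      have h3 : (ray ∘ fun x : ℝ => x + (ε - 2 * Real.pi))
          = fun x => ray (ε + (x - 2 * Real.pi)) := by
        funext x
        simp only [Function.comp]
        congr 1
        ring
      rw [h3] at h2
      refine (h2.congr_set_ae ?_)
      refine Eventually.of_forall fun x => propext ?_
      show 2 * Real.pi < x ↔ ε < x + (ε - 2 * Real.pi)
      constructor <;> intro h <;> linarith
  · intro s hs x
    have hR0 : 0 ≤ R := (norm_nonneg s).trans hs
    have hpi := Real.pi_pos
    have hexp1 : 1 ≤ Real.exp (2 * Real.pi * R) := Real.one_le_exp (by positivity)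
    have hray0 : ∀ t, 0 < t → 0 ≤ ray t := fun t ht => by simp only [hray]; positivity
    rcases lt_or_ge x 0 with hx | hx
    · have h2 : x ∉ Set.Icc 0 (2 * Real.pi) := fun h => not_lt.mpr h.1 hx
      have h3 : x ∉ Set.Ioi (2 * Real.pi) := fun h => by
        have : 2 * Real.pi < x := h
        linarith
      simp only [Set.indicator_of_mem (show x ∈ Set.Iio 0 from hx), Set.indicator_of_notMem h2,
        Set.indicator_of_notMem h3, add_zero]
      rw [hankelPoint_of_neg hx, hankelWeight_of_neg hε s hx, norm_neg, Complex.ofReal_re]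
      have ht : 0 < ε - x := by linarith
      have := hcpow s hs _ ht
      calc Real.exp (-δ * (ε - x)) * ‖((ε - x : ℝ) : ℂ) ^ (s - 1)‖
          ≤ Real.exp (-δ * (ε - x)) * ((ε - x) ^ (R + 1) + (ε - x) ^ (-(R + 1))) := by gcongr
        _ = 1 * ((ε - x) ^ (R + 1) * Real.exp (-δ * (ε - x))
            + (ε - x) ^ (-(R + 1)) * Real.exp (-δ * (ε - x))) := by ring
        _ ≤ ray (ε - x) := by
            simp only [hray]
            gcongr
    rcases le_or_gt x (2 * Real.pi) with hx' | hx'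
    · have h1 : x ∉ Set.Iio (0 : ℝ) := not_lt.mpr hx
      have h3 : x ∉ Set.Ioi (2 * Real.pi) := not_lt.mpr hx'
      simp only [Set.indicator_of_mem (show x ∈ Set.Icc 0 (2 * Real.pi) from ⟨hx, hx'⟩),
        Set.indicator_of_notMem h1, Set.indicator_of_notMem h3, add_zero, zero_add]
      rw [hankelWeight_of_mem hε s ⟨hx, hx'⟩, norm_mul, Complex.norm_I, mul_one, Complex.norm_exp]
      have h4 : -ε ≤ (hankelPoint ε x).re := by
        have h5 : ‖hankelPoint ε x‖ = ε := by
          rw [hankelPoint_of_mem ⟨hx, hx'⟩, norm_mul, Complex.norm_exp_ofReal_mul_I,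
            mul_one, Complex.norm_real, Real.norm_of_nonneg hε.le]
        linarith [neg_abs_le (hankelPoint ε x).re, Complex.abs_re_le_norm (hankelPoint ε x)]
      have h6 : ‖(Real.log ε + x * Complex.I : ℂ)‖ ≤ |Real.log ε| + 2 * Real.pi := by
        refine (norm_add_le _ _).trans ?_
        rw [norm_mul, Complex.norm_I, mul_one, Complex.norm_real, Complex.norm_real,
          Real.norm_eq_abs, Real.norm_eq_abs, abs_of_nonneg hx]
        linarith
      have h7 : (s * (Real.log ε + x * Complex.I)).re ≤ R * (|Real.log ε| + 2 * Real.pi) := by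
        refine (Complex.re_le_norm _).trans ?_
        rw [norm_mul]
        exact mul_le_mul hs h6 (norm_nonneg _) hR0
      have h8 : -δ * (hankelPoint ε x).re ≤ δ * ε := by nlinarith
      exact mul_le_mul (Real.exp_le_exp.mpr h8) (Real.exp_le_exp.mpr h7) (Real.exp_pos _).le
        (Real.exp_pos _).le
    · have h1 : x ∉ Set.Iio (0 : ℝ) := not_lt.mpr hx
      have h2 : x ∉ Set.Icc 0 (2 * Real.pi) := fun h => not_le.mpr hx' h.2
      simp only [Set.indicator_of_mem (show x ∈ Set.Ioi (2 * Real.pi) from hx'),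
        Set.indicator_of_notMem h1, Set.indicator_of_notMem h2, zero_add]
      rw [hankelPoint_of_gt hx', hankelWeight_of_gt hε s hx', norm_mul, Complex.ofReal_re,
        Complex.norm_exp]
      have ht : 0 < ε + (x - 2 * Real.pi) := by linarith
      have h3 := hcpow s hs _ ht
      have h4 : (2 * Real.pi * Complex.I * s).re ≤ 2 * Real.pi * R := by
        refine (Complex.re_le_norm _).trans ?_
        rw [norm_mul, norm_mul, Complex.norm_I, mul_one]
        have : ‖(2 * Real.pi : ℂ)‖ = 2 * Real.pi := by
          rw [norm_mul, Complex.norm_real, Real.norm_of_nonneg hpi.le]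
          simp
        rw [this]
        gcongr
      set t := ε + (x - 2 * Real.pi)
      calc Real.exp (-δ * t) * (Real.exp ((2 * Real.pi * Complex.I * s).re) * ‖(t : ℂ) ^ (s - 1)‖)
          ≤ Real.exp (-δ * t) * (Real.exp (2 * Real.pi * R) * (t ^ (R + 1) + t ^ (-(R + 1)))) := by
            gcongr
        _ = ray t := by
            simp only [hray]
            ring

/-! ### Independence of the radius and collapse of the contour. -/

section OneVariable

variable {ρ δ ε : ℝ} {f : ℂ → ℂ} {s : ℂ}

lemma DecayingOn.integrable_path (hf : DecayingOn ρ δ f) {p : ℝ → ℂ} (hp : Measurable p)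
    (hpρ : ∀ x, p x ∈ openStrip ρ) {k : ℝ → ℂ} (hk : Measurable k) {g : ℝ → ℝ} (hg : Integrable g)
    (hkg : ∀ x, Real.exp (-δ * (p x).re) * ‖k x‖ ≤ g x) :
    Integrable fun x => f (p x) * k x := by
  obtain ⟨C, hC⟩ := hf.bound
  refine (hg.const_mul |C|).mono' ((hf.measurable.comp hp).mul hk).aestronglyMeasurable
    (Eventually.of_forall fun x => ?_)
  rw [norm_mul]
  calc ‖f (p x)‖ * ‖k x‖ ≤ (|C| * Real.exp (-δ * (p x).re)) * ‖k x‖ := by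
        gcongr
        exact (hC _ (hpρ x)).trans (mul_le_mul_of_nonneg_right (le_abs_self C) (Real.exp_pos _).le)
    _ = |C| * (Real.exp (-δ * (p x).re) * ‖k x‖) := by ring
    _ ≤ |C| * g x := mul_le_mul_of_nonneg_left (hkg x) (abs_nonneg _)

lemma DecayingOn.integrable_hankel (hf : DecayingOn ρ δ f) (hδ : 0 < δ) (hε : 0 < ε)
    (hερ : ε < ρ) (s : ℂ) : Integrable fun x => f (hankelPoint ε x) * hankelWeight ε s x := by
  obtain ⟨g, hg, hb⟩ := exists_hankelWeight_bound hε hδ ‖s‖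
  exact hf.integrable_path (measurable_hankelPoint ε) (hankelPoint_mem_openStrip hε hερ)
    (measurable_hankelWeight ε s) hg (hb s le_rfl)

/-- A solution of `s Ψ + z Ψ' = f` yields a primitive of `f(t) t ^ (s - 1)`. -/
lemma integral_interval_eq (hf : DecayingOn ρ δ f) {Ψ : ℂ → ℂ}
    (hΨ : DifferentiableOn ℂ Ψ (Metric.ball 0 ρ))
    (hode : ∀ z ∈ Metric.ball (0 : ℂ) ρ, s * Ψ z + z * deriv Ψ z = f z) {a b : ℝ} (ha : 0 ≤ a)
    (hab : a ≤ b) (hb : b < ρ) (has : 0 < a ∨ 0 < s.re) :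
    ∫ t in a..b, f t * (t : ℂ) ^ (s - 1) = (b : ℂ) ^ s * Ψ b - (a : ℂ) ^ s * Ψ a := by
  have hmem : ∀ t ∈ Set.Icc a b, (t : ℂ) ∈ Metric.ball (0 : ℂ) ρ := fun t ht => by
    rw [mem_ball_zero_iff, Complex.norm_real, Real.norm_of_nonneg (ha.trans ht.1)]
    exact ht.2.trans_lt hb
  refine intervalIntegral.integral_eq_sub_of_hasDerivAt_of_le
    (f := fun t : ℝ => (t : ℂ) ^ s * Ψ t) hab ?_ (fun t ht => ?_) ?_
  · intro t ht
    have h1 : ContinuousAt (fun t : ℝ => (t : ℂ) ^ s) t := by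
      refine Complex.continuousAt_ofReal_cpow_const t s ?_
      rcases has with h | h
      · exact Or.inr (h.trans_le ht.1).ne'
      · exact Or.inl h
    have h2 : ContinuousAt (fun t : ℝ => Ψ t) t :=
      (hΨ.differentiableAt (Metric.isOpen_ball.mem_nhds (hmem t ht))).continuousAt.comp
        Complex.continuous_ofReal.continuousAt
    exact (h1.mul h2).continuousWithinAt
  · have ht0 : 0 < t := ha.trans_lt ht.1
    have htm := hmem t (Set.Ioo_subset_Icc_self ht)
    have h1 : HasDerivAt (fun z : ℂ => z ^ s) (s * (t : ℂ) ^ (s - 1)) t := by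
      simpa using (hasDerivAt_id (t : ℂ)).cpow_const (c := s) (Complex.ofReal_mem_slitPlane.mpr ht0)
    have h2 := (hΨ.differentiableAt (Metric.isOpen_ball.mem_nhds htm)).hasDerivAt
    have h3 := (h1.mul h2).comp_ofReal
    convert! h3 using 1
    have ht0' : (t : ℂ) ≠ 0 := Complex.ofReal_ne_zero.mpr ht0.ne'
    have h4 : (t : ℂ) ^ s = t * (t : ℂ) ^ (s - 1) := by
      rw [Complex.cpow_sub _ _ ht0', Complex.cpow_one]
      field_simp
    rw [← hode _ htm, h4]
    ring
  · have h1 : IntervalIntegrable (fun t : ℝ => (t : ℂ) ^ (s - 1)) volume a b := by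
      rcases has with h | h
      · refine intervalIntegral.intervalIntegrable_cpow (Or.inr ?_)
        rw [Set.uIcc_of_le hab]
        exact fun h0 => not_lt.mpr h0.1 h
      · exact intervalIntegral.intervalIntegrable_cpow' (by simpa using h)
    refine h1.continuousOn_mul ?_
    rw [Set.uIcc_of_le hab]
    exact hf.holomorphic.continuousOn.comp Complex.continuous_ofReal.continuousOn fun t ht =>
      ofReal_mem_openStrip (ha.trans_lt (hab.trans_lt hb)) (ha.trans ht.1)

lemma DecayingOn.integrableOn_ray (hf : DecayingOn ρ δ f) (hδ : 0 < δ) (hε : 0 ≤ ε)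
    (hρ : 0 < ρ) (hs : 0 < ε ∨ 0 < s.re) :
    IntegrableOn (fun t : ℝ => f t * (t : ℂ) ^ (s - 1)) (Set.Ioi ε) := by
  obtain ⟨C, hC⟩ := hf.bound
  have h1 : IntegrableOn (fun t : ℝ => t ^ (s.re - 1) * Real.exp (-δ * t)) (Set.Ioi ε) := by
    rcases hs with h | h
    · exact integrableOn_cpow_mul_exp h hδ _
    · have := integrableOn_rpow_mul_exp_neg_mul_rpow (p := 1) (s := s.re - 1) (b := δ)
        (by linarith) one_pos hδ
      simp only [Real.rpow_one] at this
      exact this.mono_set (Set.Ioi_subset_Ioi hε)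
  refine Integrable.mono' (h1.const_mul |C|) ?_ ?_
  · refine Measurable.aestronglyMeasurable ?_
    have := hf.measurable
    fun_prop
  · filter_upwards [ae_restrict_mem measurableSet_Ioi] with t ht
    have ht0 : 0 < t := hε.trans_lt ht
    rw [norm_mul, Complex.norm_cpow_eq_rpow_re_of_pos ht0]
    have h2 := hC t (ofReal_mem_openStrip hρ ht0.le)
    rw [Complex.ofReal_re] at h2
    calc ‖f t‖ * t ^ (s - 1).re ≤ (|C| * Real.exp (-δ * t)) * t ^ (s - 1).re := by
          gcongr
          exact h2.trans (mul_le_mul_of_nonneg_right (le_abs_self C) (Real.exp_pos _).le)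
      _ = |C| * (t ^ (s.re - 1) * Real.exp (-δ * t)) := by simp; ring

/-- Along the circle t^s Ψ(t), with the continuous branch of t^s, is a primitive of the integrand; Ψ
is single-valued, so its increment is the monodromy factor e^{2πis} - 1 times the initial value. -/
lemma integral_circle_eq (hf : DecayingOn ρ δ f) (hδ : 0 < δ) (hε : 0 < ε) (hερ : ε < ρ)
    {Ψ : ℂ → ℂ} (hΨ : DifferentiableOn ℂ Ψ (Metric.ball 0 ρ))
    (hode : ∀ z ∈ Metric.ball (0 : ℂ) ρ, s * Ψ z + z * deriv Ψ z = f z) :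
    ∫ x in (0 : ℝ)..(2 * Real.pi), f (hankelPoint ε x) * hankelWeight ε s x
      = (Complex.exp (2 * Real.pi * Complex.I * s) - 1) * ((ε : ℂ) ^ s * Ψ ε) := by
  have hpi : (0 : ℝ) ≤ 2 * Real.pi := by positivity
  have hpt : ∀ x : ℝ, ε * Complex.exp (x * Complex.I) ∈ Metric.ball (0 : ℂ) ρ := fun x => by
    rw [mem_ball_zero_iff, norm_mul, Complex.norm_exp_ofReal_mul_I,
      mul_one, Complex.norm_real, Real.norm_of_nonneg hε.le]
    exact hερ
  have hint := (hf.integrable_hankel hδ hε hερ s).intervalIntegrable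
    (a := 0) (b := 2 * Real.pi)
  rw [intervalIntegral.integral_eq_sub_of_hasDerivAt
    (f := fun x : ℝ => Complex.exp (s * (Real.log ε + x * Complex.I))
      * Ψ (ε * Complex.exp (x * Complex.I))) (fun x hx => ?_) hint]
  · rw [Complex.cpow_def_of_ne_zero (Complex.ofReal_ne_zero.mpr hε.ne'), ← Complex.ofReal_log hε.le]
    simp only [Complex.ofReal_zero, zero_mul, add_zero, Complex.exp_zero, mul_one]
    push_cast
    rw [Complex.exp_two_pi_mul_I, mul_one, mul_add, Complex.exp_add]
    ring_nf
  · rw [Set.uIcc_of_le hpi] at hx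
    rw [hankelPoint_of_mem hx, hankelWeight_of_mem hε s hx, ← hode _ (hpt x)]
    have hl : HasDerivAt (fun x : ℝ => (x : ℂ) * Complex.I) Complex.I x := by
      simpa using (hasDerivAt_id x).ofReal_comp.mul_const Complex.I
    have h1 : HasDerivAt (fun x : ℝ => Complex.exp (s * (Real.log ε + x * Complex.I)))
        (Complex.exp (s * (Real.log ε + x * Complex.I)) * (s * Complex.I)) x :=
      ((hl.const_add _).const_mul s).cexp
    have h2 : HasDerivAt (fun x : ℝ => ε * Complex.exp (x * Complex.I))
        (ε * (Complex.exp (x * Complex.I) * Complex.I)) x := hl.cexp.const_mul _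
    have h3 := HasDerivAt.comp x
      (hΨ.differentiableAt (Metric.isOpen_ball.mem_nhds (hpt x))).hasDerivAt h2
    convert! h1.mul h3 using 1
    simp only [Function.comp]
    ring

/-- The Hankel integral in terms of an integral along the half-line. -/
lemma integral_hankel_eq (hf : DecayingOn ρ δ f) (hδ : 0 < δ) (hε : 0 < ε) (hερ : ε < ρ)
    {Ψ : ℂ → ℂ} (hΨ : DifferentiableOn ℂ Ψ (Metric.ball 0 ρ))
    (hode : ∀ z ∈ Metric.ball (0 : ℂ) ρ, s * Ψ z + z * deriv Ψ z = f z) :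
    ∫ x, f (hankelPoint ε x) * hankelWeight ε s x
      = (Complex.exp (2 * Real.pi * Complex.I * s) - 1) *
        ((∫ t in Set.Ioi ε, f t * (t : ℂ) ^ (s - 1)) + (ε : ℂ) ^ s * Ψ ε) := by
  have hint := hf.integrable_hankel hδ hε hερ s
  -- The incoming ray contributes minus the ray integral, the outgoing one e^{2πis} times it.
  rw [← intervalIntegral.integral_Iic_add_Ioi hint.integrableOn hint.integrableOn (b := 0),
    ← intervalIntegral.integral_interval_add_Ioi hint.integrableOn hint.integrableOn
      (b := 2 * Real.pi), integral_circle_eq hf hδ hε hερ hΨ hode, integral_Iic_eq_integral_Iio]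
  have h1 : ∫ x in Set.Iio (0 : ℝ), f (hankelPoint ε x) * hankelWeight ε s x
      = -∫ t in Set.Ioi ε, f t * (t : ℂ) ^ (s - 1) := by
    have h2 : MeasurePreserving (fun x : ℝ => ε - x) volume volume :=
      Measure.measurePreserving_sub_left volume ε
    have h3 := h2.setIntegral_preimage_emb (Homeomorph.subLeft ε).measurableEmbedding
      (fun t : ℝ => f t * (t : ℂ) ^ (s - 1)) (Set.Ioi ε)
    have h4 : (fun x : ℝ => ε - x) ⁻¹' Set.Ioi ε = Set.Iio 0 := by
      ext x
      show ε < ε - x ↔ x < 0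
      constructor <;> intro h <;> linarith
    rw [← h3, h4, ← integral_neg]
    refine setIntegral_congr_fun measurableSet_Iio fun x hx => ?_
    rw [hankelPoint_of_neg hx, hankelWeight_of_neg hε s hx]
    ring
  have h2 : ∫ x in Set.Ioi (2 * Real.pi), f (hankelPoint ε x) * hankelWeight ε s x
      = Complex.exp (2 * Real.pi * Complex.I * s)
        * ∫ t in Set.Ioi ε, f t * (t : ℂ) ^ (s - 1) := by
    have h2 : MeasurePreserving (fun x : ℝ => x + (ε - 2 * Real.pi)) volume volume :=
      measurePreserving_add_right volume _
    have h3 := h2.setIntegral_preimage_emb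
      (Homeomorph.addRight (ε - 2 * Real.pi)).measurableEmbedding
      (fun t : ℝ => f t * (t : ℂ) ^ (s - 1)) (Set.Ioi ε)
    have h4 : (fun x : ℝ => x + (ε - 2 * Real.pi)) ⁻¹' Set.Ioi ε = Set.Ioi (2 * Real.pi) := by
      ext x
      show ε < x + (ε - 2 * Real.pi) ↔ 2 * Real.pi < x
      constructor <;> intro h <;> linarith
    rw [← h3, h4, ← integral_const_mul]
    refine setIntegral_congr_fun measurableSet_Ioi fun x hx => ?_
    rw [hankelPoint_of_gt hx, hankelWeight_of_gt hε s hx,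
      show x + (ε - 2 * Real.pi) = ε + (x - 2 * Real.pi) by ring]
    ring
  rw [h1, h2]
  ring

/-- The Hankel integral does not depend on the radius. -/
lemma integral_hankel_eq_integral_hankel (hf : DecayingOn ρ δ f) (hδ : 0 < δ) (hε : 0 < ε)
    (hερ : ε < ρ) {ε' : ℝ} (hε' : 0 < ε') (hερ' : ε' < ρ) (hs : ∀ n : ℕ, (n : ℂ) + s ≠ 0) :
    ∫ x, f (hankelPoint ε x) * hankelWeight ε s x
      = ∫ x, f (hankelPoint ε' x) * hankelWeight ε' s x := by
  wlog hle : ε' ≤ ε generalizing ε ε'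
  · exact (this hε' hερ' hε hερ (le_of_not_ge hle)).symm
  obtain ⟨Ψ, hΨ, hode⟩ := exists_antiderivative
    (hf.holomorphic.mono (ball_subset_openStrip ρ)) hs
  have hρ := hε.trans hερ
  rw [integral_hankel_eq hf hδ hε hερ hΨ hode, integral_hankel_eq hf hδ hε' hερ' hΨ hode,
    ← intervalIntegral.integral_interval_add_Ioi
      (hf.integrableOn_ray hδ hε'.le hρ (Or.inl hε')) (hf.integrableOn_ray hδ hε.le hρ (Or.inl hε)),
    integral_interval_eq hf hΨ hode hε'.le hle hερ (Or.inl hε')]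
  ring

/-- The Hankel integral in the half-plane in which the contour can be collapsed. -/
lemma integral_hankel_eq_integral_Ioi (hf : DecayingOn ρ δ f) (hδ : 0 < δ) (hε : 0 < ε)
    (hερ : ε < ρ) (hs : 0 < s.re) :
    ∫ x, f (hankelPoint ε x) * hankelWeight ε s x
      = (Complex.exp (2 * Real.pi * Complex.I * s) - 1) *
        ∫ t in Set.Ioi (0 : ℝ), f t * (t : ℂ) ^ (s - 1) := by
  have hs' : ∀ n : ℕ, (n : ℂ) + s ≠ 0 := by
    intro n h
    have := congrArg Complex.re h
    simp at this
    have hn : (0 : ℝ) ≤ n := Nat.cast_nonneg n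
    linarith
  obtain ⟨Ψ, hΨ, hode⟩ := exists_antiderivative
    (hf.holomorphic.mono (ball_subset_openStrip ρ)) hs'
  have hρ := hε.trans hερ
  have hs0 : s ≠ 0 := by
    rintro rfl
    simp at hs
  rw [integral_hankel_eq hf hδ hε hερ hΨ hode, ← intervalIntegral.integral_interval_add_Ioi
      (hf.integrableOn_ray hδ le_rfl hρ (Or.inr hs)) (hf.integrableOn_ray hδ hε.le hρ (Or.inl hε)),
    integral_interval_eq hf hΨ hode le_rfl hε.le hερ (Or.inr hs)]
  simp only [Complex.ofReal_zero, Complex.zero_cpow hs0, zero_mul, sub_zero]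
  ring

end OneVariable

/-- The normalizing factor `1 / ((exp (2 π i s) - 1) Γ(s))`, with its removable singularities at
the non-positive integers removed. -/
def hankelFactor (s : ℂ) : ℂ :=
  Complex.Gamma (1 - s) * Complex.exp (-(Real.pi * Complex.I * s)) / (2 * Real.pi * Complex.I)

lemma exp_sub_one_ne_zero {s : ℂ} (hs : ∀ n : ℤ, s ≠ n) :
    Complex.exp (2 * Real.pi * Complex.I * s) - 1 ≠ 0 := by
  intro h
  obtain ⟨n, hn⟩ := Complex.exp_eq_one_iff.mp (sub_eq_zero.mp h)
  refine hs n ?_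
  have h2 : (2 * Real.pi * Complex.I : ℂ) ≠ 0 := Complex.two_pi_I_ne_zero
  rw [mul_comm] at hn
  exact mul_right_cancel₀ h2 hn

/-- Reflection formula: e^{2πis} - 1 = 2i e^{πis} sin(πs) and Γ(s) sin(πs) = π / Γ(1 - s). -/
lemma one_div_eq_hankelFactor {s : ℂ} (hs : ∀ n : ℤ, s ≠ n) :
    1 / ((Complex.exp (2 * Real.pi * Complex.I * s) - 1) * Complex.Gamma s) = hankelFactor s := by
  have hG : Complex.Gamma s ≠ 0 := Complex.Gamma_ne_zero fun m => by
    have := hs (-m)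
    push_cast at this
    exact this
  have hE := exp_sub_one_ne_zero hs
  have hpi : (Real.pi : ℂ) ≠ 0 := Complex.ofReal_ne_zero.mpr Real.pi_ne_zero
  set e := Complex.exp (Real.pi * Complex.I * s) with he
  have he0 : e ≠ 0 := Complex.exp_ne_zero _
  have h1 : Complex.exp (2 * Real.pi * Complex.I * s) = e ^ 2 := by
    rw [he, ← Complex.exp_nat_mul]
    congr 1
    push_cast
    ring
  have h2 : Complex.exp (-(Real.pi * Complex.I * s)) = e⁻¹ := by rw [he, Complex.exp_neg]
  have hsin : 2 * Complex.sin (Real.pi * s) = (e⁻¹ - e) * Complex.I := by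
    rw [Complex.two_sin, he, ← Complex.exp_neg,
      show -(Real.pi * s : ℂ) * Complex.I = -(Real.pi * Complex.I * s) by ring,
      show (Real.pi * s : ℂ) * Complex.I = Real.pi * Complex.I * s by ring]
  rw [h1] at hE
  have hsin0 : Complex.sin (Real.pi * s) ≠ 0 := by
    intro h0
    rw [h0, mul_zero] at hsin
    have h3 : e⁻¹ - e = 0 := (mul_eq_zero.mp hsin.symm).resolve_right Complex.I_ne_zero
    apply hE
    field_simp at h3
    linear_combination -h3
  have hgam := Complex.Gamma_mul_Gamma_one_sub s
  have hG1 : Complex.Gamma (1 - s) = Real.pi / Complex.sin (Real.pi * s) / Complex.Gamma s := by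
    rw [← hgam]
    field_simp
  have hsin2 : Complex.sin (Real.pi * s) = (e⁻¹ - e) * Complex.I / 2 := by
    rw [← hsin]
    ring
  rw [hankelFactor, hG1, h1, h2]
  have hI := Complex.I_ne_zero
  have hI2 := Complex.I_sq
  field_simp
  rw [hsin2]
  field_simp
  linear_combination (-(e ^ 2 - 1)) * hI2

/-! ### Iterated integrals over weighted paths -/

/-- A weighted path in a neighbourhood of the half-line, against which exponentially decaying
functions can be integrated. -/
structure IsWeightedPath (ρ δ : ℝ) (p k : ℝ → ℂ) : Prop where
  measurable_point : Measurable p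
  measurable_weight : Measurable k
  mem : ∀ x, p x ∈ openStrip ρ
  integrable : Integrable fun x => Real.exp (-δ * (p x).re) * ‖k x‖

/-- The class of functions of several variables that are holomorphic and exponentially decaying
when all variables are near the positive half-line. -/
structure DecayingOnPi {r : ℕ} (ρ δ : ℝ) (φ : (Fin r → ℂ) → ℂ) : Prop where
  measurable : Measurable φ
  holomorphic : DifferentiableOn ℂ φ {t | ∀ k, t k ∈ openStrip ρ}
  bound : ∃ C ≥ 0, ∀ t : Fin r → ℂ, (∀ k, t k ∈ openStrip ρ) →
    ‖φ t‖ ≤ C * ∏ k, Real.exp (-δ * (t k).re)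

section Paths

variable {r : ℕ} {ρ δ : ℝ}

lemma DecayingOnPi.slice {φ : (Fin (r + 1) → ℂ) → ℂ} (hφ : DecayingOnPi ρ δ φ) {z : ℂ}
    (hz : z ∈ openStrip ρ) :
    DecayingOnPi ρ δ fun t : Fin r → ℂ => φ (Fin.cons z t : Fin (r + 1) → ℂ) := by
  obtain ⟨C, hC0, hC⟩ := hφ.bound
  have hmem : ∀ t : Fin r → ℂ, (∀ k, t k ∈ openStrip ρ) →
      ∀ k, (Fin.cons z t : Fin (r + 1) → ℂ) k ∈ openStrip ρ := fun t ht k => by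
    refine Fin.cases ?_ (fun j => ?_) k
    · simpa using hz
    · simpa using ht j
  refine ⟨hφ.measurable.comp ?_, ?_, C * Real.exp (-δ * z.re), by positivity, fun t ht => ?_⟩
  · rw [measurable_pi_iff]
    intro k
    refine Fin.cases ?_ (fun j => ?_) k
    · simp
    · simpa using measurable_pi_apply j
  · refine hφ.holomorphic.comp (Differentiable.differentiableOn ?_) fun t ht => hmem t ht
    rw [differentiable_pi]
    intro k
    refine Fin.cases ?_ (fun j => ?_) k
    · simp
    · simpa using differentiable_apply j
  · have := hC _ (hmem t ht)
    rw [Fin.prod_univ_succ] at this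
    simpa [mul_assoc] using this

lemma DecayingOnPi.slice_left {φ : (Fin (r + 1) → ℂ) → ℂ} (hφ : DecayingOnPi ρ δ φ)
    {t : Fin r → ℂ} (ht : ∀ k, t k ∈ openStrip ρ) :
    DecayingOn ρ δ fun z => φ (Fin.cons z t : Fin (r + 1) → ℂ) := by
  obtain ⟨C, hC0, hC⟩ := hφ.bound
  have hmem : ∀ z ∈ openStrip ρ, ∀ k, (Fin.cons z t : Fin (r + 1) → ℂ) k ∈ openStrip ρ :=
    fun z hz k => by
      refine Fin.cases ?_ (fun j => ?_) k
      · simpa using hz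
      · simpa using ht j
  refine ⟨hφ.measurable.comp ?_, ?_, C * ∏ k, Real.exp (-δ * (t k).re), fun z hz => ?_⟩
  · rw [measurable_pi_iff]
    intro k
    refine Fin.cases ?_ (fun j => ?_) k
    · simpa using measurable_id'
    · simp
  · refine hφ.holomorphic.comp (Differentiable.differentiableOn ?_) fun z hz => hmem z hz
    rw [differentiable_pi]
    intro k
    refine Fin.cases ?_ (fun j => ?_) k
    · simp
    · simp
  · have := hC _ (hmem z hz)
    rw [Fin.prod_univ_succ] at this
    simp only [Fin.cons_zero, Fin.cons_succ] at this
    linarith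

/-- The integral of `φ` over a product of weighted paths. -/
def pathIntegral (φ : (Fin r → ℂ) → ℂ) (p k : Fin r → ℝ → ℂ) : ℂ :=
  ∫ x : Fin r → ℝ, φ (fun i => p i (x i)) * ∏ i, k i (x i)

lemma DecayingOnPi.norm_le {φ : (Fin r → ℂ) → ℂ} (hφ : DecayingOnPi ρ δ φ) : ∃ C ≥ 0,
    ∀ p k : Fin r → ℝ → ℂ, (∀ i x, p i x ∈ openStrip ρ) → ∀ x : Fin r → ℝ,
      ‖φ (fun i => p i (x i)) * ∏ i, k i (x i)‖
        ≤ C * ∏ i, (Real.exp (-δ * (p i (x i)).re) * ‖k i (x i)‖) := by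
  obtain ⟨C, hC0, hC⟩ := hφ.bound
  refine ⟨C, hC0, fun p k hp x => ?_⟩
  rw [norm_mul, norm_prod, Finset.prod_mul_distrib, ← mul_assoc]
  exact mul_le_mul_of_nonneg_right (hC _ fun i => hp i _)
    (Finset.prod_nonneg fun _ _ => norm_nonneg _)

lemma DecayingOnPi.measurable_integrand {φ : (Fin r → ℂ) → ℂ} (hφ : DecayingOnPi ρ δ φ)
    {p k : Fin r → ℝ → ℂ} (hp : ∀ i, Measurable (p i)) (hk : ∀ i, Measurable (k i)) :
    Measurable fun x : Fin r → ℝ => φ (fun i => p i (x i)) * ∏ i, k i (x i) := by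
  refine (hφ.measurable.comp ?_).mul ?_
  · rw [measurable_pi_iff]
    exact fun i => (hp i).comp (measurable_pi_apply i)
  · exact Finset.measurable_fun_prod _ fun i _ => (hk i).comp (measurable_pi_apply i)

lemma DecayingOnPi.integrable {φ : (Fin r → ℂ) → ℂ} (hφ : DecayingOnPi ρ δ φ)
    {p k : Fin r → ℝ → ℂ} (hpk : ∀ i, IsWeightedPath ρ δ (p i) (k i)) :
    Integrable fun x : Fin r → ℝ => φ (fun i => p i (x i)) * ∏ i, k i (x i) := by
  obtain ⟨C, hC0, hC⟩ := hφ.norm_le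
  refine ((Integrable.fintype_prod fun i => (hpk i).integrable).const_mul C).mono'
    (hφ.measurable_integrand (fun i => (hpk i).measurable_point)
      fun i => (hpk i).measurable_weight).aestronglyMeasurable
    (Eventually.of_forall fun x => hC p k (fun i => (hpk i).mem) x)

lemma pathIntegral_eq_prod (φ : (Fin (r + 1) → ℂ) → ℂ) (p k : Fin (r + 1) → ℝ → ℂ) :
    pathIntegral φ p k = ∫ y : ℝ × (Fin r → ℝ),
      φ (Fin.cons (p 0 y.1) (fun i => p i.succ (y.2 i)) : Fin (r + 1) → ℂ) *
        (k 0 y.1 * ∏ i, k i.succ (y.2 i)) := by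
  rw [pathIntegral, ← ((volume_preserving_piFinSuccAbove (fun _ : Fin (r + 1) => ℝ) 0).symm
    ).integral_comp']
  refine integral_congr_ae (Eventually.of_forall fun y => ?_)
  simp only [MeasurableEquiv.piFinSuccAbove_symm_apply, Fin.insertNthEquiv, Equiv.coe_fn_mk,
    Fin.insertNth_zero, Fin.prod_univ_succ]
  congr 2
  funext i
  refine Fin.cases ?_ (fun j => ?_) i <;> simp

lemma DecayingOnPi.integrable_prod {φ : (Fin (r + 1) → ℂ) → ℂ} (hφ : DecayingOnPi ρ δ φ)
    {p k : Fin (r + 1) → ℝ → ℂ} (hpk : ∀ i, IsWeightedPath ρ δ (p i) (k i)) :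
    Integrable fun y : ℝ × (Fin r → ℝ) =>
      φ (Fin.cons (p 0 y.1) (fun i => p i.succ (y.2 i)) : Fin (r + 1) → ℂ) *
        (k 0 y.1 * ∏ i, k i.succ (y.2 i)) := by
  have h := hφ.integrable hpk
  rw [← ((volume_preserving_piFinSuccAbove (fun _ : Fin (r + 1) => ℝ) 0).symm
    ).integrable_comp_emb (MeasurableEquiv.measurableEmbedding _)] at h
  refine h.congr (Eventually.of_forall fun y => ?_)
  simp only [Function.comp, MeasurableEquiv.piFinSuccAbove_symm_apply, Fin.insertNthEquiv,
    Equiv.coe_fn_mk, Fin.insertNth_zero, Fin.prod_univ_succ]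
  congr 2
  funext i
  refine Fin.cases ?_ (fun j => ?_) i <;> simp

lemma pathIntegral_eq_left {φ : (Fin (r + 1) → ℂ) → ℂ} (hφ : DecayingOnPi ρ δ φ)
    {p k : Fin (r + 1) → ℝ → ℂ} (hpk : ∀ i, IsWeightedPath ρ δ (p i) (k i)) :
    pathIntegral φ p k = ∫ a, k 0 a * pathIntegral
      (fun t : Fin r → ℂ => φ (Fin.cons (p 0 a) t : Fin (r + 1) → ℂ))
      (fun i => p i.succ) (fun i => k i.succ) := by
  rw [pathIntegral_eq_prod, Measure.volume_eq_prod, integral_prod _ (hφ.integrable_prod hpk)]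
  refine integral_congr_ae (Eventually.of_forall fun a => ?_)
  simp only [pathIntegral]
  rw [← integral_const_mul]
  refine integral_congr_ae (Eventually.of_forall fun b => ?_)
  ring

lemma pathIntegral_eq_right {φ : (Fin (r + 1) → ℂ) → ℂ} (hφ : DecayingOnPi ρ δ φ)
    {p k : Fin (r + 1) → ℝ → ℂ} (hpk : ∀ i, IsWeightedPath ρ δ (p i) (k i)) :
    pathIntegral φ p k = ∫ b : Fin r → ℝ, (∏ i, k i.succ (b i)) *
      ∫ a, φ (Fin.cons (p 0 a) (fun i => p i.succ (b i)) : Fin (r + 1) → ℂ) * k 0 a := by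
  rw [pathIntegral_eq_prod, Measure.volume_eq_prod, integral_prod_symm _ (hφ.integrable_prod hpk)]
  refine integral_congr_ae (Eventually.of_forall fun b => ?_)
  beta_reduce
  rw [← integral_const_mul]
  refine integral_congr_ae (Eventually.of_forall fun a => ?_)
  ring

/-- Weighted paths that are equivalent for functions of one variable are equivalent for functions of
several variables. -/
lemma pathIntegral_congr : ∀ {r : ℕ} {φ : (Fin r → ℂ) → ℂ} (_ : DecayingOnPi ρ δ φ)
    {p k q l : Fin r → ℝ → ℂ} (_ : ∀ i, IsWeightedPath ρ δ (p i) (k i))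
    (_ : ∀ i, IsWeightedPath ρ δ (q i) (l i))
    (_ : ∀ i f, DecayingOn ρ δ f → ∫ x, f (p i x) * k i x = ∫ x, f (q i x) * l i x),
    pathIntegral φ p k = pathIntegral φ q l := by
  intro r
  induction r with
  | zero =>
    intro φ _ p k q l _ _ _
    simp only [pathIntegral, Finset.univ_eq_empty, Finset.prod_empty]
    congr 1
    funext x
    congr 2
    exact Subsingleton.elim _ _
  | succ r ih =>
    intro φ hφ p k q l hpk hql h
    -- The intermediate family keeps the first path and exchanges the others. With the first
    -- variable outermost the induction hypothesis applies to the slices; with it innermost the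
    -- hypothesis in one variable does.
    have hmix : ∀ i, IsWeightedPath ρ δ
        ((Fin.cons (p 0) (fun i => q i.succ) : Fin (r + 1) → ℝ → ℂ) i)
        ((Fin.cons (k 0) (fun i => l i.succ) : Fin (r + 1) → ℝ → ℂ) i) := fun i => by
      refine Fin.cases ?_ (fun j => ?_) i
      · simpa using hpk 0
      · simpa using hql j.succ
    trans pathIntegral φ (Fin.cons (p 0) (fun i => q i.succ)) (Fin.cons (k 0) (fun i => l i.succ))
    · rw [pathIntegral_eq_left hφ hpk, pathIntegral_eq_left hφ hmix]
      refine integral_congr_ae (Eventually.of_forall fun a => ?_)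
      simp only [Fin.cons_zero, Fin.cons_succ]
      rw [ih (hφ.slice ((hpk 0).mem a)) (fun i => hpk i.succ) (fun i => hql i.succ)
        fun i => h i.succ]
    · rw [pathIntegral_eq_right hφ hql, pathIntegral_eq_right hφ hmix]
      refine integral_congr_ae (Eventually.of_forall fun b => ?_)
      simp only [Fin.cons_zero, Fin.cons_succ]
      rw [h 0 _ (hφ.slice_left fun i => (hql i.succ).mem (b i))]

end Paths

/-! ### The two weighted paths that represent the normalized Hankel integral -/

/-- The points of the half-line (for `true`) or of the Hankel contour (for `false`). -/
def pathPoint (ε : ℝ) : Bool → ℝ → ℂ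
  | true, x => ((max x 0 : ℝ) : ℂ)
  | false, x => hankelPoint ε x

/-- The normalized weight `t ^ (s - 1) dt` on the half-line (for `true`) or on the Hankel contour
(for `false`). -/
def pathWeight (ε : ℝ) : Bool → ℂ → ℝ → ℂ
  | true, s, x => if 0 < x then (x : ℂ) ^ (s - 1) * (Complex.Gamma s)⁻¹ else 0
  | false, s, x => hankelFactor s * hankelWeight ε s x

/-- A half-plane in which the normalized weight is holomorphic. -/
def pathRegion : Bool → Set ℂ
  | true => {s | 0 < s.re}
  | false => {s | s.re < 1}

section PathWeights

variable {ρ δ ε : ℝ}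

lemma isOpen_pathRegion (b : Bool) : IsOpen (pathRegion b) := by
  cases b
  · exact isOpen_lt Complex.continuous_re continuous_const
  · exact isOpen_lt continuous_const Complex.continuous_re

lemma measurable_pathPoint (b : Bool) : Measurable (pathPoint ε b) := by
  cases b
  · exact measurable_hankelPoint ε
  · show Measurable fun x : ℝ => ((max x 0 : ℝ) : ℂ)
    fun_prop

lemma measurable_pathWeight (b : Bool) (s : ℂ) : Measurable (pathWeight ε b s) := by
  cases b
  · exact (measurable_hankelWeight ε s).const_mul _
  · exact Measurable.ite measurableSet_Ioi (by fun_prop) (by fun_prop)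

/-- The truncation `max x 0` keeps the point in the strip also for negative x, where the weight
vanishes. -/
lemma pathPoint_mem (hε : 0 < ε) (hερ : ε < ρ) (b : Bool) (x : ℝ) :
    pathPoint ε b x ∈ openStrip ρ := by
  cases b
  · exact hankelPoint_mem_openStrip hε hερ x
  · exact ofReal_mem_openStrip (hε.trans hερ) (le_max_right _ _)

lemma differentiableAt_hankelFactor {s : ℂ} (hs : s.re < 1) :
    DifferentiableAt ℂ hankelFactor s := by
  have h1 : DifferentiableAt ℂ (fun s => Complex.Gamma (1 - s)) s := by
    refine DifferentiableAt.comp s (Complex.differentiableAt_Gamma _ fun m h => ?_) (by fun_prop)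
    have := congrArg Complex.re h
    simp at this
    have hm : (0 : ℝ) ≤ m := Nat.cast_nonneg m
    linarith
  unfold hankelFactor
  exact (h1.mul (by fun_prop)).div_const _

lemma differentiableAt_pathWeight {b : Bool} {s : ℂ} (hs : s ∈ pathRegion b) (x : ℝ) :
    DifferentiableAt ℂ (fun s => pathWeight ε b s x) s := by
  cases b
  · refine (differentiableAt_hankelFactor hs).mul ?_
    unfold hankelWeight
    fun_prop
  · simp only [pathWeight]
    split_ifs with hx
    · have h1 : DifferentiableAt ℂ (fun s : ℂ => (x : ℂ) ^ (s - 1)) s :=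
        DifferentiableAt.const_cpow (by fun_prop) (Or.inl (Complex.ofReal_ne_zero.mpr hx.ne'))
      exact h1.mul (Complex.differentiable_one_div_Gamma s)
    · exact differentiableAt_const _

lemma exists_ball_bound {f : ℂ → ℂ} {s₀ : ℂ} (hf : ContinuousAt f s₀) {U : Set ℂ} (hU : IsOpen U)
    (hs₀ : s₀ ∈ U) : ∃ R > 0, Metric.ball s₀ R ⊆ U ∧ ∀ s ∈ Metric.ball s₀ R, ‖f s‖ ≤ ‖f s₀‖ + 1 := by
  have h1 : ∀ᶠ s in 𝓝 s₀, ‖f s‖ < ‖f s₀‖ + 1 :=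
    hf.norm.eventually_lt_const (lt_add_one _)
  obtain ⟨R, hR, h⟩ := Metric.eventually_nhds_iff_ball.mp (h1.and (hU.mem_nhds hs₀))
  exact ⟨R, hR, fun s hs => (h s hs).2, fun s hs => (h s hs).1.le⟩

/-- A majorant uniform near s₀ is what differentiation under the integral needs. On the half-line Re
s is confined between Re s₀ / 2 and 2 Re s₀, and the sum of the two extreme powers dominates. -/
lemma exists_pathWeight_bound (hε : 0 < ε) (hδ : 0 < δ) {b : Bool} {s₀ : ℂ}
    (hs₀ : s₀ ∈ pathRegion b) :
    ∃ R > 0, Metric.ball s₀ R ⊆ pathRegion b ∧ ∃ g : ℝ → ℝ, Integrable g ∧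
      ∀ s ∈ Metric.ball s₀ R, ∀ x,
        Real.exp (-δ * (pathPoint ε b x).re) * ‖pathWeight ε b s x‖ ≤ g x := by
  cases b
  · obtain ⟨R, hR, hsub, hb⟩ := exists_ball_bound (differentiableAt_hankelFactor hs₀).continuousAt
      (isOpen_pathRegion false) hs₀
    obtain ⟨g, hg, hgb⟩ := exists_hankelWeight_bound hε hδ (‖s₀‖ + R)
    refine ⟨R, hR, hsub, fun x => (‖hankelFactor s₀‖ + 1) * g x, hg.const_mul _, fun s hs x => ?_⟩
    have hs' : ‖s‖ ≤ ‖s₀‖ + R := by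
      have h1 : ‖s - s₀‖ < R := by rwa [Metric.mem_ball, dist_eq_norm] at hs
      calc ‖s‖ = ‖s₀ + (s - s₀)‖ := by congr 1; ring
        _ ≤ ‖s₀‖ + ‖s - s₀‖ := norm_add_le _ _
        _ ≤ _ := by linarith
    have h2 := hgb s hs' x
    simp only [pathPoint, pathWeight, norm_mul]
    calc Real.exp (-δ * (hankelPoint ε x).re) * (‖hankelFactor s‖ * ‖hankelWeight ε s x‖)
        = ‖hankelFactor s‖ * (Real.exp (-δ * (hankelPoint ε x).re) * ‖hankelWeight ε s x‖) := by
          ring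
      _ ≤ (‖hankelFactor s₀‖ + 1) * g x :=
          mul_le_mul (hb s hs) h2 (by positivity) (by positivity)
  · have hpos : 0 < s₀.re := hs₀
    obtain ⟨R, hR, hsub, hb⟩ := exists_ball_bound
      (Complex.differentiable_one_div_Gamma s₀).continuousAt
      ((isOpen_lt continuous_const Complex.continuous_re).inter
        (isOpen_lt Complex.continuous_re continuous_const))
      (show s₀ ∈ {s : ℂ | s₀.re / 2 < s.re} ∩ {s : ℂ | s.re < 2 * s₀.re} from
        ⟨show s₀.re / 2 < s₀.re by linarith, show s₀.re < 2 * s₀.re by linarith⟩)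
    have hint : ∀ a : ℝ, 0 < a →
        IntegrableOn (fun t : ℝ => t ^ (a - 1) * Real.exp (-δ * t)) (Set.Ioi 0) := by
      intro a ha
      have := integrableOn_rpow_mul_exp_neg_mul_rpow (p := 1) (s := a - 1) (b := δ)
        (by linarith) one_pos hδ
      simpa only [Real.rpow_one] using this
    refine ⟨R, hR, fun s hs => ?_, Set.indicator (Set.Ioi 0) fun t =>
      (‖(Complex.Gamma s₀)⁻¹‖ + 1) * (t ^ (s₀.re / 2 - 1) * Real.exp (-δ * t)
        + t ^ (2 * s₀.re - 1) * Real.exp (-δ * t)), ?_, fun s hs x => ?_⟩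
    · have h1 : s₀.re / 2 < s.re := (hsub hs).1
      show 0 < s.re
      linarith
    · refine IntegrableOn.integrable_indicator (Integrable.const_mul ?_ _) measurableSet_Ioi
      exact (hint _ (by linarith)).add (hint _ (by linarith))
    · have h1 : s₀.re / 2 < s.re := (hsub hs).1
      have h2 : s.re < 2 * s₀.re := (hsub hs).2
      by_cases hx : 0 < x
      · simp only [pathPoint, pathWeight, if_pos hx, Set.indicator_of_mem (Set.mem_Ioi.mpr hx),
          Complex.ofReal_re, max_eq_left hx.le, norm_mul]
        rw [Complex.norm_cpow_eq_rpow_re_of_pos hx]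
        have p1 : 0 ≤ x ^ (s₀.re / 2 - 1) := by positivity
        have p2 : 0 ≤ x ^ (2 * s₀.re - 1) := by positivity
        have h3 : x ^ (s - 1).re ≤ x ^ (s₀.re / 2 - 1) + x ^ (2 * s₀.re - 1) := by
          simp only [Complex.sub_re, Complex.one_re]
          rcases le_total 1 x with h | h
          · linarith [Real.rpow_le_rpow_of_exponent_le h
              (by linarith : s.re - 1 ≤ 2 * s₀.re - 1)]
          · linarith [Real.rpow_le_rpow_of_exponent_ge hx h
              (by linarith : s₀.re / 2 - 1 ≤ s.re - 1)]
        calc Real.exp (-δ * x) * (x ^ (s - 1).re * ‖(Complex.Gamma s)⁻¹‖)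
            ≤ Real.exp (-δ * x) * ((x ^ (s₀.re / 2 - 1) + x ^ (2 * s₀.re - 1))
              * (‖(Complex.Gamma s₀)⁻¹‖ + 1)) := by
              gcongr
              exact hb s hs
          _ = _ := by ring
      · simp [pathWeight, hx]

lemma isWeightedPath_pathWeight (hε : 0 < ε) (hερ : ε < ρ) (hδ : 0 < δ) {b : Bool} {s : ℂ}
    (hs : s ∈ pathRegion b) : IsWeightedPath ρ δ (pathPoint ε b) (pathWeight ε b s) := by
  obtain ⟨R, hR, -, g, hg, hb⟩ := exists_pathWeight_bound hε hδ hs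
  have h1 := measurable_pathPoint (ε := ε) b
  have h2 := measurable_pathWeight (ε := ε) b s
  refine ⟨h1, h2, pathPoint_mem hε hερ b, hg.mono' ?_ (Eventually.of_forall fun x => ?_)⟩
  · exact Measurable.aestronglyMeasurable (by fun_prop)
  · rw [norm_mul, norm_norm, Real.norm_of_nonneg (Real.exp_pos _).le]
    exact hb s (Metric.mem_ball_self hR) x

lemma isWeightedPath_hankel (hε : 0 < ε) (hερ : ε < ρ) (hδ : 0 < δ) (c s : ℂ) :
    IsWeightedPath ρ δ (hankelPoint ε) (fun x => c * hankelWeight ε s x) := by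
  obtain ⟨g, hg, hb⟩ := exists_hankelWeight_bound hε hδ ‖s‖
  have h1 := measurable_hankelPoint ε
  have h2 := measurable_hankelWeight ε s
  refine ⟨h1, h2.const_mul c, hankelPoint_mem_openStrip hε hερ,
    (hg.const_mul ‖c‖).mono' ?_ (Eventually.of_forall fun x => ?_)⟩
  · exact ((Real.measurable_exp.comp ((Complex.measurable_re.comp h1).const_mul (-δ))).mul
      (h2.const_mul c).norm).aestronglyMeasurable
  · rw [norm_mul, norm_norm, norm_mul, Real.norm_of_nonneg (Real.exp_pos _).le]
    calc Real.exp (-δ * (hankelPoint ε x).re) * (‖c‖ * ‖hankelWeight ε s x‖)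
        = ‖c‖ * (Real.exp (-δ * (hankelPoint ε x).re) * ‖hankelWeight ε s x‖) := by ring
      _ ≤ ‖c‖ * g x := mul_le_mul_of_nonneg_left (hb s le_rfl x) (norm_nonneg _)

variable {f : ℂ → ℂ}

lemma integral_pathWeight_true (f : ℂ → ℂ) (s : ℂ) :
    ∫ x, f (pathPoint ε true x) * pathWeight ε true s x
      = (Complex.Gamma s)⁻¹ * ∫ t in Set.Ioi (0 : ℝ), f t * (t : ℂ) ^ (s - 1) := by
  rw [← integral_indicator measurableSet_Ioi, ← integral_const_mul]
  refine integral_congr_ae (Eventually.of_forall fun x => ?_)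
  by_cases hx : 0 < x
  · simp only [pathPoint, pathWeight, if_pos hx, Set.indicator_of_mem (Set.mem_Ioi.mpr hx),
      max_eq_left hx.le]
    ring
  · simp only [pathPoint, pathWeight, if_neg hx,
      Set.indicator_of_notMem (fun h => hx (Set.mem_Ioi.mp h)), mul_zero]

lemma integral_hankel_eq_pathWeight_true (hf : DecayingOn ρ δ f) (hδ : 0 < δ) (hε : 0 < ε)
    (hερ : ε < ρ) {ε' : ℝ} {s : ℂ} (hs : 0 < s.re) (hsn : ∀ n : ℤ, s ≠ n) :
    ∫ x, f (hankelPoint ε x) * (hankelFactor s * hankelWeight ε s x)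
      = ∫ x, f (pathPoint ε' true x) * pathWeight ε' true s x := by
  have h1 : ∀ x, f (hankelPoint ε x) * (hankelFactor s * hankelWeight ε s x)
      = hankelFactor s * (f (hankelPoint ε x) * hankelWeight ε s x) := fun x => by ring
  simp_rw [h1]
  rw [integral_const_mul, integral_hankel_eq_integral_Ioi hf hδ hε hερ hs,
    integral_pathWeight_true, ← one_div_eq_hankelFactor hsn]
  have := exp_sub_one_ne_zero hsn
  field_simp

/-- All weighted paths represent the same functional, as long as the argument is not an integer. -/
lemma integral_hankel_eq_pathWeight (hf : DecayingOn ρ δ f) (hδ : 0 < δ) (hε : 0 < ε)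
    (hερ : ε < ρ) {ε' : ℝ} (hε' : 0 < ε') (hερ' : ε' < ρ) {s : ℂ} {b : Bool}
    (hs : s ∈ pathRegion b) (hsn : ∀ n : ℤ, s ≠ n) :
    ∫ x, f (hankelPoint ε x) * (hankelFactor s * hankelWeight ε s x)
      = ∫ x, f (pathPoint ε' b x) * pathWeight ε' b s x := by
  cases b
  · have h1 : ∀ (e : ℝ) (x : ℝ), f (hankelPoint e x) * (hankelFactor s * hankelWeight e s x)
        = hankelFactor s * (f (hankelPoint e x) * hankelWeight e s x) := fun e x => by ring
    simp only [pathPoint, pathWeight]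
    simp_rw [h1]
    rw [integral_const_mul, integral_const_mul,
      integral_hankel_eq_integral_hankel hf hδ hε hερ hε' hερ' fun n h => ?_]
    refine hsn (-n) ?_
    push_cast
    linear_combination h
  · exact integral_hankel_eq_pathWeight_true hf hδ hε hερ hs hsn

/-- Two different half-planes overlap in 0 < Re s < 1, a strip without integers; there both
integrals equal the Hankel integral with its normalizing factor. -/
lemma integral_pathWeight_congr (hf : DecayingOn ρ δ f) (hδ : 0 < δ) (hε : 0 < ε)
    (hερ : ε < ρ) {s : ℂ} {b b' : Bool} (hs : s ∈ pathRegion b) (hs' : s ∈ pathRegion b') :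
    ∫ x, f (pathPoint ε b x) * pathWeight ε b s x
      = ∫ x, f (pathPoint ε b' x) * pathWeight ε b' s x := by
  by_cases hbb : b = b'
  · rw [hbb]
  have hsn : ∀ n : ℤ, s ≠ n := by
    have h : 0 < s.re ∧ s.re < 1 := by
      cases b <;> cases b'
      · exact absurd rfl hbb
      · exact ⟨hs', hs⟩
      · exact ⟨hs, hs'⟩
      · exact absurd rfl hbb
    rintro n rfl
    simp only [Complex.intCast_re] at h
    have h1 : (0 : ℤ) < n := by exact_mod_cast h.1
    have h2 : n < (1 : ℤ) := by exact_mod_cast h.2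
    omega
  rw [← integral_hankel_eq_pathWeight hf hδ hε hερ hε hερ hs hsn,
    ← integral_hankel_eq_pathWeight hf hδ hε hερ hε hερ hs' hsn]

end PathWeights

/-! ### The desingularized function -/

lemma measurable_kernelFactor (c : ℝ) : Measurable (kernelFactor c) := by
  unfold kernelFactor
  exact Measurable.ite (measurableSet_singleton 0) (by fun_prop) (by fun_prop)

/-- The limit of `(-1) ^ r / (c - 1) ^ r * kernel γ c` as `c` tends to `1`. -/
def limitGenerating {r : ℕ} (γ : Fin r → ℂ) (t : Fin r → ℂ) : ℂ :=
  ∏ j : Fin r, limitKernel (γ j * ∑ k ∈ Finset.Ici j, t k)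

/-! ### Decay of the generating functions in all variables. -/

section Bounds

variable {r : ℕ} {γ : Fin r → ℂ}

lemma sum_mem_strip {η : ℝ} (hη : 0 < η) {t : Fin r → ℂ}
    (ht : ∀ k, t k ∈ openStrip (η / (r + 1))) (A : Finset (Fin r)) : ∑ k ∈ A, t k ∈ strip η := by
  have hcard : (A.card : ℝ) * (η / (r + 1)) ≤ η := by
    have h1 : (A.card : ℝ) ≤ r + 1 := by
      have := Finset.card_le_univ A
      simp only [Fintype.card_fin] at this
      have : (A.card : ℝ) ≤ r := by exact_mod_cast this
      linarith
    calc (A.card : ℝ) * (η / (r + 1)) ≤ (r + 1) * (η / (r + 1)) := by gcongr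
      _ = η := by field_simp
  constructor
  · rw [Complex.im_sum]
    calc |∑ k ∈ A, (t k).im| ≤ ∑ k ∈ A, |(t k).im| := Finset.abs_sum_le_sum_abs _ _
      _ ≤ ∑ _k ∈ A, η / (r + 1) := Finset.sum_le_sum fun k _ => (ht k).1.le
      _ ≤ η := by simpa using hcard
  · rw [Complex.re_sum]
    have : ∑ _k ∈ A, -(η / (r + 1)) ≤ ∑ k ∈ A, (t k).re :=
      Finset.sum_le_sum fun k _ => (ht k).2.le
    simp only [Finset.sum_const, nsmul_eq_mul] at this
    linarith

/-- The j-th factor decays in t_j + ⋯ + t_r. The other summands have real part bounded below in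
total by -η, so the decay in t_j alone survives, and the product over j decays in every variable. -/
lemma exists_kernel_bounds (hγ : ∀ j, 0 < (γ j).re) :
    ∃ ρ > 0, ∃ δ > 0, ∃ C > 0, ∀ t : Fin r → ℂ, (∀ k, t k ∈ openStrip ρ) → ∀ j,
      γ j * ∑ k ∈ Finset.Ici j, t k ∈ kernelDomain ∧
      ‖limitKernel (γ j * ∑ k ∈ Finset.Ici j, t k)‖ ≤ C * Real.exp (-δ * (t j).re) ∧
      ∀ c ∈ Set.Icc (1 / 2 : ℝ) 2, ‖kernelFactor c (γ j * ∑ k ∈ Finset.Ici j, t k)‖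
        ≤ |c - 1| * (C * Real.exp (-δ * (t j).re)) := by
  obtain ⟨η, hη, δ, hδ, C, hC, h⟩ := exists_uniform_kernel_bound hγ
  refine ⟨η / (r + 1), by positivity, δ, hδ, C * Real.exp (δ * η), by positivity,
    fun t ht j => ?_⟩
  obtain ⟨h1, h2, h3⟩ := h j _ (sum_mem_strip hη ht (Finset.Ici j))
  have hexp : C * Real.exp (-δ * (∑ k ∈ Finset.Ici j, t k).re)
      ≤ C * Real.exp (δ * η) * Real.exp (-δ * (t j).re) := by
    rw [mul_assoc, ← Real.exp_add]
    refine mul_le_mul_of_nonneg_left (Real.exp_le_exp.mpr ?_) hC.le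
    rw [← Finset.add_sum_erase _ _ (Finset.mem_Ici.mpr le_rfl), Complex.add_re]
    have := (sum_mem_strip hη ht ((Finset.Ici j).erase j)).2
    nlinarith
  exact ⟨h1, h2.trans hexp, fun c hc => (h3 c hc).trans
    (mul_le_mul_of_nonneg_left hexp (abs_nonneg _))⟩

lemma measurable_kernel (γ : Fin r → ℂ) (c : ℝ) : Measurable (kernel γ c) :=
  Finset.measurable_fun_prod _ fun _ _ => (measurable_kernelFactor c).comp (by fun_prop)

lemma measurable_limitGenerating (γ : Fin r → ℂ) : Measurable (limitGenerating γ) :=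
  Finset.measurable_fun_prod _ fun _ _ => measurable_limitKernel.comp (by fun_prop)

lemma exists_generating_bounds (hγ : ∀ j, 0 < (γ j).re) :
    ∃ ρ > 0, ∃ δ > 0, DecayingOnPi ρ δ (limitGenerating γ) ∧ ∃ C ≥ 0, ∀ t : Fin r → ℂ,
      (∀ k, t k ∈ openStrip ρ) → (∀ j, γ j * ∑ k ∈ Finset.Ici j, t k ∈ kernelDomain) ∧
      ∀ c ∈ Set.Icc (1 / 2 : ℝ) 2,
        ‖kernel γ c t‖ ≤ |c - 1| ^ r * (C * ∏ k, Real.exp (-δ * (t k).re)) := by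
  obtain ⟨ρ, hρ, δ, hδ, C, hC, h⟩ := exists_kernel_bounds hγ
  refine ⟨ρ, hρ, δ, hδ, ⟨measurable_limitGenerating γ, ?_, C ^ r, by positivity, fun t ht => ?_⟩,
    C ^ r, by positivity, fun t ht => ⟨fun j => (h t ht j).1, fun c hc => ?_⟩⟩
  · unfold limitGenerating
    have h1 : ∀ j, DifferentiableOn ℂ
        (fun t : Fin r → ℂ => limitKernel (γ j * ∑ k ∈ Finset.Ici j, t k))
        {t | ∀ k, t k ∈ openStrip ρ} := fun j =>
      differentiableOn_limitKernel.comp (by fun_prop) fun t ht => (h t ht j).1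
    exact fun t ht => (HasFDerivWithinAt.finsetProd fun j _ =>
      (h1 j t ht).hasFDerivWithinAt).differentiableWithinAt
  · rw [limitGenerating, norm_prod]
    calc ∏ j, ‖limitKernel (γ j * ∑ k ∈ Finset.Ici j, t k)‖
        ≤ ∏ j : Fin r, C * Real.exp (-δ * (t j).re) :=
          Finset.prod_le_prod (fun _ _ => norm_nonneg _) fun j _ => (h t ht j).2.1
      _ = _ := by simp [Finset.prod_mul_distrib]
  · rw [kernel, norm_prod]
    calc ∏ j, ‖kernelFactor c (γ j * ∑ k ∈ Finset.Ici j, t k)‖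
        ≤ ∏ j : Fin r, |c - 1| * (C * Real.exp (-δ * (t j).re)) :=
          Finset.prod_le_prod (fun _ _ => norm_nonneg _) fun j _ => (h t ht j).2.2 c hc
      _ = _ := by simp [Finset.prod_mul_distrib]

end Bounds

/-! ### The normalized integral as an entire function. -/

section Normalized

variable {r : ℕ} {ρ δ ε : ℝ} {φ : (Fin r → ℂ) → ℂ}

lemma DecayingOnPi.differentiableAt_pathIntegral (hφ : DecayingOnPi ρ δ φ) (hδ : 0 < δ)
    (hε : 0 < ε) (hερ : ε < ρ) {b : Fin r → Bool} {s₀ : Fin r → ℂ}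
    (hs₀ : ∀ i, s₀ i ∈ pathRegion (b i)) :
    DifferentiableAt ℂ (fun s : Fin r → ℂ =>
      pathIntegral φ (fun i => pathPoint ε (b i)) (fun i => pathWeight ε (b i) (s i))) s₀ := by
  choose R hR hsub g hg hgb using fun i => exists_pathWeight_bound (ε := ε) hε hδ (hs₀ i)
  obtain ⟨C, hC0, hC⟩ := hφ.norm_le
  obtain ⟨R', hR', hR'le⟩ : ∃ R' > 0, ∀ i, R' ≤ R i := by
    have h1 : ∀ᶠ x : ℝ in 𝓝[>] 0, ∀ i, x ≤ R i := by
      rw [eventually_all]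
      intro i
      refine eventually_nhdsWithin_of_eventually_nhds ?_
      filter_upwards [eventually_lt_nhds (hR i)] with x h2 using h2.le
    obtain ⟨x, hx, hx0⟩ := (h1.and self_mem_nhdsWithin).exists
    exact ⟨x, hx0, hx⟩
  have hball : ∀ s ∈ Metric.ball s₀ R', ∀ i, s i ∈ Metric.ball (s₀ i) (R i) := fun s hs i =>
    ((dist_le_pi_dist s s₀ i).trans_lt hs).trans_le (hR'le i)
  unfold pathIntegral
  refine differentiableAt_integral_of_dominated hR' (bound := fun x => C * ∏ i, g i (x i))
    (fun s _ => ?_) (fun x s hs => ?_) (fun x s hs => ?_)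
    ((Integrable.fintype_prod hg).const_mul C)
  · exact (hφ.measurable_integrand (fun i => measurable_pathPoint _)
      fun i => measurable_pathWeight _ _).aestronglyMeasurable
  · refine DifferentiableAt.differentiableWithinAt (DifferentiableAt.const_mul ?_ _)
    have h1 : ∀ i, DifferentiableAt ℂ (fun s : Fin r → ℂ => pathWeight ε (b i) (s i) (x i)) s :=
      fun i => DifferentiableAt.comp (g := fun z => pathWeight ε (b i) z (x i)) s
        (differentiableAt_pathWeight (hsub i (hball s hs i)) (x i)) (differentiableAt_apply i s)
    exact (HasFDerivAt.finsetProd fun i _ => (h1 i).hasFDerivAt).differentiableAt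
  · refine (hC (fun i => pathPoint ε (b i)) (fun i => pathWeight ε (b i) (s i))
      (fun i y => pathPoint_mem hε hερ _ _) x).trans ?_
    refine mul_le_mul_of_nonneg_left ?_ hC0
    exact Finset.prod_le_prod (fun _ _ => by positivity) fun i _ => hgb i _ (hball s hs i) _

/-- The choice of a weighted path for the argument `s`. -/
def pathChoice (s : ℂ) : Bool := decide (1 / 2 < s.re)

lemma mem_pathRegion_pathChoice (s : ℂ) : s ∈ pathRegion (pathChoice s) := by
  by_cases h : 1 / 2 < s.re
  · have : pathChoice s = true := by simp only [pathChoice, h, decide_true]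
    rw [this]
    show 0 < s.re
    linarith
  · have : pathChoice s = false := by simp only [pathChoice, h, decide_false]
    rw [this]
    show s.re < 1
    linarith

/-- The entire function of `s` that is given by the normalized Hankel integral of `φ`. -/
def normalizedIntegral (φ : (Fin r → ℂ) → ℂ) (ε : ℝ) (s : Fin r → ℂ) : ℂ :=
  pathIntegral φ (fun i => pathPoint ε (pathChoice (s i)))
    (fun i => pathWeight ε (pathChoice (s i)) (s i))

lemma DecayingOnPi.normalizedIntegral_eq (hφ : DecayingOnPi ρ δ φ) (hδ : 0 < δ) (hε : 0 < ε)
    (hερ : ε < ρ) {b : Fin r → Bool} {s : Fin r → ℂ} (hs : ∀ i, s i ∈ pathRegion (b i)) :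
    normalizedIntegral φ ε s =
      pathIntegral φ (fun i => pathPoint ε (b i)) (fun i => pathWeight ε (b i) (s i)) :=
  pathIntegral_congr hφ
    (fun i => isWeightedPath_pathWeight hε hερ hδ (mem_pathRegion_pathChoice (s i)))
    (fun i => isWeightedPath_pathWeight hε hερ hδ (hs i))
    fun i _ hf => integral_pathWeight_congr hf hδ hε hερ (mem_pathRegion_pathChoice (s i)) (hs i)

/-- Although `pathChoice` jumps at Re s = 1/2, near s₀ the choice may be frozen at the one for s₀,
since admissible choices give equal integrals; the frozen integral is holomorphic. -/
lemma DecayingOnPi.differentiable_normalizedIntegral (hφ : DecayingOnPi ρ δ φ) (hδ : 0 < δ)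
    (hε : 0 < ε) (hερ : ε < ρ) : Differentiable ℂ (normalizedIntegral φ ε) := by
  intro s₀
  have hs₀ : ∀ i, s₀ i ∈ pathRegion (pathChoice (s₀ i)) := fun i => mem_pathRegion_pathChoice _
  refine (hφ.differentiableAt_pathIntegral hδ hε hερ hs₀).congr_of_eventuallyEq ?_
  have : ∀ᶠ s in 𝓝 s₀, ∀ i, s i ∈ pathRegion (pathChoice (s₀ i)) := by
    rw [eventually_all]
    exact fun i => (continuous_apply i).continuousAt.eventually_mem
      ((isOpen_pathRegion _).mem_nhds (hs₀ i))
  filter_upwards [this] with s hs using hφ.normalizedIntegral_eq hδ hε hερ hs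

lemma DecayingOnPi.integral_hankel (hφ : DecayingOnPi ρ δ φ) (hδ : 0 < δ) (hε : 0 < ε)
    (hερ : ε < ρ) {ε' : ℝ} (hε' : 0 < ε') (hερ' : ε' < ρ) {s : Fin r → ℂ}
    (hs : ∀ k, ∀ n : ℤ, s k ≠ n) :
    pathIntegral φ (fun _ => hankelPoint ε)
      (fun i x => hankelFactor (s i) * hankelWeight ε (s i) x) = normalizedIntegral φ ε' s :=
  pathIntegral_congr hφ (fun _ => isWeightedPath_hankel hε hερ hδ _ _)
    (fun i => isWeightedPath_pathWeight hε' hερ' hδ (mem_pathRegion_pathChoice (s i)))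
    fun i _ hf => integral_hankel_eq_pathWeight hf hδ hε hερ hε' hερ'
      (mem_pathRegion_pathChoice (s i)) (hs i)

end Normalized

/-! ### Existence and uniqueness of the desingularized function. -/

section Existence

variable {r : ℕ} {γ : Fin r → ℂ}

lemma eventually_mem_Icc_nhdsNE : ∀ᶠ c : ℝ in 𝓝[≠] 1, c ∈ Set.Icc (1 / 2 : ℝ) 2 ∧ c ≠ 1 :=
  (eventually_nhdsWithin_of_eventually_nhds
    (Icc_mem_nhds (by norm_num) (by norm_num))).and self_mem_nhdsWithin

lemma scaled_kernel_eq (γ : Fin r → ℂ) (c : ℝ) (t : Fin r → ℂ) :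
    (-1) ^ r / ((c : ℂ) - 1) ^ r * kernel γ c t
      = ∏ j, -(kernelFactor c (γ j * ∑ k ∈ Finset.Ici j, t k) / ((c : ℂ) - 1)) := by
  rw [kernel, Finset.prod_neg, Finset.prod_div_distrib]
  simp
  ring

lemma tendsto_scaled_kernel {t : Fin r → ℂ}
    (ht : ∀ j, γ j * ∑ k ∈ Finset.Ici j, t k ∈ kernelDomain) :
    Tendsto (fun c : ℝ => (-1) ^ r / ((c : ℂ) - 1) ^ r * kernel γ c t) (𝓝[≠] 1)
      (𝓝 (limitGenerating γ t)) := by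
  simp_rw [scaled_kernel_eq]
  refine tendsto_finsetProd _ fun j _ => ?_
  simpa using (tendsto_kernelFactor (ht j)).neg

/-- The desingularized function exists, and it is given by every normalized Hankel integral of
the limit of the generating functions. -/
lemma exists_isDesingularization_normalizedIntegral (hγ : ∀ j, 0 < (γ j).re) :
    ∃ ρ > 0, ∃ δ > 0, ∃ ε > 0, ε < ρ ∧ DecayingOnPi ρ δ (limitGenerating γ) ∧
      IsDesingularization γ (normalizedIntegral (limitGenerating γ) ε) := by
  obtain ⟨ρ, hρ, δ, hδ, hφ, C, hC0, hC⟩ := exists_generating_bounds hγ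
  refine ⟨ρ, hρ, δ, hδ, ρ / 2, by positivity, by linarith, hφ,
    hφ.differentiable_normalizedIntegral hδ (by positivity) (by linarith), ρ, hρ,
    fun ε hε hερ s hs => ?_⟩
  have hint : ∀ i, Integrable fun x => Real.exp (-δ * (hankelPoint ε x).re) *
      ‖hankelFactor (s i) * hankelWeight ε (s i) x‖ := fun i =>
    (isWeightedPath_hankel hε hερ hδ (hankelFactor (s i)) (s i)).integrable
  have hint' : ∀ i, Integrable fun x => Real.exp (-δ * (hankelPoint ε x).re) *
      ‖hankelWeight ε (s i) x‖ := fun i => by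
    simpa using (isWeightedPath_hankel hε hερ hδ 1 (s i)).integrable
  have hpt : ∀ x : Fin r → ℝ, ∀ k, hankelPoint ε (x k) ∈ openStrip ρ := fun x k =>
    hankelPoint_mem_openStrip hε hερ _
  have hmeas : ∀ c : ℝ, Measurable fun x : Fin r → ℝ => kernel γ c fun k => hankelPoint ε (x k) :=
    fun c => (measurable_kernel γ c).comp <| measurable_pi_iff.mpr fun i =>
      (measurable_hankelPoint ε).comp (measurable_pi_apply i)
  constructor
  · filter_upwards [eventually_mem_Icc_nhdsNE] with c hc
    refine (((Integrable.fintype_prod hint').const_mul (|c - 1| ^ r * C))).mono' ?_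
      (Eventually.of_forall fun x => ?_)
    · exact ((hmeas c).mul (Finset.measurable_fun_prod _ fun i _ =>
        (measurable_hankelWeight ε (s i)).comp (measurable_pi_apply i))).aestronglyMeasurable
    · show ‖kernel γ c (fun k => hankelPoint ε (x k)) * ∏ k, hankelWeight ε (s k) (x k)‖ ≤ _
      rw [norm_mul, norm_prod, Finset.prod_mul_distrib, ← mul_assoc, mul_assoc (|c - 1| ^ r)]
      exact mul_le_mul_of_nonneg_right ((hC _ (hpt x)).2 c hc.1)
        (Finset.prod_nonneg fun _ _ => norm_nonneg _)
  · rw [← hφ.integral_hankel hδ hε hερ (ε' := ρ / 2) (by positivity) (by linarith) hs]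
    have hpre : ∀ c : ℝ, preDesingularization γ ε c s = ∫ x : Fin r → ℝ,
        ((-1) ^ r / ((c : ℂ) - 1) ^ r * kernel γ c fun k => hankelPoint ε (x k)) *
          ∏ k, (hankelFactor (s k) * hankelWeight ε (s k) (x k)) := fun c => by
      rw [preDesingularization, Finset.prod_congr rfl fun k _ => one_div_eq_hankelFactor (hs k),
        ← integral_const_mul]
      refine integral_congr_ae (Eventually.of_forall fun x => ?_)
      show _ * (kernel γ c (fun k => hankelPoint ε (x k)) * ∏ k, hankelWeight ε (s k) (x k)) = _
      beta_reduce
      rw [Finset.prod_mul_distrib]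
      ring
    simp_rw [hpre]
    -- The factor |c - 1|^r in the bound of the kernel cancels the division by (c - 1)^r, so the
    -- majorant is independent of c.
    refine tendsto_integral_filter_of_dominated_convergence
      (fun x => C * ∏ k, (Real.exp (-δ * (hankelPoint ε (x k)).re) *
        ‖hankelFactor (s k) * hankelWeight ε (s k) (x k)‖)) ?_ ?_
      ((Integrable.fintype_prod hint).const_mul C) ?_
    · refine Eventually.of_forall fun c => Measurable.aestronglyMeasurable ?_
      exact ((hmeas c).const_mul _).mul (Finset.measurable_fun_prod _ fun i _ =>
        ((measurable_hankelWeight ε (s i)).comp (measurable_pi_apply i)).const_mul _)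
    · filter_upwards [eventually_mem_Icc_nhdsNE] with c hc
      refine Eventually.of_forall fun x => ?_
      have hc1 : 0 < |c - 1| := abs_pos.mpr (sub_ne_zero.mpr hc.2)
      have h1 := (hC _ (hpt x)).2 c hc.1
      rw [norm_mul, norm_prod, Finset.prod_mul_distrib, ← mul_assoc]
      refine mul_le_mul_of_nonneg_right ?_ (Finset.prod_nonneg fun _ _ => norm_nonneg _)
      have h2 : ‖(-1 : ℂ) ^ r / ((c : ℂ) - 1) ^ r‖ = (|c - 1| ^ r)⁻¹ := by
        rw [norm_div, norm_pow, norm_pow, norm_neg, norm_one, one_pow, one_div,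
          ← Complex.ofReal_one, ← Complex.ofReal_sub, Complex.norm_real, Real.norm_eq_abs]
      rw [norm_mul, h2, inv_mul_le_iff₀ (by positivity)]
      exact h1
    · refine Eventually.of_forall fun x => ?_
      exact (tendsto_scaled_kernel (hC _ (hpt x)).1).mul_const _

lemma dense_nonInteger (r : ℕ) : Dense {s : Fin r → ℂ | ∀ k, ∀ n : ℤ, s k ≠ n} := by
  have h1 : Dense {z : ℂ | ∀ n : ℤ, z ≠ n} := by
    have : {z : ℂ | ∀ n : ℤ, z ≠ n} = (Set.range ((↑) : ℤ → ℂ))ᶜ := by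
      ext z
      simp [eq_comm]
    rw [this]
    exact (Set.countable_range _).dense_compl ℂ
  have := dense_pi (Set.univ : Set (Fin r)) (s := fun _ => {z : ℂ | ∀ n : ℤ, z ≠ n})
    fun _ _ => h1
  convert this using 1
  ext s
  simp

/-- The limits determine the function at points without integer coordinates, which are dense; a
radius below both thresholds is admissible for both functions. -/
lemma IsDesingularization.unique {D D' : (Fin r → ℂ) → ℂ} (h : IsDesingularization γ D)
    (h' : IsDesingularization γ D') : D = D' := by
  refine Continuous.ext_on (dense_nonInteger r) h.entire.continuous h'.entire.continuous
    fun s hs => ?_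
  obtain ⟨e, he, h1⟩ := h.limit
  obtain ⟨e', he', h2⟩ := h'.limit
  have hpos : 0 < min e e' := lt_min he he'
  have hl : min e e' / 2 < min e e' := by linarith
  exact tendsto_nhds_unique
    (h1 _ (half_pos hpos) (hl.trans_le (min_le_left _ _)) s hs).2
    (h2 _ (half_pos hpos) (hl.trans_le (min_le_right _ _)) s hs).2

end Existence

/-! ### The Gamma integral -/

lemma integrableOn_rpow_mul_exp_neg {σ N : ℝ} (hσ : 0 < σ) (hN : 0 < N) :
    IntegrableOn (fun t : ℝ => t ^ (σ - 1) * Real.exp (-(N * t))) (Set.Ioi 0) := by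
  have := integrableOn_rpow_mul_exp_neg_mul_rpow (p := 1) (s := σ - 1) (b := N)
    (by linarith) one_pos hN
  simpa only [Real.rpow_one, neg_mul] using this

lemma measurable_cpow_mul_exp (a N : ℂ) :
    Measurable fun t : ℝ => (t : ℂ) ^ (a - 1) * Complex.exp (-(N * t)) := by
  fun_prop

lemma norm_cpow_mul_exp (a N : ℂ) {t : ℝ} (ht : 0 < t) :
    ‖(t : ℂ) ^ (a - 1) * Complex.exp (-(N * t))‖
      = t ^ (a.re - 1) * Real.exp (-(N.re * t)) := by
  rw [norm_mul, Complex.norm_cpow_eq_rpow_re_of_pos ht, Complex.norm_exp]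
  simp

lemma integrableOn_cpow_mul_exp_neg {a N : ℂ} (ha : 0 < a.re) (hN : 0 < N.re) :
    IntegrableOn (fun t : ℝ => (t : ℂ) ^ (a - 1) * Complex.exp (-(N * t))) (Set.Ioi 0) := by
  refine (integrableOn_rpow_mul_exp_neg ha hN).mono'
    (measurable_cpow_mul_exp a N).aestronglyMeasurable ?_
  filter_upwards [self_mem_ae_restrict measurableSet_Ioi] with t ht
  exact (norm_cpow_mul_exp a N ht).le

/-- The Gamma integral `∫ t ^ (a - 1) exp (-N t) dt = N ^ (-a) Γ(a)` for complex `N` in the right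
half-plane. -/
lemma integral_cpow_mul_exp_neg {a N : ℂ} (ha : 0 < a.re) (hN : 0 < N.re) :
    ∫ t in Set.Ioi (0 : ℝ), (t : ℂ) ^ (a - 1) * Complex.exp (-(N * t))
      = N ^ (-a) * Complex.Gamma a := by
  have hopen : IsOpen {N : ℂ | 0 < N.re} := isOpen_lt continuous_const Complex.continuous_re
  have h1 : DifferentiableOn ℂ (fun N : ℂ =>
      ∫ t in Set.Ioi (0 : ℝ), (t : ℂ) ^ (a - 1) * Complex.exp (-(N * t))) {N | 0 < N.re} := by
    intro N₀ hN₀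
    have hN₀' : 0 < N₀.re := hN₀
    refine DifferentiableAt.differentiableWithinAt ?_
    have hre : ∀ N ∈ Metric.ball N₀ (N₀.re / 2), N₀.re / 2 < N.re := fun N hN => by
      rw [Metric.mem_ball, dist_eq_norm] at hN
      have := (Complex.abs_re_le_norm (N - N₀)).trans_lt hN
      rw [Complex.sub_re, abs_lt] at this
      linarith
    -- Writing |t| for t makes the domination hold for every real t, while the integral only sees t
    -- > 0.
    refine differentiableAt_integral_of_dominated (half_pos hN₀')
      (μ := volume.restrict (Set.Ioi 0))
      (bound := fun t => ‖(t : ℂ) ^ (a - 1)‖ * Real.exp (-(N₀.re / 2 * |t|)))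
      (f := fun (N : ℂ) (t : ℝ) => (t : ℂ) ^ (a - 1) * Complex.exp (-(N * (|t| : ℝ)))) ?_ ?_ ?_ ?_
      |>.congr_of_eventuallyEq ?_
    · exact fun N _ => Measurable.aestronglyMeasurable (by fun_prop)
    · exact fun t => by fun_prop
    · intro t N hN
      rw [norm_mul, Complex.norm_exp]
      refine mul_le_mul_of_nonneg_left (Real.exp_le_exp.mpr ?_) (norm_nonneg _)
      have := mul_le_mul_of_nonneg_right (hre N hN).le (abs_nonneg t)
      simpa using this
    · refine (integrableOn_rpow_mul_exp_neg ha (half_pos hN₀')).congr_fun (fun t ht => ?_)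
        measurableSet_Ioi
      have ht' : 0 < t := ht
      simp only [Complex.norm_cpow_eq_rpow_re_of_pos ht', abs_of_pos ht', Complex.sub_re,
        Complex.one_re]
    · refine Eventually.of_forall fun N => setIntegral_congr_fun measurableSet_Ioi fun t ht => ?_
      have ht' : 0 < t := ht
      simp only [abs_of_pos ht']
  have h2 : DifferentiableOn ℂ (fun N : ℂ => N ^ (-a) * Complex.Gamma a) {N | 0 < N.re} := by
    intro N hN
    have hs : N ∈ Complex.slitPlane := Or.inl hN
    exact ((differentiableAt_id.cpow_const hs).mul_const _).differentiableWithinAt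
  have hconv : IsPreconnected {N : ℂ | 0 < N.re} :=
    (convex_halfSpace_re_gt 0).isPreconnected
  -- Both sides are holomorphic in N, and the formula for real N > 0 gives agreement on a set
  -- accumulating at 1.
  refine (h1.analyticOnNhd hopen).eqOn_of_preconnected_of_frequently_eq (h2.analyticOnNhd hopen)
    hconv (z₀ := 1) (by simp) ?_ hN
  have h3 : ∀ x : ℝ, 0 < x →
      ∫ t in Set.Ioi (0 : ℝ), (t : ℂ) ^ (a - 1) * Complex.exp (-((x : ℂ) * t))
        = (x : ℂ) ^ (-a) * Complex.Gamma a := fun x hx => by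
    rw [Complex.integral_cpow_mul_exp_neg_mul_Ioi ha hx, one_div, Complex.inv_cpow, Complex.cpow_neg]
    rw [Complex.arg_ofReal_of_nonneg hx.le]
    exact Real.pi_pos.ne
  have h4 : Tendsto (fun x : ℝ => (x : ℂ)) (𝓝[≠] 1) (𝓝[≠] 1) := by
    refine tendsto_nhdsWithin_iff.mpr ⟨?_, ?_⟩
    · exact (Complex.continuous_ofReal.tendsto' (1 : ℝ) 1 (by simp)).mono_left nhdsWithin_le_nhds
    · filter_upwards [self_mem_nhdsWithin] with x hx
      simpa using hx
  refine h4.frequently (Eventually.frequently ?_)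
  filter_upwards [eventually_nhdsWithin_of_eventually_nhds (eventually_gt_nhds one_pos)] with x hx
    using h3 x hx

/-! ### The expansion of the limit kernel -/

/-- This is the derivative of y / (e^y - 1) = ∑_{n ≥ 1} y e^{-ny}, verified through the closed forms
of ∑ z^n and ∑ n z^n at z = e^{-y}. -/
lemma hasSum_limitKernel {y : ℂ} (hy : 0 < y.re) :
    HasSum (fun n : ℕ => (1 - ((n : ℂ) + 1) * y) * Complex.exp (-(((n : ℂ) + 1) * y)))
      (limitKernel y) ∧
    Summable fun n : ℕ => ‖(1 - ((n : ℂ) + 1) * y) * Complex.exp (-(((n : ℂ) + 1) * y))‖ := by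
  have hy0 : y ≠ 0 := by
    rintro rfl
    simp at hy
  set z := Complex.exp (-y) with hz
  have hz1 : ‖z‖ < 1 := by
    rw [hz, Complex.norm_exp]
    simpa using hy
  have hz0 : z ≠ 0 := Complex.exp_ne_zero _
  have hze : Complex.exp y = z⁻¹ := by rw [hz, Complex.exp_neg, inv_inv]
  have hz1' : 1 - z ≠ 0 := by
    intro h
    rw [sub_eq_zero] at h
    rw [← h] at hz1
    simp at hz1
  have hexp : Complex.exp y - 1 ≠ 0 := by
    rw [hze]
    intro h
    apply hz1'
    rw [sub_eq_zero, inv_eq_one] at h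
    rw [h, sub_self]
  have h1 := hasSum_geometric_of_norm_lt_one hz1
  have h2 := hasSum_coe_mul_geometric_of_norm_lt_one hz1
  have hterm : ∀ n : ℕ, (1 - ((n : ℂ) + 1) * y) * Complex.exp (-(((n : ℂ) + 1) * y))
      = z * ((1 - y) * z ^ n - y * (n * z ^ n)) := fun n => by
    have : Complex.exp (-(((n : ℂ) + 1) * y)) = z ^ n * z := by
      rw [hz, ← Complex.exp_nat_mul, ← Complex.exp_add]
      congr 1
      ring
    rw [this]
    ring
  simp_rw [hterm]
  constructor
  · convert! ((h1.mul_left (1 - y)).sub (h2.mul_left y)).mul_left z using 1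
    rw [limitKernel_eq hy0 hexp, hze]
    have h3 : z⁻¹ - 1 = (1 - z) / z := by field_simp
    rw [h3]
    field_simp
    ring
  · have h3 := (summable_geometric_of_norm_lt_one hz1).norm
    have h4 := summable_norm_pow_mul_geometric_of_norm_lt_one 1 hz1
    refine Summable.of_nonneg_of_le (fun _ => norm_nonneg _) (fun n => ?_)
      (((summable_norm_geometric_of_norm_lt_one hz1).mul_left ‖1 - y‖).add
        (h4.mul_left ‖y‖) |>.mul_left ‖z‖)
    rw [norm_mul]
    refine mul_le_mul_of_nonneg_left ((norm_sub_le _ _).trans_eq ?_) (norm_nonneg _)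
    simp only [norm_mul, pow_one]

lemma hasSum_prod_pi {r : ℕ} : ∀ {f : Fin r → ℕ → ℂ} {a : Fin r → ℂ}
    (_ : ∀ j, HasSum (f j) (a j)) (_ : ∀ j, Summable fun n => ‖f j n‖),
    HasSum (fun m : Fin r → ℕ => ∏ j, f j (m j)) (∏ j, a j) ∧
      Summable fun m : Fin r → ℕ => ‖∏ j, f j (m j)‖ := by
  induction r with
  | zero =>
    intro f a _ _
    refine ⟨?_, Summable.of_finite⟩
    simp
  | succ r ih =>
    intro f a hf hf'
    obtain ⟨h1, h2⟩ := ih (fun j => hf j.succ) fun j => hf' j.succ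
    have h3 := (hf' 0).mul_norm h2
    have h4 := (hf 0).mul h1 (h3.of_norm)
    rw [← (Fin.consEquiv fun _ : Fin (r + 1) => ℕ).hasSum_iff,
      ← (Fin.consEquiv fun _ : Fin (r + 1) => ℕ).summable_iff]
    refine ⟨?_, ?_⟩
    · rw [Fin.prod_univ_succ]
      convert! h4 using 1
      funext p
      simp [Fin.prod_univ_succ, Fin.consEquiv]
    · refine h3.congr fun p => ?_
      simp [Fin.prod_univ_succ, Fin.consEquiv]

/-! ### Evaluation of the generating polynomial -/

section Evaluation

variable {r : ℕ}

/-- The monomial `∏ (N_j t_j) ^ l_j N_j ^ (-m_j)`. -/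
def monomialValue (N : Fin r → ℂ) (t : Fin r → ℂ) (p : (Fin r → ℕ) × (Fin r → ℤ)) : ℂ :=
  ∏ j, (N j * t j) ^ p.1 j * N j ^ (-p.2 j)

/-- Monomials as a homomorphism from the monoid of exponents. -/
def monomialHom (N : Fin r → ℂ) (hN : ∀ j, N j ≠ 0) (t : Fin r → ℂ) :
    Multiplicative ((Fin r → ℕ) × (Fin r → ℤ)) →* ℂ where
  toFun p := monomialValue N t p.toAdd
  map_one' := by simp [monomialValue]
  map_mul' p q := by
    simp only [monomialValue, toAdd_mul, ← Finset.prod_mul_distrib]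
    refine Finset.prod_congr rfl fun j _ => ?_
    simp only [Prod.fst_add, Prod.snd_add, Pi.add_apply, pow_add, neg_add, zpow_add₀ (hN j)]
    ring

/-- The substitution `u_k v_k ↦ t_k`, `v_k⁻¹ ↦ N_k`. -/
def evaluation (N : Fin r → ℂ) (hN : ∀ j, N j ≠ 0) (t : Fin r → ℂ) : LaurentRing r →ₐ[ℤ] ℂ :=
  AddMonoidAlgebra.lift ℤ ℂ _ (monomialHom N hN t)

variable {N : Fin r → ℂ} (hN : ∀ j, N j ≠ 0) (t : Fin r → ℂ)

lemma evaluation_generatingPolynomial_eq_sum :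
    evaluation N hN t (generatingPolynomial r)
      = ∑ p ∈ exponents r, (coefficient r p.1 p.2 : ℂ) * monomialValue N t p := by
  rw [evaluation, AddMonoidAlgebra.lift_apply]
  simp only [Finsupp.sum, zsmul_eq_mul]
  rfl

lemma evaluation_varU_mul_varV (k : Fin r) : evaluation N hN t (varU k * varV k) = t k := by
  rw [varU, varV, AddMonoidAlgebra.single_mul_single, evaluation, AddMonoidAlgebra.lift_single]
  show (1 * 1 : ℤ) • monomialValue N t _ = _
  rw [monomialValue, Finset.prod_eq_single k]
  · have := hN k
    simp
    field_simp
  · intro j _ hj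
    simp [hj]
  · simp

lemma evaluation_varVInv (k : Fin r) : evaluation N hN t (varVInv k) = N k := by
  rw [varVInv, evaluation, AddMonoidAlgebra.lift_single]
  show (1 : ℤ) • monomialValue N t _ = _
  rw [monomialValue, Finset.prod_eq_single k]
  · simp
  · intro j _ hj
    simp [hj]
  · simp

/-- The difference of consecutive partial sums; the convention v_0⁻¹ = 0 corresponds to the empty
partial sum. -/
lemma evaluation_varVInv_sub_varVInvPrev (γ : Fin r → ℂ) (m : Fin r → ℕ)
    (hN : ∀ j, partialSum γ m j ≠ 0) (j : Fin r) :
    evaluation (partialSum γ m) hN t (varVInv j - varVInvPrev j) = ((m j : ℂ) + 1) * γ j := by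
  rw [map_sub, evaluation_varVInv, varVInvPrev]
  split_ifs with hj
  · have : Finset.Iic j = {j} := by
      ext k
      simp only [Finset.mem_Iic, Finset.mem_singleton, Fin.le_def, Fin.ext_iff]
      omega
    simp [partialSum, this]
  · rw [evaluation_varVInv, partialSum, partialSum, sub_eq_iff_eq_add]
    have : Finset.Iic j
        = insert j (Finset.Iic (⟨(j : ℕ) - 1, lt_of_le_of_lt (Nat.sub_le _ _) j.isLt⟩ : Fin r)) := by
      ext k
      simp only [Finset.mem_Iic, Finset.mem_insert, Fin.le_def, Fin.ext_iff]
      omega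
    rw [this, Finset.sum_insert]
    simp only [Finset.mem_Iic, Fin.le_def]
    omega

/-- Here the coefficients a_{l,m} enter: the polynomial factors of the expanded kernel are the
factors of the generating polynomial under the substitution. -/
lemma prod_one_sub_eq_sum (γ : Fin r → ℂ) (m : Fin r → ℕ) (hN : ∀ j, partialSum γ m j ≠ 0) :
    ∏ j, (1 - ((m j : ℂ) + 1) * (γ j * ∑ k ∈ Finset.Ici j, t k))
      = ∑ p ∈ exponents r, (coefficient r p.1 p.2 : ℂ) * monomialValue (partialSum γ m) t p := by
  rw [← evaluation_generatingPolynomial_eq_sum hN, generatingPolynomial, map_prod]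
  refine Finset.prod_congr rfl fun j _ => ?_
  rw [map_sub, map_one, map_mul, evaluation_varVInv_sub_varVInvPrev, map_sum]
  simp_rw [evaluation_varU_mul_varV]
  ring

/-- Exchange of the order of summation over j ≤ k; it separates the variables t_k in the
exponential. -/
lemma sum_mul_sum_Ici_eq (γ : Fin r → ℂ) (m : Fin r → ℕ) :
    ∑ j, ((m j : ℂ) + 1) * (γ j * ∑ k ∈ Finset.Ici j, t k) = ∑ k, partialSum γ m k * t k := by
  have h1 : ∀ j : Fin r, Finset.Ici j = Finset.univ.filter (j ≤ ·) := fun j => by ext; simp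
  have h2 : ∀ j : Fin r, Finset.Iic j = Finset.univ.filter (· ≤ j) := fun j => by ext; simp
  simp_rw [partialSum, h1, h2, Finset.sum_filter, Finset.mul_sum, Finset.sum_mul]
  rw [Finset.sum_comm]
  refine Finset.sum_congr rfl fun j _ => Finset.sum_congr rfl fun k _ => ?_
  split_ifs <;> ring

end Evaluation

/-! ### The series expansion of the desingularized function -/

/-- The integrand of one variable in the expansion of the normalized integral: the monomial
`(N t) ^ l N ^ (-m)` times `exp (-N t)` times the weight. -/
def expansionFactor (ε : ℝ) (N : ℂ) (l : ℕ) (m : ℤ) (s : ℂ) (x : ℝ) : ℂ :=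
  (N * pathPoint ε true x) ^ l * N ^ (-m) *
    (Complex.exp (-(N * pathPoint ε true x)) * pathWeight ε true s x)

/-! ### Gamma integrals of the separated factors. -/

section Factor

variable {ε : ℝ} {N s : ℂ} {l : ℕ} {m : ℤ}

lemma expansionFactor_eq (hN : N ≠ 0) : expansionFactor ε N l m s = Set.indicator (Set.Ioi 0)
    fun t : ℝ => (Complex.Gamma s)⁻¹ * N ^ ((l : ℂ) - m) *
      ((t : ℂ) ^ ((s + l) - 1) * Complex.exp (-(N * t))) := by
  funext x
  by_cases hx : 0 < x
  · have hx0 : (x : ℂ) ≠ 0 := Complex.ofReal_ne_zero.mpr hx.ne'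
    simp only [expansionFactor, pathPoint, pathWeight, if_pos hx,
      Set.indicator_of_mem (Set.mem_Ioi.mpr hx), max_eq_left hx.le]
    have h1 : (x : ℂ) ^ ((s + l) - 1) = (x : ℂ) ^ l * (x : ℂ) ^ (s - 1) := by
      rw [← Complex.cpow_natCast, ← Complex.cpow_add _ _ hx0]
      congr 1
      ring
    have h2 : N ^ ((l : ℂ) - m) = N ^ l * N ^ (-m) := by
      rw [← Complex.cpow_natCast, ← Complex.cpow_intCast, ← Complex.cpow_add _ _ hN]
      congr 1
      push_cast
      ring
    rw [h1, h2]
    ring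
  · simp only [expansionFactor, pathWeight, if_neg hx,
      Set.indicator_of_notMem (fun h => hx (Set.mem_Ioi.mp h)), mul_zero]

lemma integrable_expansionFactor (hN : 0 < N.re) (hs : 0 < s.re) :
    Integrable (expansionFactor ε N l m s) := by
  have hN0 : N ≠ 0 := by
    rintro rfl
    simp at hN
  have hsl : 0 < (s + l).re := by
    simp only [Complex.add_re, Complex.natCast_re]
    positivity
  rw [expansionFactor_eq hN0]
  exact IntegrableOn.integrable_indicator ((integrableOn_cpow_mul_exp_neg hsl hN).const_mul _)
    measurableSet_Ioi

/-- The Gamma integral at s + l gives Γ(s + l) / Γ(s) = (s)_l, and the powers of N combine with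
exponent (l - m) - (s + l) = -(s + m). -/
lemma integral_expansionFactor (hN : 0 < N.re) (hs : 0 < s.re) :
    ∫ x, expansionFactor ε N l m s x = (ascPochhammer ℂ l).eval s * N ^ (-(s + m)) := by
  have hN0 : N ≠ 0 := by
    rintro rfl
    simp at hN
  have hsl : 0 < (s + l).re := by
    simp only [Complex.add_re, Complex.natCast_re]
    positivity
  have hsk : ∀ k : ℕ, s ≠ -k := by
    rintro k rfl
    simp only [Complex.neg_re, Complex.natCast_re] at hs
    have : (0 : ℝ) ≤ k := Nat.cast_nonneg k
    linarith
  rw [expansionFactor_eq hN0, integral_indicator measurableSet_Ioi, integral_const_mul,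
    integral_cpow_mul_exp_neg hsl hN, ← Complex.Gamma_add_nat_div_Gamma_eq s hsk]
  have h1 : N ^ (-(s + m)) = N ^ ((l : ℂ) - m) * N ^ (-(s + l)) := by
    rw [← Complex.cpow_add _ _ hN0]
    congr 1
    ring
  rw [h1]
  ring

lemma integral_norm_expansionFactor (hN : 0 < N.re) (hs : 0 < s.re) :
    ∫ x, ‖expansionFactor ε N l m s x‖ = ‖(Complex.Gamma s)⁻¹‖ * ‖N ^ ((l : ℂ) - m)‖ *
      ((1 / N.re) ^ (s.re + l) * Real.Gamma (s.re + l)) := by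
  have hN0 : N ≠ 0 := by
    rintro rfl
    simp at hN
  rw [expansionFactor_eq hN0]
  simp_rw [norm_indicator_eq_indicator_norm]
  rw [integral_indicator measurableSet_Ioi,
    ← Real.integral_rpow_mul_exp_neg_mul_Ioi (by positivity) hN, ← integral_const_mul]
  refine setIntegral_congr_fun measurableSet_Ioi fun t ht => ?_
  rw [norm_mul, norm_mul, norm_cpow_mul_exp _ _ ht]
  simp

/-- The partial sums have real part and modulus comparable with the partial counts, so passing to
absolute values inside the integral costs only a constant: the decay exponent is still Re s + m. -/
lemma exists_integral_norm_expansionFactor_bound {r : ℕ} {γ : Fin r → ℂ} (hγ : ∀ j, 0 < (γ j).re)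
    (ε : ℝ) (l : ℕ) (m : ℤ) (hs : 0 < s.re) : ∃ M ≥ 0, ∀ (n : Fin r → ℕ) j,
      ∫ x, ‖expansionFactor ε (partialSum γ n j) l m s x‖
        ≤ M * partialCount n j ^ (-(s.re + m)) := by
  obtain ⟨a, ha, b, hb, h⟩ := exists_comparison hγ
  obtain ⟨M, hM, hMb⟩ := exists_cpow_bound (ι := (Fin r → ℕ) × Fin r)
    (S := fun i => partialCount i.1 i.2) (z := fun i => partialSum γ i.1 i.2)
    (fun i => partialCount_pos _ _) ha (fun i => h i.1 i.2) ‖(m : ℂ) - l‖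
  have hΓ : 0 < Real.Gamma (s.re + l) := Real.Gamma_pos_of_pos (by positivity)
  refine ⟨‖(Complex.Gamma s)⁻¹‖ * M * (a⁻¹ ^ (s.re + l) * Real.Gamma (s.re + l)),
    by positivity, fun n j => ?_⟩
  have hS := partialCount_pos n j
  have h1 := hMb (n, j) ((m : ℂ) - l) le_rfl
  rw [neg_sub] at h1
  have h2 : (1 / (partialSum γ n j).re) ^ (s.re + l)
      ≤ a⁻¹ ^ (s.re + l) * partialCount n j ^ (-(s.re + l)) := by
    rw [Real.rpow_neg hS.le, ← Real.inv_rpow hS.le, ← Real.mul_rpow (by positivity) (by positivity),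
      ← mul_inv, one_div]
    refine Real.rpow_le_rpow (inv_nonneg.mpr (partialSum_re_pos hγ n j).le) ?_ (by positivity)
    exact inv_anti₀ (by positivity) (h n j).1
  rw [integral_norm_expansionFactor (partialSum_re_pos hγ n j) hs]
  have h3 : partialCount n j ^ (-(s.re + m))
      = partialCount n j ^ (-((m : ℂ) - l).re) * partialCount n j ^ (-(s.re + l)) := by
    rw [← Real.rpow_add hS]
    congr 1
    simp only [Complex.sub_re, Complex.intCast_re, Complex.natCast_re]
    ring
  have hre := partialSum_re_pos hγ n j
  calc ‖(Complex.Gamma s)⁻¹‖ * ‖partialSum γ n j ^ ((l : ℂ) - m)‖ *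
        ((1 / (partialSum γ n j).re) ^ (s.re + l) * Real.Gamma (s.re + l))
      ≤ ‖(Complex.Gamma s)⁻¹‖ * (M * partialCount n j ^ (-((m : ℂ) - l).re)) *
        (a⁻¹ ^ (s.re + l) * partialCount n j ^ (-(s.re + l)) * Real.Gamma (s.re + l)) := by
        gcongr
    _ = _ := by
        rw [h3]
        ring

end Factor

/-! ### Interchange of summation and integration. -/

section Expansion

variable {r : ℕ} {γ : Fin r → ℂ}

lemma summable_prod_partialCount {σ : Fin r → ℝ}
    (hσ : (fun j => (σ j : ℂ)) ∈ convergenceRegion r) :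
    Summable fun n : Fin r → ℕ => ∏ j, partialCount n j ^ (-σ j) := by
  have h : TermBound (r := r) 0 fun s n => ((∏ j, partialCount n j ^ (-(s j).re) : ℝ) : ℂ) := by
    refine fun R => ⟨1, zero_le_one, fun s _ n => ?_⟩
    rw [Complex.norm_real, Real.norm_of_nonneg
      (Finset.prod_nonneg fun j _ => Real.rpow_nonneg (partialCount_pos n j).le _)]
    simp
  have := (h.summable (n := 0) (fun j => by simp) (shiftedRegion_zero r ▸ hσ)).norm
  refine this.congr fun n => ?_
  rw [Complex.norm_real, Real.norm_of_nonneg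
    (Finset.prod_nonneg fun j _ => Real.rpow_nonneg (partialCount_pos n j).le _)]
  simp

lemma summable_prod_integral_norm_expansionFactor (hγ : ∀ j, 0 < (γ j).re) (ε : ℝ)
    {s : Fin r → ℂ} (hs : ∀ j, 0 < (s j).re) {p : (Fin r → ℕ) × (Fin r → ℤ)}
    (hp : (fun j => s j + (p.2 j : ℂ)) ∈ convergenceRegion r) :
    Summable fun n : Fin r → ℕ =>
      ∏ j, ∫ x, ‖expansionFactor ε (partialSum γ n j) (p.1 j) (p.2 j) (s j) x‖ := by
  choose M hM hMb using fun j =>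
    exists_integral_norm_expansionFactor_bound hγ ε (p.1 j) (p.2 j) (hs j)
  have h1 : (fun j => (((s j).re + p.2 j : ℝ) : ℂ)) ∈ convergenceRegion r := by
    intro j
    have := hp j
    simp only [Complex.re_sum, Complex.add_re, Complex.intCast_re, Complex.ofReal_re] at this ⊢
    exact this
  refine Summable.of_nonneg_of_le
    (fun n => Finset.prod_nonneg fun j _ => integral_nonneg fun x => norm_nonneg _) (fun n => ?_)
    ((summable_prod_partialCount h1).mul_left (∏ j, M j))
  rw [← Finset.prod_mul_distrib]
  exact Finset.prod_le_prod (fun j _ => integral_nonneg fun x => norm_nonneg _)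
    fun j _ => hMb j n j

/-- The terms of the expansion of the integrand of the normalized integral. -/
def expansionTerm (γ : Fin r → ℂ) (ε : ℝ) (s : Fin r → ℂ) (n : Fin r → ℕ) (x : Fin r → ℝ) : ℂ :=
  ∑ p ∈ exponents r, (coefficient r p.1 p.2 : ℂ) *
    ∏ j, expansionFactor ε (partialSum γ n j) (p.1 j) (p.2 j) (s j) (x j)

lemma expansionTerm_eq (hγ : ∀ j, 0 < (γ j).re) (ε : ℝ) (s : Fin r → ℂ) (n : Fin r → ℕ)
    (x : Fin r → ℝ) : expansionTerm γ ε s n x =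
      (∏ j, (1 - ((n j : ℂ) + 1) * (γ j * ∑ k ∈ Finset.Ici j, pathPoint ε true (x k))) *
        Complex.exp (-(((n j : ℂ) + 1) * (γ j * ∑ k ∈ Finset.Ici j, pathPoint ε true (x k))))) *
      ∏ j, pathWeight ε true (s j) (x j) := by
  have h1 : ∏ j, Complex.exp (-(((n j : ℂ) + 1) *
      (γ j * ∑ k ∈ Finset.Ici j, pathPoint ε true (x k))))
      = ∏ j, Complex.exp (-(partialSum γ n j * pathPoint ε true (x j))) := by
    rw [← Complex.exp_sum, ← Complex.exp_sum, Finset.sum_neg_distrib, Finset.sum_neg_distrib,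
      sum_mul_sum_Ici_eq]
  rw [Finset.prod_mul_distrib, h1,
    prod_one_sub_eq_sum (fun k => pathPoint ε true (x k)) γ n (partialSum_ne_zero hγ n),
    expansionTerm, mul_assoc, Finset.sum_mul]
  refine Finset.sum_congr rfl fun p _ => ?_
  simp only [expansionFactor, monomialValue, Finset.prod_mul_distrib]
  ring

lemma tsum_expansionTerm (hγ : ∀ j, 0 < (γ j).re) (ε : ℝ) (s : Fin r → ℂ) (x : Fin r → ℝ) :
    ∑' n, expansionTerm γ ε s n x = limitGenerating γ (fun k => pathPoint ε true (x k)) *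
      ∏ j, pathWeight ε true (s j) (x j) := by
  simp_rw [expansionTerm_eq hγ]
  rw [tsum_mul_right]
  -- The expansion needs Re y_j > 0; if some x j is not positive, the weight vanishes instead.
  by_cases hx : ∀ j, 0 < x j
  · congr 1
    have hy : ∀ j, 0 < (γ j * ∑ k ∈ Finset.Ici j, pathPoint ε true (x k)).re := fun j => by
      simp only [pathPoint, ← Complex.ofReal_sum, Complex.re_mul_ofReal]
      refine mul_pos (hγ j) (Finset.sum_pos (fun k _ => ?_) ⟨j, Finset.mem_Ici.mpr le_rfl⟩)
      exact lt_max_of_lt_left (hx k)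
    exact (hasSum_prod_pi (fun j => (hasSum_limitKernel (hy j)).1)
      fun j => (hasSum_limitKernel (hy j)).2).1.tsum_eq
  · push Not at hx
    obtain ⟨j, hj⟩ := hx
    have : ∏ j, pathWeight ε true (s j) (x j) = 0 :=
      Finset.prod_eq_zero (Finset.mem_univ j) (by simp [pathWeight, hj.not_gt])
    rw [this, mul_zero, mul_zero]

lemma integrable_prod_expansionFactor (hγ : ∀ j, 0 < (γ j).re) (ε : ℝ) {s : Fin r → ℂ}
    (hs : ∀ j, 0 < (s j).re) (n : Fin r → ℕ) (p : (Fin r → ℕ) × (Fin r → ℤ)) :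
    Integrable fun x : Fin r → ℝ =>
      ∏ j, expansionFactor ε (partialSum γ n j) (p.1 j) (p.2 j) (s j) (x j) :=
  Integrable.fintype_prod fun j => integrable_expansionFactor (partialSum_re_pos hγ n j) (hs j)

lemma integral_expansionTerm (hγ : ∀ j, 0 < (γ j).re) (ε : ℝ) {s : Fin r → ℂ}
    (hs : ∀ j, 0 < (s j).re) (n : Fin r → ℕ) : ∫ x, expansionTerm γ ε s n x =
      ∑ p ∈ exponents r, (coefficient r p.1 p.2 : ℂ) *
        (∏ j : Fin r, (ascPochhammer ℂ (p.1 j)).eval (s j)) *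
          zetaTerm γ (fun j => s j + (p.2 j : ℂ)) n := by
  unfold expansionTerm
  rw [integral_finsetSum _ fun p _ => (integrable_prod_expansionFactor hγ ε hs n p).const_mul _]
  refine Finset.sum_congr rfl fun p _ => ?_
  rw [integral_const_mul, integral_fintype_prod_volume_eq_prod, zetaTerm_eq, mul_assoc,
    ← Finset.prod_mul_distrib]
  congr 1
  exact Finset.prod_congr rfl fun j _ => integral_expansionFactor (partialSum_re_pos hγ n j) (hs j)

lemma summable_integral_norm_expansionTerm (hγ : ∀ j, 0 < (γ j).re) (ε : ℝ) {s : Fin r → ℂ}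
    (hs : ∀ j, 0 < (s j).re)
    (hs' : ∀ p ∈ exponents r, (fun j => s j + (p.2 j : ℂ)) ∈ convergenceRegion r) :
    Summable fun n => ∫ x, ‖expansionTerm γ ε s n x‖ := by
  refine Summable.of_nonneg_of_le (fun n => integral_nonneg fun x => norm_nonneg _) (fun n => ?_)
    (summable_sum fun p hp =>
      (summable_prod_integral_norm_expansionFactor hγ ε hs (hs' p hp)).mul_left
        ‖(coefficient r p.1 p.2 : ℂ)‖)
  have hint : ∀ p ∈ exponents r, Integrable fun x : Fin r → ℝ =>
      ‖(coefficient r p.1 p.2 : ℂ) *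
        ∏ j, expansionFactor ε (partialSum γ n j) (p.1 j) (p.2 j) (s j) (x j)‖ := fun p _ =>
    ((integrable_prod_expansionFactor hγ ε hs n p).const_mul _).norm
  calc ∫ x, ‖expansionTerm γ ε s n x‖
      ≤ ∫ x : Fin r → ℝ, ∑ p ∈ exponents r, ‖(coefficient r p.1 p.2 : ℂ) *
        ∏ j, expansionFactor ε (partialSum γ n j) (p.1 j) (p.2 j) (s j) (x j)‖ := by
        refine integral_mono_of_nonneg (Eventually.of_forall fun x => norm_nonneg _)
          (integrable_finsetSum _ hint) (Eventually.of_forall fun x => norm_sum_le _ _)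
    _ = _ := by
        rw [integral_finsetSum _ hint]
        refine Finset.sum_congr rfl fun p _ => ?_
        simp_rw [norm_mul, norm_prod]
        rw [integral_const_mul, integral_fintype_prod_volume_eq_prod fun j y =>
          ‖expansionFactor ε (partialSum γ n j) (p.1 j) (p.2 j) (s j) y‖]

/-- Far to the right the desingularized function is the combination of convergent series. -/
lemma DecayingOnPi.normalizedIntegral_eq_shiftedCombination {ρ δ ε : ℝ}
    (hφ : DecayingOnPi ρ δ (limitGenerating γ)) (hδ : 0 < δ) (hε : 0 < ε) (hερ : ε < ρ)
    (hγ : ∀ j, 0 < (γ j).re) {Z : (Fin r → ℂ) → ℂ} (hZ : IsZetaContinuation γ Z) {s : Fin r → ℂ}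
    (hs : ∀ j, 0 < (s j).re)
    (hs' : ∀ p ∈ exponents r, (fun j => s j + (p.2 j : ℂ)) ∈ convergenceRegion r) :
    normalizedIntegral (limitGenerating γ) ε s = shiftedCombination Z s := by
  rw [hφ.normalizedIntegral_eq hδ hε hερ (b := fun _ => true) (s := s) hs, pathIntegral]
  simp_rw [← tsum_expansionTerm hγ]
  have h1 := hasSum_integral_of_summable_integral_norm
    (fun n => integrable_finsetSum _ fun p _ =>
      (integrable_prod_expansionFactor hγ ε hs n p).const_mul _)
    (summable_integral_norm_expansionTerm hγ ε hs hs')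
  refine h1.unique ?_
  have h2 : (fun n => ∫ x, expansionTerm γ ε s n x) = fun n => _ :=
    funext fun n => integral_expansionTerm hγ ε hs n
  refine Eq.mpr (congrArg (HasSum · _) h2) ?_
  exact hasSum_sum fun p hp => (hZ.hasSum _ (hs' p hp)).mul_left _

end Expansion

/-! ### Homogeneity of the generating polynomial -/

/-- The total degree in the variables `v_j`, where `u_j` has degree `0`. -/
def weightHom (r : ℕ) : (Fin r → ℕ) × (Fin r → ℤ) →+ ℤ where
  toFun p := ∑ j, p.2 j
  map_zero' := by simp
  map_add' p q := by simp [Finset.sum_add_distrib]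

section Homogeneity

variable {r : ℕ}

lemma varU_mul_varV_mem (k : Fin r) :
    varU k * varV k ∈ AddMonoidAlgebra.gradeBy ℤ (weightHom r) 1 := by
  have h := AddMonoidAlgebra.single_mem_gradeBy (weightHom r)
    ((Pi.single k 1, 0) + (0, Pi.single k 1)) (1 * 1 : ℤ)
  have hw : weightHom r ((Pi.single k 1, 0) + (0, Pi.single k 1)) = 1 := by simp [weightHom]
  rw [← AddMonoidAlgebra.single_mul_single, hw] at h
  exact h

lemma varVInv_mem (k : Fin r) : varVInv k ∈ AddMonoidAlgebra.gradeBy ℤ (weightHom r) (-1) := by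
  have h := AddMonoidAlgebra.single_mem_gradeBy (weightHom r) (0, Pi.single k (-1)) (1 : ℤ)
  have hw : weightHom r (0, Pi.single k (-1)) = -1 := by simp [weightHom]
  rw [hw] at h
  exact h

lemma varVInvPrev_mem (k : Fin r) :
    varVInvPrev k ∈ AddMonoidAlgebra.gradeBy ℤ (weightHom r) (-1) := by
  rw [varVInvPrev]
  split_ifs
  · exact Submodule.zero_mem _
  · exact varVInv_mem _

/-- Each product u_k v_k has degree 1 and each v_j⁻¹ degree -1, so every factor is homogeneous of
degree 0. -/
lemma generatingPolynomial_mem (r : ℕ) :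
    generatingPolynomial r ∈ AddMonoidAlgebra.gradeBy ℤ (weightHom r) 0 := by
  refine Finset.prod_induction _ (· ∈ AddMonoidAlgebra.gradeBy ℤ (weightHom r) 0)
    (fun a b ha hb => ?_) (SetLike.GradedOne.one_mem) fun j _ => ?_
  · simpa using SetLike.GradedMul.mul_mem ha hb
  · refine Submodule.sub_mem _ SetLike.GradedOne.one_mem ?_
    have h := SetLike.GradedMul.mul_mem
      (Submodule.sum_mem _ fun k (_ : k ∈ Finset.Ici j) => varU_mul_varV_mem k)
      (Submodule.sub_mem _ (varVInv_mem j) (varVInvPrev_mem j))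
    simpa using h

lemma sum_eq_zero_of_mem_exponents {p : (Fin r → ℕ) × (Fin r → ℤ)} (hp : p ∈ exponents r) :
    ∑ j, p.2 j = 0 :=
  generatingPolynomial_mem r p hp

end Homogeneity

/-! ### The identity of meromorphic functions -/

section Identity

variable {r : ℕ} {γ : Fin r → ℂ} {Z D : (Fin r → ℂ) → ℂ}

lemma dense_regularSet (hZ : ∀ p, MeromorphicAtPoint Z p) : Dense (regularSet Z) := by
  have h : regularSet Z = ⋂ p ∈ (exponents r : Set ((Fin r → ℕ) × (Fin r → ℤ))),
      (fun s : Fin r → ℂ => s + fun j => (p.2 j : ℂ)) ⁻¹' {s | HolomorphicAt Z s} := by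
    ext s
    simp only [regularSet, Set.mem_ofPred_eq, Set.mem_iInter, Set.mem_preimage, Finset.mem_coe]
    rfl
  rw [h]
  refine dense_biInter_of_isOpen (fun p _ => ?_) (Finset.countable_toSet _) fun p _ => ?_
  · exact (isOpen_holomorphicAt Z).preimage (by fun_prop)
  · exact (dense_holomorphicAt hZ).preimage (isOpenMap_add_right _)

lemma differentiable_prod_ascPochhammer (l : Fin r → ℕ) :
    Differentiable ℂ fun s : Fin r → ℂ => ∏ j, (ascPochhammer ℂ (l j)).eval (s j) := by
  have h : ∀ j, Differentiable ℂ fun s : Fin r → ℂ => (ascPochhammer ℂ (l j)).eval (s j) :=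
    fun j => Differentiable.comp (g := fun z => (ascPochhammer ℂ (l j)).eval z)
      (Polynomial.differentiable _) (differentiable_apply j)
  exact fun s => (HasFDerivAt.finsetProd fun j _ => (h j s).hasFDerivAt).differentiableAt

lemma meromorphicAtPoint_shiftedCombination (hZ : ∀ p, MeromorphicAtPoint Z p) (s : Fin r → ℂ) :
    MeromorphicAtPoint (shiftedCombination Z) s :=
  MeromorphicAtPoint.sum fun p _ => MeromorphicAtPoint.mul_left
    (HolomorphicAt.of_differentiable ((differentiable_prod_ascPochhammer p.1).const_mul _) s)
    (MeromorphicAtPoint.comp_add_const (a := fun j => (p.2 j : ℂ)) (hZ _))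

lemma continuousAt_shiftedCombination {s : Fin r → ℂ} (hs : s ∈ regularSet Z) :
    ContinuousAt (shiftedCombination Z) s := by
  unfold shiftedCombination
  refine tendsto_finsetSum _ fun p hp => ?_
  refine ContinuousAt.mul
    ((differentiable_prod_ascPochhammer p.1).continuous.continuousAt.const_mul _) ?_
  exact ContinuousAt.comp (f := fun s : Fin r → ℂ => fun j => s j + (p.2 j : ℂ))
    (hs p hp).self_of_nhds.continuousAt (Continuous.continuousAt (by fun_prop))

/-- The points at which all the series in the combination converge form an open set; it contains
all points with sufficiently large real coordinates. -/
lemma exists_eventually_mem_convergenceRegion (r : ℕ) : ∃ s₀ : Fin r → ℂ, ∀ᶠ s in 𝓝 s₀,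
    (∀ j, 0 < (s j).re) ∧
      ∀ p ∈ exponents r, (fun j => s j + (p.2 j : ℂ)) ∈ convergenceRegion r := by
  -- After any of the shifts every coordinate is at least r + 1, so the first summand of a tail
  -- alone exceeds the bound r - j.
  set T : ℝ := r + 1 + ∑ p ∈ exponents r, ∑ j, |(p.2 j : ℝ)| with hT
  have hT0 : 0 < T := by positivity
  refine ⟨fun _ => (T : ℂ), (eventually_all.mpr fun j => ?_).and
    ((Filter.eventually_all_finset _).mpr fun p hp => ?_)⟩
  · have : Continuous fun s : Fin r → ℂ => (s j).re := by fun_prop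
    exact this.continuousAt.eventually_const_lt (by simpa using hT0)
  · have hc : Continuous fun s : Fin r → ℂ => fun j => s j + (p.2 j : ℂ) := by fun_prop
    refine hc.continuousAt.eventually_mem ((isOpen_convergenceRegion r).mem_nhds fun j => ?_)
    have hk : ∀ k, (r : ℝ) + 1 ≤ T + p.2 k := fun k => by
      have h1 : |(p.2 k : ℝ)| ≤ ∑ j, |(p.2 j : ℝ)| :=
        Finset.single_le_sum (f := fun j => |(p.2 j : ℝ)|) (fun _ _ => abs_nonneg _)
          (Finset.mem_univ k)
      have h2 : ∑ j, |(p.2 j : ℝ)| ≤ ∑ p ∈ exponents r, ∑ j, |(p.2 j : ℝ)| :=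
        Finset.single_le_sum (f := fun p : (Fin r → ℕ) × (Fin r → ℤ) => ∑ j, |(p.2 j : ℝ)|)
          (fun _ _ => Finset.sum_nonneg fun _ _ => abs_nonneg _) hp
      have h3 := neg_abs_le (p.2 k : ℝ)
      linarith
    have h1 : T + p.2 j ≤ ∑ k ∈ Finset.Ici j, (T + (p.2 k : ℝ)) :=
      Finset.single_le_sum (f := fun k => T + (p.2 k : ℝ))
        (fun k _ => by linarith [hk k, (Nat.cast_nonneg r : (0 : ℝ) ≤ r)])
        (Finset.mem_Ici.mpr le_rfl)
    simp only [Complex.re_sum, Complex.add_re, Complex.ofReal_re, Complex.intCast_re]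
    linarith [hk j, (Nat.cast_nonneg (j : ℕ) : (0 : ℝ) ≤ (j : ℕ))]

/-- The difference of the two sides is meromorphic and vanishes on an open set far to the right; at
a regular point it is continuous, so it vanishes there too. -/
lemma eq_shiftedCombination (hγ : ∀ j, 0 < (γ j).re) (hD : IsDesingularization γ D)
    (hZ : IsZetaContinuation γ Z) {s : Fin r → ℂ} (hs : s ∈ regularSet Z) :
    D s = shiftedCombination Z s := by
  obtain ⟨ρ, -, δ, hδ, ε, hε, hερ, hφ, hD'⟩ := exists_isDesingularization_normalizedIntegral hγ
  obtain ⟨s₀, hs₀⟩ := exists_eventually_mem_convergenceRegion r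
  have hmer : ∀ q, MeromorphicAtPoint (fun s => D s + -1 * shiftedCombination Z s) q := fun q =>
    (MeromorphicAtPoint.of_differentiable hD.entire q).add
      (MeromorphicAtPoint.mul_left (f := fun _ => -1)
        (HolomorphicAt.of_differentiable (differentiable_const _) q)
        (meromorphicAtPoint_shiftedCombination hZ.meromorphic q))
  have hzero : ∀ᶠ s in 𝓝 s₀, D s + -1 * shiftedCombination Z s = 0 := by
    filter_upwards [hs₀] with s h
    rw [hD.unique hD', hφ.normalizedIntegral_eq_shiftedCombination hδ hε hερ hγ hZ h.1 h.2]
    ring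
  have hcont : ContinuousAt (fun s => D s + -1 * shiftedCombination Z s) s :=
    hD.entire.continuous.continuousAt.add ((continuousAt_shiftedCombination hs).const_mul _)
  linear_combination eq_zero_of_meromorphic hmer hzero hcont

end Identity

end MultipleZeta

end

theorem theorem3 (r : ℕ) (hr : 1 ≤ r) (γ : Fin r → ℂ) (hγ : ∀ j, 0 < (γ j).re) :
    (∃! D : (Fin r → ℂ) → ℂ, MultipleZeta.IsDesingularization γ D) ∧
    (∃ Z : (Fin r → ℂ) → ℂ, MultipleZeta.IsZetaContinuation γ Z) ∧
    (∀ p ∈ MultipleZeta.exponents r, ∑ j, p.2 j = 0) ∧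
    ∀ D Z : (Fin r → ℂ) → ℂ,
      MultipleZeta.IsDesingularization γ D → MultipleZeta.IsZetaContinuation γ Z →
      Dense (MultipleZeta.regularSet Z) ∧
      (∀ s ∈ MultipleZeta.regularSet Z, D s = MultipleZeta.shiftedCombination Z s) ∧
      ∀ s₀ : Fin r → ℂ, Tendsto (MultipleZeta.shiftedCombination Z)
        (𝓝[MultipleZeta.regularSet Z] s₀) (𝓝 (D s₀)) := by
  refine ⟨?_, ?_, fun p hp => MultipleZeta.sum_eq_zero_of_mem_exponents hp, fun D Z hD hZ => ?_⟩
  · obtain ⟨ρ, -, δ, -, ε, -, -, -, hD⟩ :=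
      MultipleZeta.exists_isDesingularization_normalizedIntegral hγ
    exact ⟨_, hD, fun D' hD' => hD'.unique hD⟩
  · obtain ⟨r, rfl⟩ := Nat.exists_eq_add_of_le' hr
    exact MultipleZeta.exists_isZetaContinuation hγ
  · have hident : ∀ s ∈ MultipleZeta.regularSet Z, D s = MultipleZeta.shiftedCombination Z s :=
      fun s hs => MultipleZeta.eq_shiftedCombination hγ hD hZ hs
    refine ⟨MultipleZeta.dense_regularSet hZ.meromorphic, hident, fun s₀ => ?_⟩
    refine (hD.entire.continuous.tendsto s₀).mono_left nhdsWithin_le_nhds |>.congr' ?_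
    filter_upwards [self_mem_nhdsWithin] with s hs using hident s hs
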